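/- **Setting.** Let $n\ge 2$ agents be connected by a connected undirected graph on $\{1,\dots,n\}$ with a symmetric weight matrix $W=(w_{ij})$, $w_{ij}>0$ if $(i,j)$ is an edge and $w_{ij}=0$ otherwise. Let $L=\mathrm{diag}(\sum_j w_{ij})-W$ be its Laplacian, $\underline\lambda$ its smallest positive and $\bar\lambda$ its largest eigenvalue. Agent $i$ has a data distribution $\mathcal D_i$ and a stochastic cost $F_i(x,\xi)$, $x\in\mathbb R^d$, differentiable in $x$; put $f_i(x)=\mathbb E_{\xi\sim\mathcal D_i}F_i(x,\xi)$, $f=\frac1n\sum_i f_i$ and $f^*=\inf f$. Assume: 1. each $f_i$ is differentiable with $\|\nabla f_i(x)-\nabla f_i(y)\|\le L_f\|x-y\|$ for all $x,y$, where $L_f>0$; 2. the samples $\xi_{i,k}\sim\mathcal D_i$ ($1\le i\le n$, $k\ge0$) are independent, $\mathbb E\,\nabla F_i(x,\xi_{i,k})=\nabla f_i(x)$ and $\mathbb E\|\nabla F_i(x,\xi_{i,k})-\nabla f_i(x)\|^2\le\sigma^2$ for all $x$, where $\sigma>0$; 3. $f^*>-\infty$; 4. the random compressor $\mathcal C:\mathbb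 R^d\to\mathbb R^d$ satisfies $\mathbb E_{\mathcal C}\|\mathcal C(x)/r-x\|^2\le(1-\varphi)\|x\|^2+\sigma_{\mathcal C}$ for all $x$, where $\varphi\in(0,1]$, $r>0$, $\sigma_{\mathcal C}\ge0$; its internal randomness is drawn afresh at each time, independently of the past and of the samples. **Algorithm (RCP-SGD).** Let $x_{i,0}\in\mathbb R^d$ be arbitrary and $v_{i,0}=x^c_{i,0}=0$. With parameters $\omega,\beta_1,\beta_2>0$, $\gamma=\beta_1\omega$, $\eta=\beta_2/\omega$, $\alpha_x\in(0,1/r)$ and $h_k=h_0^k$, $h_0\in(0,1)$, iterate $$\hat x_{j,k}=x^c_{j,k}+h_k\,\mathcal C\big((x_{j,k}-x^c_{j,k})/h_k\big),\qquad x^c_{j,k+1}=(1-\alpha_x)x^c_{j,k}+\alpha_x\hat x_{j,k},$$ $$x_{i,k+1}=x_{i,k}-\eta\Big(\gamma\sum_jL_{ij}\hat x_{j,k}+\omega v_{i,k}+\nabla F_i(x_{i,k},\xi_{i,k})\Big),\qquad v_{i,k+1}=v_{i,k}+\eta\omega\sum_jL_{ij}\hat x_{j,k}.$$ Write $\bar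 x_k=\frac1n\sum_ix_{i,k}$. **Thresholds.** Let $\beta_5>0$ be arbitrary, $\varphi_1=\alpha_xr\varphi$, $r_0=2r^2(1-\varphi)+2(1-r)^2$, $c_0=\max\{\frac{9+\beta_5}{2\underline\lambda},1\}$, $\beta_6=\big(\frac{16(1+\beta_1)^2}{\underline\lambda}+\frac{8}{\underline\lambda^2}\big)L_f^2$ and, with $\gamma=\beta_1\omega$, $$\tilde\epsilon_1=\tfrac{\gamma}{2}\underline\lambda-\tfrac{9\omega+4}{4}-\tfrac54L_f^2,\qquad \tilde\epsilon_2=\big(7+\tfrac{16}{\varphi_1}\big)L_f^2+\big(4+\tfrac{8}{\varphi_1}\big)\gamma^2\bar\lambda^2+1+2\omega^2+3\gamma^2\bar\lambda^2,$$ $$\epsilon_4=\tfrac{3\omega-1}{4}-\tfrac{3}{\underline\lambda},\qquad \epsilon_5=2\omega^2\bar\lambda+\tfrac1{\underline\lambda}+\big(4+\tfrac{8}{\varphi_1}\big)\omega^2\underline\lambda,$$ $$\epsilon_6=\tfrac18-\Big(\tfrac{2(1+\beta_1)^2}{\omega^2\underline\lambda}+\tfrac1{\omega^2\underline\lambda^2}\Big)L_f^2,\qquad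 \epsilon_7=\Big(\tfrac{1+\beta_1}{\omega^2\underline\lambda}+\tfrac1{\omega^2\underline\lambda^2}+\tfrac32\Big)L_f^2+L_f,$$ $$\epsilon_{10}=\tfrac{\varphi_1+\varphi_1^2}{2},\qquad \epsilon_{11}=\tfrac12(\gamma+2\omega)\bar\lambda r_0+2\omega r_0,\qquad \epsilon_{12}=\tfrac{(8+7\varphi_1)\gamma^2\bar\lambda^2r_0}{\varphi_1}+(1+2\omega^2)r_0,$$ $$\beta_4(\omega)=\min\Big\{\frac{\tilde\epsilon_1}{\tilde\epsilon_2},\frac{\epsilon_4}{\epsilon_5},\frac{\epsilon_6}{\epsilon_7},\frac{\sqrt{\epsilon_{11}^2+4\epsilon_{10}\epsilon_{12}}-\epsilon_{11}}{2\epsilon_{12}},1\Big\}$$ (the fourth entry is omitted if $r_0=0$), and $$\beta_3(\omega)=\max\Big\{\frac{4+5L_f^2}{\beta_5},\frac{12\underline\lambda^{-1}+1}{3},\sqrt{\beta_6},\frac{\beta_2}{\beta_4(\omega)},4\beta_2L_f\Big\}.$$ **Theorem.** Let $\beta_1>c_0$ and $\beta_2>0$. There are a constant $C_1$, depending only on $L_f,\sigma,\beta_2$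 and an upper bound for $f(\bar x_0)-f^*$, and a constant $C_2$, depending only on these quantities, on $\varphi,r,\sigma_{\mathcal C},\alpha_x,h_0,\beta_1,\beta_5,\underline\lambda,\bar\lambda$ and on upper bounds for $\frac1n\sum_i\|x_{i,0}\|^2$ and $\frac1n\sum_i\|\nabla f_i(\bar x_0)\|^2$ (so neither depends on $n$, $d$, $\omega$ or $T$ otherwise), such that: (a) for every $\omega$ with $\omega>\beta_3(\omega)$, all the expectations below are finite and for every integer $T\ge1$ $$\frac1T\sum_{k=0}^{T-1}\mathbb E\Big[\frac1n\sum_{i=1}^n\|x_{i,k}-\bar x_k\|^2\Big]\le \frac{C_2}{T}+\frac{C_2}{\omega^2},$$ $$\frac1T\sum_{k=0}^{T-1}\mathbb E\|\nabla f(\bar x_k)\|^2\le \frac{C_1\omega}{T}+\frac{C_1}{n\omega}+\frac{C_2}{T}+\frac{C_2}{\omega^2};$$ (b) for every integer $T\ge1$, if $\omega=\beta_2\sqrt T/\sqrt n$ and $T>n(\beta_3(\omega)/\beta_2)^2$, then $$\frac1T\sum_{k=0}^{T-1}\mathbb E\Big[\frac1n\sum_{i=1}^n\|x_{i,k}-\bar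 x_k\|^2\Big]\le \frac{C_2n}{T},\qquad \frac1T\sum_{k=0}^{T-1}\mathbb E\|\nabla f(\bar x_k)\|^2\le\frac{C_1}{\sqrt{nT}}+\frac{C_2n}{T}.$$ -/

import Mathlib

open MeasureTheory ProbabilityTheory

namespace RCPSGD

noncomputable section

/-- The space `ℝ^d` with the Euclidean norm. -/
abbrev Vec (d : ℕ) := EuclideanSpace ℝ (Fin d)

/-! ### The communication graph -/

/-- `W` is a coupling weight matrix of the undirected graph `G`. -/
structure IsWeightMatrix {n : ℕ} (G : SimpleGraph (Fin n)) (W : Matrix (Fin n) (Fin n) ℝ) :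
    Prop where
  symm : W.IsSymm
  pos : ∀ i j, G.Adj i j → 0 < W i j
  zero : ∀ i j, ¬ G.Adj i j → W i j = 0

/-- The weighted Laplacian `D - W`, with `D` the diagonal matrix of the row sums of `W`. -/
def laplacian {n : ℕ} (W : Matrix (Fin n) (Fin n) ℝ) : Matrix (Fin n) (Fin n) ℝ :=
  Matrix.diagonal (fun i => ∑ j, W i j) - W

/-- `lam` is the smallest positive eigenvalue of `L`. -/
def IsMinPosEigenvalue {n : ℕ} (L : Matrix (Fin n) (Fin n) ℝ) (lam : ℝ) : Prop :=
  IsLeast {μ : ℝ | 0 < μ ∧ Module.End.HasEigenvalue (Matrix.toLin' L) μ} lam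

/-- `Lam` is the largest eigenvalue of `L`. -/
def IsMaxEigenvalue {n : ℕ} (L : Matrix (Fin n) (Fin n) ℝ) (Lam : ℝ) : Prop :=
  IsGreatest {μ : ℝ | Module.End.HasEigenvalue (Matrix.toLin' L) μ} Lam

/-! ### The stochastic optimization problem -/

/-- The data of the problem: agent `i` has the data distribution `D i` on `Ξ i` and the
stochastic cost `F i x s` at the decision `x` and the datum `s`. -/
structure Problem (n d : ℕ) (Ξ : Fin n → Type*) [∀ i, MeasurableSpace (Ξ i)] where
  D : ∀ i, Measure (Ξ i)
  F : ∀ i, Vec d → Ξ i → ℝ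

namespace Problem

variable {n d : ℕ} {Ξ : Fin n → Type*} [∀ i, MeasurableSpace (Ξ i)]

/-- The local cost `f_i(x) = E_{s ∼ D_i} F_i(x, s)`. -/
def localCost (p : Problem n d Ξ) (i : Fin n) (x : Vec d) : ℝ :=
  ∫ s, p.F i x s ∂(p.D i)

/-- The global cost `f(x) = (1/n) ∑ᵢ f_i(x)`. -/
def cost (p : Problem n d Ξ) (x : Vec d) : ℝ :=
  (1 / (n : ℝ)) * ∑ i, p.localCost i x

/-- The stochastic gradient: the gradient of `F_i(·, s)` at `x`. -/
def stochGrad (p : Problem n d Ξ) (i : Fin n) (x : Vec d) (s : Ξ i) : Vec d :=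
  gradient (fun y => p.F i y s) x

/-- The objects of the problem are well defined: the expectations defining the local costs exist,
the stochastic costs are differentiable in the decision, and the stochastic gradients are jointly
measurable. -/
structure WellPosed (p : Problem n d Ξ) : Prop where
  integrable : ∀ i x, Integrable (p.F i x) (p.D i)
  differentiable : ∀ i s, Differentiable ℝ (fun x => p.F i x s)
  measurable : ∀ i, Measurable (fun q : Vec d × Ξ i => p.stochGrad i q.1 q.2)

/-- Every local cost is `Lf`-smooth. -/
structure Smooth (p : Problem n d Ξ) (Lf : ℝ) : Prop where
  differentiable : ∀ i, Differentiable ℝ (p.localCost i)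
  lipschitz : ∀ i x y,
    ‖gradient (p.localCost i) x - gradient (p.localCost i) y‖ ≤ Lf * ‖x - y‖

/-- The stochastic gradients are unbiased, with variance at most `σ ^ 2`. -/
structure UnbiasedBoundedVariance (p : Problem n d Ξ) (σ : ℝ) : Prop where
  unbiased : ∀ i x, ∫ s, p.stochGrad i x s ∂(p.D i) = gradient (p.localCost i) x
  integrable : ∀ i x,
    Integrable (fun s => ‖p.stochGrad i x s - gradient (p.localCost i) x‖ ^ 2) (p.D i)
  variance : ∀ i x,
    ∫ s, ‖p.stochGrad i x s - gradient (p.localCost i) x‖ ^ 2 ∂(p.D i) ≤ σ ^ 2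

end Problem

/-! ### Compressors -/

/-- The stochastic compressor `x ↦ C x z`, with internal randomness `z ∼ Q`, has relative and
absolute compression errors governed by `φ`, `r` and `σC`. -/
structure IsCompressor {d : ℕ} {Z : Type*} [MeasurableSpace Z] (Q : Measure Z)
    (C : Vec d → Z → Vec d) (φ r σC : ℝ) : Prop where
  measurable : Measurable (fun q : Vec d × Z => C q.1 q.2)
  integrable : ∀ x, Integrable (fun z => ‖(1 / r) • C x z - x‖ ^ 2) Q
  error : ∀ x, ∫ z, ‖(1 / r) • C x z - x‖ ^ 2 ∂Q ≤ (1 - φ) * ‖x‖ ^ 2 + σC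

/-! ### Sampling -/

/-- `ξ i k` is the datum drawn by agent `i` at time `k` and `ζ i k` the internal randomness of the
compressor used by agent `i` at time `k`. The data are independent over all agents and times, the
compressor draws are independent over time (nothing is asked about different agents at one and
the same time), and the data are independent of the compressor draws. -/
structure IsSampling {n : ℕ} {Ξ : Fin n → Type*} [∀ i, MeasurableSpace (Ξ i)]
    {Z Ω : Type*} [MeasurableSpace Z] [MeasurableSpace Ω]
    (D : ∀ i, Measure (Ξ i)) (Q : Measure Z) (P : Measure Ω)
    (ξ : ∀ i, ℕ → Ω → Ξ i) (ζ : Fin n → ℕ → Ω → Z) : Prop where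
  measurable_data : ∀ i k, Measurable (ξ i k)
  law_data : ∀ i k, P.map (ξ i k) = D i
  measurable_comp : ∀ i k, Measurable (ζ i k)
  law_comp : ∀ i k, P.map (ζ i k) = Q
  indep_data : iIndepFun (β := fun q : Fin n × ℕ => Ξ q.1) (fun q => ξ q.1 q.2) P
  indep_comp : iIndepFun (fun (k : ℕ) (a : Ω) (i : Fin n) => ζ i k a) P
  indep_data_comp :
    IndepFun (fun (a : Ω) (q : Fin n × ℕ) => ξ q.1 q.2 a)
      (fun (a : Ω) (q : Fin n × ℕ) => ζ q.1 q.2 a) P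

/-! ### The algorithm -/

/-- The variables of all agents: primal `x`, dual `v`, auxiliary `c` (written `x^c`). -/
structure State (n d : ℕ) where
  x : Fin n → Vec d
  v : Fin n → Vec d
  c : Fin n → Vec d

/-- One step of RCP-SGD with Laplacian `L`, parameters `η γ ω α h`, compressor realizations
`comp i` and stochastic gradient realizations `grad i`. -/
def step {n d : ℕ} (L : Matrix (Fin n) (Fin n) ℝ) (η γ ω α h : ℝ)
    (comp : Fin n → Vec d → Vec d) (grad : Fin n → Vec d → Vec d) (S : State n d) : State n d :=
  let xhat : Fin n → Vec d := fun j => S.c j + h • comp j ((1 / h) • (S.x j - S.c j))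
  { x := fun i => S.x i - η • (γ • (∑ j, L i j • xhat j) + ω • S.v i + grad i (S.x i))
    v := fun i => S.v i + (η * ω) • ∑ j, L i j • xhat j
    c := fun j => (1 - α) • S.c j + α • xhat j }

/-- RCP-SGD with parameter sequences `η γ ω h`, from the initial point `x₀` (and zero dual and
auxiliary variables), along the data `s` and the compressor draws `z`. -/
def iterate {n d : ℕ} {Ξ : Fin n → Type*} {Z : Type*} (L : Matrix (Fin n) (Fin n) ℝ)
    (η γ ω h : ℕ → ℝ) (α : ℝ) (C : Vec d → Z → Vec d) (g : ∀ i, Vec d → Ξ i → Vec d)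
    (x₀ : Fin n → Vec d) (s : ∀ i, ℕ → Ξ i) (z : Fin n → ℕ → Z) : ℕ → State n d
  | 0 => { x := x₀, v := fun _ => 0, c := fun _ => 0 }
  | k + 1 =>
      step L (η k) (γ k) (ω k) α (h k) (fun i y => C y (z i k)) (fun i y => g i y (s i k))
        (iterate L η γ ω h α C g x₀ s z k)

/-- The random primal iterates `x_{i,k}` of RCP-SGD with the constant parameters
`ω_k = ω`, `γ_k = β₁ ω`, `η_k = β₂ / ω` and the scaling `h_k = h₀ ^ k`. -/
def primal {n d : ℕ} {Ξ : Fin n → Type*} [∀ i, MeasurableSpace (Ξ i)] {Z Ω : Type*}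
    (p : Problem n d Ξ) (W : Matrix (Fin n) (Fin n) ℝ) (C : Vec d → Z → Vec d)
    (x₀ : Fin n → Vec d) (ξ : ∀ i, ℕ → Ω → Ξ i) (ζ : Fin n → ℕ → Ω → Z)
    (β₁ β₂ α h₀ ω : ℝ) (k : ℕ) (a : Ω) : Fin n → Vec d :=
  (iterate (laplacian W) (fun _ => β₂ / ω) (fun _ => β₁ * ω) (fun _ => ω) (fun k => h₀ ^ k) α C
    p.stochGrad x₀ (fun i k => ξ i k a) (fun i k => ζ i k a) k).x

/-- The average of the agents' vectors. -/
def mean {n d : ℕ} (x : Fin n → Vec d) : Vec d := (1 / (n : ℝ)) • ∑ i, x i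

/-- The consensus error `(1/n) ∑ᵢ ‖xᵢ - x̄‖²`. -/
def consensusError {n d : ℕ} (x : Fin n → Vec d) : ℝ :=
  (1 / (n : ℝ)) * ∑ i, ‖x i - mean x‖ ^ 2

/-- The time average `(1/T) ∑_{k<T} E[Y_k]`. -/
def timeAvg {Ω : Type*} [MeasurableSpace Ω] (P : Measure Ω) (Y : ℕ → Ω → ℝ) (T : ℕ) : ℝ :=
  (1 / (T : ℝ)) * ∑ k ∈ Finset.range T, ∫ a, Y k a ∂P

/-! ### The thresholds

`lam` and `Lam` are the smallest positive and the largest eigenvalue of the Laplacian,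
`φ₁ = α r φ`, and `γ = β₁ ω`. -/

/-- The constant of the relative error of the unscaled compressor. -/
def r0 (φ r : ℝ) : ℝ := 2 * r ^ 2 * (1 - φ) + 2 * (1 - r) ^ 2

def eps1 (lam Lf β₁ ω : ℝ) : ℝ :=
  β₁ * ω / 2 * lam - ((9 * ω + 4) / 4 + 5 / 4 * Lf ^ 2)

def eps2 (Lam Lf φ₁ β₁ ω : ℝ) : ℝ :=
  (7 + 16 / φ₁) * Lf ^ 2 + (4 + 8 / φ₁) * (β₁ * ω) ^ 2 * Lam ^ 2 + 1 + 2 * ω ^ 2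
    + 3 * (β₁ * ω) ^ 2 * Lam ^ 2

def eps4 (lam ω : ℝ) : ℝ := (3 * ω - 1) / 4 - 3 * lam⁻¹

def eps5 (lam Lam φ₁ ω : ℝ) : ℝ :=
  2 * ω ^ 2 * Lam + lam⁻¹ + (4 + 8 / φ₁) * ω ^ 2 * lam

def eps6 (lam Lf β₁ ω : ℝ) : ℝ :=
  1 / 8 - (2 * (1 + β₁) ^ 2 / (ω ^ 2 * lam) + 1 / (ω ^ 2 * lam ^ 2)) * Lf ^ 2

def eps7 (lam Lf β₁ ω : ℝ) : ℝ :=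
  ((1 + β₁) / (ω ^ 2 * lam) + 1 / (ω ^ 2 * lam ^ 2) + 3 / 2) * Lf ^ 2 + Lf

def eps10 (φ₁ : ℝ) : ℝ := φ₁ / 2 + φ₁ ^ 2 / 2

def eps11 (Lam ρ β₁ ω : ℝ) : ℝ := 1 / 2 * (β₁ * ω + 2 * ω) * Lam * ρ + 2 * ω * ρ

def eps12 (Lam φ₁ ρ β₁ ω : ℝ) : ℝ :=
  (8 + 7 * φ₁) * (β₁ * ω) ^ 2 * Lam ^ 2 * ρ / φ₁ + (1 + 2 * ω ^ 2) * ρ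

/-- The positive root in `t` of `ε₁₀ - t ε₁₁ - t² ε₁₂ = 0`, where `ρ = r₀`. For `ρ = 0` the
left-hand side is a positive constant and there is no constraint on `t`; the value is then `1`,
which is neutral in the minimum `beta4`. -/
def compressionRoot (Lam φ₁ ρ β₁ ω : ℝ) : ℝ :=
  open Classical in
  if ρ = 0 then 1
  else (Real.sqrt (eps11 Lam ρ β₁ ω ^ 2 + 4 * eps10 φ₁ * eps12 Lam φ₁ ρ β₁ ω)
      - eps11 Lam ρ β₁ ω) / (2 * eps12 Lam φ₁ ρ β₁ ω)

def beta4 (lam Lam Lf φ r α β₁ ω : ℝ) : ℝ :=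
  min (eps1 lam Lf β₁ ω / eps2 Lam Lf (α * r * φ) β₁ ω)
    (min (eps4 lam ω / eps5 lam Lam (α * r * φ) ω)
      (min (eps6 lam Lf β₁ ω / eps7 lam Lf β₁ ω)
        (min (compressionRoot Lam (α * r * φ) (r0 φ r) β₁ ω) 1)))

def beta6 (lam Lf β₁ : ℝ) : ℝ :=
  (16 * (1 + β₁) ^ 2 / lam + 8 / lam ^ 2) * Lf ^ 2

/-- The threshold for `β₁`. -/
def c0 (lam β₅ : ℝ) : ℝ := max ((9 + β₅) / (2 * lam)) 1

/-- The threshold for `ω`. As `beta4` depends on `ω`, so does `beta3`; the requirement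
`beta3 … ω < ω` is an implicit condition on `ω`. Its other entries make the numerators in `beta4`
positive, so that the entry `β₂ / beta4` says `β₂ / ω < beta4`. -/
def beta3 (lam Lam Lf φ r α β₁ β₂ β₅ ω : ℝ) : ℝ :=
  max ((4 + 5 * Lf ^ 2) / β₅)
    (max ((12 * lam⁻¹ + 1) / 3)
      (max (Real.sqrt (beta6 lam Lf β₁))
        (max (β₂ / beta4 lam Lam Lf φ r α β₁ ω) (4 * β₂ * Lf))))

end

end RCPSGD

namespace RCPSGD

/-! Because `γ = β₁ω` and `η = β₂/ω`, the products `ηγ = β₁β₂` and `ηω = β₂` are free of `ω`. Shift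
the dual variable to `y_i = v_i + ∇f_i(x̄)/ω`, which absorbs the heterogeneity of the agents. Along
a Laplacian eigenvector with eigenvalue `μ > 0`, the pair `(x, y)` then follows a linear recursion
independent of `ω`. It is perturbed by the compression error and, divided by `ω`, by `∇f_i(x_i) -
∇f_i(x̄)`, by the gradient noise and by the drift of `∇f_i(x̄)`. The quadratic form `modeLyap`
decreases along this recursion (`modeLyap_step_le`), and summing over the modes gives
`IsEigenbasis.consensusLyap_contract`.

Three quantities feed each other: the consensus form, the compression error `∑ᵢ ‖x_i - x^c_i‖²` and
the cost at the mean. In `Run.lyap` they are weighted so that every leak is paid. The compression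
error contracts at rate `φ₁` up to the displacement `‖x_{k+1} - x_k‖²`
(`integral_compression_succ_le`), and the consensus step leaves room for exactly that displacement.
The mean gradient that drives the displacement is paid by the term `-3/8 η ‖mean gradient‖²` of the
cost descent (`cost_step_le`). The consensus error appearing in the cost descent is paid by the
consensus decay. What remains, in `lyap_succ_le`, is a decrease by `β₂/4` times the consensus error,
against `n·O(1/ω²)` from the noise and `n·O(h₀^{2k})` from the absolute compression error, which is
summable. Telescoping gives the consensus rate.

For the gradient rate the cost descent alone is telescoped. Independence of the agents reduces the
noise of the mean to `σ²/n`, and the consensus error enters multiplied by `Lf²`. Hence the leading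
constant depends only on `Lf`, `σ`, `β₂` and `Δ₀`. Part (b) substitutes `ω = β₂√T/√n`.

The thresholds enter only through `admissible_of_beta3_lt`. The probabilistic input is that the
state at time `k` is a function of the draws before `k`, so that Fubini can replace conditional
expectations. -/

/-! ### One step of the dynamics in a single Laplacian mode -/

/-- The quadratic Lyapunov function of a mode with Laplacian eigenvalue `μ`. -/
noncomputable def modeLyap (A μ x y : ℝ) : ℝ := x ^ 2 + (1 + A) / μ * y ^ 2 + 2 / μ * (x * y)

/-- Completing the square in `x` leaves a multiple `(1 + A)μ - 1` of `(y/μ)²`. -/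
lemma modeLyap_nonneg {A μ : ℝ} (hμ : 0 < μ) (h : 1 ≤ (1 + A) * μ) (x y : ℝ) :
    0 ≤ modeLyap A μ x y := by
  have e : modeLyap A μ x y = (x + y / μ) ^ 2 + ((1 + A) * μ - 1) * (y / μ) ^ 2 := by
    unfold modeLyap; field_simp; ring
  rw [e]
  have : 0 ≤ (1 + A) * μ - 1 := by linarith
  positivity

/-- Weighted Cauchy–Schwarz: the reciprocals of the weights 4, 4, 3, 12, 12 sum to 1. The third slot
will hold the dual variable and gets the smallest weight. -/
lemma sq_sum_five_le (v₁ v₂ v₃ v₄ v₅ : ℝ) :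
    (v₁ + v₂ + v₃ + v₄ + v₅) ^ 2 ≤
      4 * v₁ ^ 2 + 4 * v₂ ^ 2 + 3 * v₃ ^ 2 + 12 * v₄ ^ 2 + 12 * v₅ ^ 2 := by
  have h1 : (v₁ + v₂ + (v₃ + v₄ + v₅)) ^ 2 ≤ 2 * (v₁ + v₂) ^ 2 + 2 * (v₃ + v₄ + v₅) ^ 2 := by
    nlinarith [sq_nonneg (v₁ + v₂ - (v₃ + v₄ + v₅))]
  have h2 : (v₁ + v₂) ^ 2 ≤ 2 * v₁ ^ 2 + 2 * v₂ ^ 2 := by nlinarith [sq_nonneg (v₁ - v₂)]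
  have h3 : (v₃ + (v₄ + v₅)) ^ 2 ≤ 3 / 2 * v₃ ^ 2 + 3 * (v₄ + v₅) ^ 2 := by
    nlinarith [sq_nonneg (v₃ - 2 * (v₄ + v₅))]
  have h4 : (v₄ + v₅) ^ 2 ≤ 2 * v₄ ^ 2 + 2 * v₅ ^ 2 := by nlinarith [sq_nonneg (v₄ - v₅)]
  have e1 : v₁ + v₂ + v₃ + v₄ + v₅ = v₁ + v₂ + (v₃ + v₄ + v₅) := by ring
  have e2 : v₃ + v₄ + v₅ = v₃ + (v₄ + v₅) := by ring
  rw [e1]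
  rw [e2] at h1 ⊢
  linarith

/-- The weights of `modeLyap` make the first-order `x * y` terms cancel, leaving the decrease `2b(Aμ
- 1)x² + 2b y²/μ`; all other terms are split by Young's inequality. Here `e` is the compression
error, `p` the gradient difference caused by disagreement, `N` the noise and `δ` the drift of the
shifted dual variable. The squared displacement on the left will pay for the compression recursion.
The noise is bounded pathwise, since its cost `1/ω²` is affordable without cancellation. -/
lemma modeLyap_step_le {b A μ ω B : ℝ} (hb : 0 < b) (hA : 1 ≤ A) (hμ : 0 < μ) (hω : 0 < ω)
    (hB : 0 ≤ B) (hBμ : 2 * b * μ + 3 / 2 * B * b * μ ≤ 15 / 16) (x y e p N δ : ℝ) :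
    modeLyap A μ (x - b * (A * μ * (x + e) + y + (p + N) / ω)) (y + b * μ * (x + e) + δ)
      + (B - 3) / 2 * (b * (A * μ * (x + e) + y + (p + N) / ω)) ^ 2 ≤
    modeLyap A μ x y
      + b * ((-(A * μ) + 15 / 4 + 1 / ω + b + 2 * B * A ^ 2 * b * μ ^ 2) * x ^ 2
        + (A * μ + 19 / 8 + 2 * μ + b + 2 * B * A ^ 2 * b * μ ^ 2) * e ^ 2
        + (1 / ω + 8 / (ω ^ 2 * μ) + 16 * (b / ω) ^ 2 + 6 * B * b / ω ^ 2) * p ^ 2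
        + (8 / ω ^ 2 + 16 / (ω ^ 2 * μ) + 16 * (b / ω) ^ 2 + 6 * B * b / ω ^ 2) * N ^ 2)
      + (8 / 3 * (1 + A) ^ 2 / (b * μ) + 4 / 3 / (b * μ ^ 2) + 16 * b * (1 + A) ^ 2
        + (1 + A) / μ + 2 / μ ^ 2) * δ ^ 2 := by
  set D := b * (A * μ * (x + e) + y + (p + N) / ω) with hD
  have hsq : D ^ 2 ≤ 4 * (A * b * μ * x) ^ 2 + 4 * (A * b * μ * e) ^ 2 + 3 * (b * y) ^ 2
      + 12 * (b / ω * p) ^ 2 + 12 * (b / ω * N) ^ 2 := by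
    have := sq_sum_five_le (A * b * μ * x) (A * b * μ * e) (b * y) (b / ω * p) (b / ω * N)
    have e1 : D = A * b * μ * x + A * b * μ * e + b * y + b / ω * p + b / ω * N := by
      rw [hD]; field_simp; ring
    rw [e1]; exact this
  have hsq' := mul_le_mul_of_nonneg_left hsq (by positivity : 0 ≤ B / 2)
  -- Of the decrease `2b y²/μ`, the bounds `i3`, `i6`, `i7`, `i8` take `1/2`, `1/8`, `1/16`, `3/8`.
  -- The remaining `15/16` must cover `i11`, used twice, and the dual part of `D²`.
  have hy : b * ((2 * b * μ + 3 / 2 * B * b * μ) * (y ^ 2 / μ)) ≤ b * (15 / 16 * (y ^ 2 / μ)) := by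
    gcongr
  -- Exact expansion. The `(x + e)²` terms of second order collect into the factor `1 - A ≤ 0`, and
  -- `D²` gets `1 + (B - 3)/2 = (B - 1)/2`.
  have key : modeLyap A μ (x - D) (y + b * μ * (x + e) + δ) + (B - 3) / 2 * D ^ 2 =
      modeLyap A μ x y - 2 * A * b * μ * x ^ 2 + 2 * b * x ^ 2 - 2 * b * (y ^ 2 / μ)
      - 2 * A * b * μ * x * e + 2 * b * x * e + 2 * b * e * y
      - 2 * (b / ω) * x * p - 2 * (b / ω) * x * N - 2 * b / (ω * μ) * (p * y)
      - 2 * b / (ω * μ) * (N * y) + 2 * (1 + A) / μ * (y * δ) + 2 / μ * (x * δ)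
      + (1 - A) * b ^ 2 * μ * (x + e) ^ 2 - 2 * b ^ 2 * (y * x) - 2 * b ^ 2 * (y * e)
      - 2 * (b / ω) * b * (p * x) - 2 * (b / ω) * b * (p * e)
      - 2 * (b / ω) * b * (N * x) - 2 * (b / ω) * b * (N * e)
      + 2 * (1 + A) * b * (x * δ) + 2 * (1 + A) * b * (e * δ) + (1 + A) / μ * δ ^ 2
      - 2 / μ * (D * δ) + (B - 1) / 2 * D ^ 2 := by
    unfold modeLyap
    rw [hD]; field_simp; ring
  have i1 : - (2 * A * b * μ * x * e) ≤ A * b * μ * x ^ 2 + A * b * μ * e ^ 2 := by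
    have : 0 ≤ A * b * μ * (x + e) ^ 2 := by positivity
    linarith [this, (by ring : A * b * μ * (x + e) ^ 2 =
      A * b * μ * x ^ 2 + A * b * μ * e ^ 2 + 2 * A * b * μ * x * e)]
  have i2 : 2 * b * x * e ≤ b * (x ^ 2 / 2 + 2 * e ^ 2) := by
    have : 0 ≤ b * (x - 2 * e) ^ 2 / 2 := by positivity
    linarith [(by ring : b * (x - 2 * e) ^ 2 / 2 = b * (x ^ 2 / 2 + 2 * e ^ 2) - 2 * b * x * e)]
  have i3 : 2 * b * e * y ≤ b * (1 / 2 * (y ^ 2 / μ) + 2 * μ * e ^ 2) := by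
    have : 0 ≤ b / (2 * μ) * (y - 2 * μ * e) ^ 2 := by positivity
    have e1 : b / (2 * μ) * (y - 2 * μ * e) ^ 2 =
      b * (1 / 2 * (y ^ 2 / μ) + 2 * μ * e ^ 2) - 2 * b * e * y := by field_simp; ring
    linarith
  have i4 : - (2 * (b / ω) * x * p) ≤ b * (1 / ω * x ^ 2 + 1 / ω * p ^ 2) := by
    have : 0 ≤ b / ω * (x + p) ^ 2 := by positivity
    have e1 : b / ω * (x + p) ^ 2 =
      b * (1 / ω * x ^ 2 + 1 / ω * p ^ 2) + 2 * (b / ω) * x * p := by field_simp; ring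
    linarith
  have i5 : - (2 * (b / ω) * x * N) ≤ b * (x ^ 2 / 8 + 8 / ω ^ 2 * N ^ 2) := by
    have : 0 ≤ b / 8 * (x + 8 / ω * N) ^ 2 := by positivity
    have e1 : b / 8 * (x + 8 / ω * N) ^ 2 =
      b * (x ^ 2 / 8 + 8 / ω ^ 2 * N ^ 2) + 2 * (b / ω) * x * N := by field_simp; ring
    linarith
  have i6 : - (2 * b / (ω * μ) * (p * y)) ≤
      b * (1 / 8 * (y ^ 2 / μ) + 8 / (ω ^ 2 * μ) * p ^ 2) := by
    have : 0 ≤ b / (8 * μ) * (y + 8 / ω * p) ^ 2 := by positivity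
    have e1 : b / (8 * μ) * (y + 8 / ω * p) ^ 2 =
      b * (1 / 8 * (y ^ 2 / μ) + 8 / (ω ^ 2 * μ) * p ^ 2) + 2 * b / (ω * μ) * (p * y) := by
      field_simp; ring
    linarith
  have i7 : - (2 * b / (ω * μ) * (N * y)) ≤
      b * (1 / 16 * (y ^ 2 / μ) + 16 / (ω ^ 2 * μ) * N ^ 2) := by
    have : 0 ≤ b / (16 * μ) * (y + 16 / ω * N) ^ 2 := by positivity
    have e1 : b / (16 * μ) * (y + 16 / ω * N) ^ 2 =
      b * (1 / 16 * (y ^ 2 / μ) + 16 / (ω ^ 2 * μ) * N ^ 2) + 2 * b / (ω * μ) * (N * y) := by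
      field_simp; ring
    linarith
  have i8 : 2 * (1 + A) / μ * (y * δ) ≤
      b * (3 / 8 * (y ^ 2 / μ)) + 8 / 3 * (1 + A) ^ 2 / (b * μ) * δ ^ 2 := by
    have : 0 ≤ 3 * b / (8 * μ) * (y - 8 * (1 + A) / (3 * b) * δ) ^ 2 := by positivity
    have e1 : 3 * b / (8 * μ) * (y - 8 * (1 + A) / (3 * b) * δ) ^ 2 =
      b * (3 / 8 * (y ^ 2 / μ)) + 8 / 3 * (1 + A) ^ 2 / (b * μ) * δ ^ 2
        - 2 * (1 + A) / μ * (y * δ) := by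
      field_simp; ring
    linarith
  have i9 : 2 / μ * (x * δ) ≤ b * (3 / 4 * x ^ 2) + 4 / 3 / (b * μ ^ 2) * δ ^ 2 := by
    have : 0 ≤ 3 * b / 4 * (x - 4 / (3 * b * μ) * δ) ^ 2 := by positivity
    have e1 : 3 * b / 4 * (x - 4 / (3 * b * μ) * δ) ^ 2 =
      b * (3 / 4 * x ^ 2) + 4 / 3 / (b * μ ^ 2) * δ ^ 2 - 2 / μ * (x * δ) := by
      field_simp; ring
    linarith
  have i10 : (1 - A) * b ^ 2 * μ * (x + e) ^ 2 ≤ 0 := by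
    have : 0 ≤ (A - 1) * (b ^ 2 * μ * (x + e) ^ 2) :=
      mul_nonneg (by linarith) (by positivity)
    linarith [(by ring : (A - 1) * (b ^ 2 * μ * (x + e) ^ 2) =
      -((1 - A) * b ^ 2 * μ * (x + e) ^ 2))]
  have i11 : ∀ z : ℝ, - (2 * b ^ 2 * (y * z)) ≤ b * (b * μ * (y ^ 2 / μ) + b * z ^ 2) := by
    intro z
    have : 0 ≤ b ^ 2 * (y + z) ^ 2 := by positivity
    have e1 : b ^ 2 * (y + z) ^ 2 =
      b * (b * μ * (y ^ 2 / μ) + b * z ^ 2) + 2 * b ^ 2 * (y * z) := by field_simp; ring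
    linarith
  have i12 : ∀ q z : ℝ, - (2 * (b / ω) * b * (q * z)) ≤
      b * (z ^ 2 / 8 + 8 * (b / ω) ^ 2 * q ^ 2) := by
    intro q z
    have : 0 ≤ b / 8 * (z + 8 * (b / ω) * q) ^ 2 := by positivity
    linarith [(by ring : b / 8 * (z + 8 * (b / ω) * q) ^ 2 =
      b * (z ^ 2 / 8 + 8 * (b / ω) ^ 2 * q ^ 2) + 2 * (b / ω) * b * (q * z))]
  have i13 : ∀ z : ℝ, 2 * (1 + A) * b * (z * δ) ≤
      b * (z ^ 2 / 8) + 8 * b * (1 + A) ^ 2 * δ ^ 2 := by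
    intro z
    have : 0 ≤ b / 8 * (z - 8 * (1 + A) * δ) ^ 2 := by positivity
    linarith [(by ring : b / 8 * (z - 8 * (1 + A) * δ) ^ 2 =
      b * (z ^ 2 / 8) + 8 * b * (1 + A) ^ 2 * δ ^ 2 - 2 * (1 + A) * b * (z * δ))]
  -- The half of `D²` spent here raises its coefficient to the `B / 2` of `hsq'`.
  have i14 : - (2 / μ * (D * δ)) ≤ 1 / 2 * D ^ 2 + 2 / μ ^ 2 * δ ^ 2 := by
    have : 0 ≤ 1 / 2 * (D + 2 / μ * δ) ^ 2 := by positivity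
    have e1 : 1 / 2 * (D + 2 / μ * δ) ^ 2 =
      1 / 2 * D ^ 2 + 2 / μ ^ 2 * δ ^ 2 + 2 / μ * (D * δ) := by field_simp; ring
    linarith
  have hDexp : B / 2 * (4 * (A * b * μ * x) ^ 2 + 4 * (A * b * μ * e) ^ 2 + 3 * (b * y) ^ 2
      + 12 * (b / ω * p) ^ 2 + 12 * (b / ω * N) ^ 2) =
      b * (2 * B * A ^ 2 * b * μ ^ 2 * x ^ 2 + 2 * B * A ^ 2 * b * μ ^ 2 * e ^ 2
        + 3 / 2 * B * b * μ * (y ^ 2 / μ) + 6 * B * b / ω ^ 2 * p ^ 2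
        + 6 * B * b / ω ^ 2 * N ^ 2) := by
    field_simp; ring
  rw [hDexp] at hsq'
  rw [key]
  have j1 := i11 x
  have j2 := i11 e
  have j3 := i12 p x
  have j4 := i12 p e
  have j5 := i12 N x
  have j6 := i12 N e
  have j7 := i13 x
  have j8 := i13 e
  linarith

/-! ### Spectral decomposition of the Laplacian of a connected weighted graph -/

section Graph

variable {n : ℕ} {G : SimpleGraph (Fin n)} {W : Matrix (Fin n) (Fin n) ℝ}

lemma sum_laplacian_mul (W : Matrix (Fin n) (Fin n) ℝ) (i : Fin n) (z : Fin n → ℝ) :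
    ∑ j, laplacian W i j * z j = ∑ j, W i j * (z i - z j) := by
  simp only [laplacian, Matrix.sub_apply, Matrix.diagonal_apply, sub_mul, mul_sub,
    Finset.sum_sub_distrib, ite_mul, zero_mul, Finset.sum_ite_eq, Finset.mem_univ, if_true,
    Finset.sum_mul]

lemma IsWeightMatrix.laplacian_comm (hW : IsWeightMatrix G W) (i j : Fin n) :
    laplacian W i j = laplacian W j i := by
  have h := hW.symm.apply i j
  by_cases hij : i = j
  · rw [hij]
  · simp [laplacian, hij, Ne.symm hij, h]

lemma IsWeightMatrix.quadratic_form (hW : IsWeightMatrix G W) (z : Fin n → ℝ) :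
    2 * ∑ i, z i * ∑ j, laplacian W i j * z j = ∑ i, ∑ j, W i j * (z i - z j) ^ 2 := by
  have h1 : ∑ i, z i * ∑ j, laplacian W i j * z j = ∑ i, ∑ j, W i j * (z i * (z i - z j)) := by
    refine Finset.sum_congr rfl fun i _ => ?_
    rw [sum_laplacian_mul, Finset.mul_sum]
    exact Finset.sum_congr rfl fun j _ => by ring
  have h2 : ∑ i, ∑ j, W i j * (z i * (z i - z j)) = ∑ i, ∑ j, W i j * (z j * (z j - z i)) := by
    rw [Finset.sum_comm]
    refine Finset.sum_congr rfl fun i _ => Finset.sum_congr rfl fun j _ => ?_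
    rw [hW.symm.apply i j]
  have h3 : ∑ i, ∑ j, W i j * (z i - z j) ^ 2 =
      ∑ i, ∑ j, W i j * (z i * (z i - z j)) + ∑ i, ∑ j, W i j * (z j * (z j - z i)) := by
    simp only [← Finset.sum_add_distrib]
    exact Finset.sum_congr rfl fun i _ => Finset.sum_congr rfl fun j _ => by ring
  rw [h3, ← h2, h1]
  ring

lemma IsWeightMatrix.nonneg (hW : IsWeightMatrix G W) (i j : Fin n) : 0 ≤ W i j := by
  by_cases h : G.Adj i j
  · exact (hW.pos i j h).le
  · exact (hW.zero i j h).ge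

/-- The quadratic form is a sum of nonnegative edge terms, so it vanishes only if `z` agrees across
every edge, hence along every walk. -/
lemma IsWeightMatrix.eq_of_laplacian_eq_zero (hW : IsWeightMatrix G W) (hG : G.Connected)
    {z : Fin n → ℝ} (hz : ∀ i, ∑ j, laplacian W i j * z j = 0) (i j : Fin n) : z i = z j := by
  have h0 := hW.quadratic_form z
  simp only [hz, mul_zero, Finset.sum_const_zero] at h0
  have hn : ∀ i j, 0 ≤ W i j * (z i - z j) ^ 2 :=
    fun i j => mul_nonneg (hW.nonneg i j) (sq_nonneg _)
  have hadj : ∀ i j, G.Adj i j → z i = z j := by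
    intro i j hij
    have h1 := (Finset.sum_eq_zero_iff_of_nonneg
      (fun i _ => Finset.sum_nonneg fun j _ => hn i j)).1 h0.symm i (Finset.mem_univ i)
    have h2 := (Finset.sum_eq_zero_iff_of_nonneg (fun j _ => hn i j)).1 h1 j (Finset.mem_univ j)
    rcases mul_eq_zero.1 h2 with h | h
    · exact absurd h (hW.pos i j hij).ne'
    · exact sub_eq_zero.1 (pow_eq_zero_iff (two_ne_zero)|>.1 h)
  obtain ⟨w⟩ := hG.preconnected i j
  induction w with
  | nil => rfl
  | cons h _ ih => exact (hadj _ _ h).trans ih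

/-- An orthonormal eigenbasis of the Laplacian, stored as the matrix `U` whose columns are the
eigenvectors, with eigenvalues `μ`. -/
structure IsEigenbasis (W : Matrix (Fin n) (Fin n) ℝ) (lam Lam : ℝ) (U : Fin n → Fin n → ℝ)
    (μ : Fin n → ℝ) : Prop where
  parseval : ∀ z : Fin n → ℝ, ∑ l, (∑ i, U i l * z i) ^ 2 = ∑ i, z i ^ 2
  eigen : ∀ (z : Fin n → ℝ) (l : Fin n),
    ∑ i, U i l * ∑ j, laplacian W i j * z j = μ l * ∑ i, U i l * z i
  bounds : ∀ l, μ l ≠ 0 → lam ≤ μ l ∧ μ l ≤ Lam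
  const : ∀ l, μ l = 0 → ∃ c, ∀ i, U i l = c
  sum_eq_zero : ∀ l, μ l ≠ 0 → ∑ i, U i l = 0

/-- The spectral theorem gives the basis, and the quadratic form makes the eigenvalues nonnegative,
so `lam` and `Lam` bracket the nonzero ones. Connectedness makes kernel vectors constant; testing an
eigenvector of nonzero eigenvalue against the constants gives it zero sum. -/
lemma exists_isEigenbasis (hG : G.Connected) (hW : IsWeightMatrix G W) {lam Lam : ℝ}
    (hlam : IsMinPosEigenvalue (laplacian W) lam) (hLam : IsMaxEigenvalue (laplacian W) Lam) :
    ∃ U μ, IsEigenbasis W lam Lam U μ := by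
  have hH : (laplacian W).IsHermitian := by
    ext i j
    simpa using hW.laplacian_comm j i
  set v := hH.eigenvectorBasis
  set μ := hH.eigenvalues
  have heig : ∀ l i, ∑ j, laplacian W i j * v l j = μ l * v l i := by
    intro l i
    have := congrFun (hH.mulVec_eigenvectorBasis l) i
    simpa [Matrix.mulVec, dotProduct] using this
  have hnorm : ∀ l, ∑ i, v l i ^ 2 = 1 := by
    intro l
    have h := v.orthonormal.1 l
    have h2 := EuclideanSpace.real_norm_sq_eq (v l)
    rw [h] at h2
    simpa using h2.symm
  have hμ0 : ∀ l, 0 ≤ μ l := by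
    intro l
    have h := hW.quadratic_form (fun i => v l i)
    simp only [heig] at h
    have h1 : ∑ i, v l i * (μ l * v l i) = μ l := by
      calc ∑ i, v l i * (μ l * v l i) = μ l * ∑ i, v l i ^ 2 := by
            rw [Finset.mul_sum]
            exact Finset.sum_congr rfl fun i _ => by ring
        _ = μ l := by rw [hnorm l, mul_one]
    rw [h1] at h
    have h2 : 0 ≤ ∑ i, ∑ j, W i j * (v l i - v l j) ^ 2 :=
      Finset.sum_nonneg fun i _ => Finset.sum_nonneg fun j _ =>
        mul_nonneg (hW.nonneg i j) (sq_nonneg _)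
    linarith
  have hev : ∀ l, Module.End.HasEigenvalue (Matrix.toLin' (laplacian W)) (μ l) := by
    intro l
    refine Module.End.hasEigenvalue_of_hasEigenvector (x := fun i => v l i) ⟨?_, ?_⟩
    · rw [Module.End.mem_eigenspace_iff]
      ext i
      simpa [Matrix.mulVec, dotProduct] using heig l i
    · intro h0
      have := hnorm l
      have h0' : ∀ i, v l i = 0 := fun i => congrFun h0 i
      simp [h0'] at this
  have hself : ∀ (z : Fin n → ℝ) (l : Fin n),
      ∑ i, v l i * ∑ j, laplacian W i j * z j = μ l * ∑ i, v l i * z i := by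
    intro z l
    simp only [Finset.mul_sum]
    rw [Finset.sum_comm]
    refine Finset.sum_congr rfl fun j _ => ?_
    rw [← mul_assoc, ← heig l j, Finset.sum_mul]
    exact Finset.sum_congr rfl fun i _ => by rw [hW.laplacian_comm i j]; ring
  refine ⟨fun i l => v l i, μ, ⟨?_, hself, ?_, ?_, ?_⟩⟩
  · intro z
    have h := v.sum_sq_norm_inner_right (WithLp.toLp 2 z)
    rw [EuclideanSpace.real_norm_sq_eq] at h
    simp only [PiLp.inner_apply, RCLike.inner_apply, Real.norm_eq_abs, sq_abs] at h
    simpa [mul_comm] using h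
  · intro l hl
    exact ⟨hlam.2 ⟨lt_of_le_of_ne (hμ0 l) (Ne.symm hl), hev l⟩, hLam.2 (hev l)⟩
  · intro l hl
    obtain ⟨i₀⟩ := hG.nonempty
    refine ⟨v l i₀, fun i => hW.eq_of_laplacian_eq_zero hG (z := fun i => v l i) ?_ i i₀⟩
    intro i
    rw [heig, hl, zero_mul]
  · intro l hl
    have h := hself (fun _ => 1) l
    have h0 : ∀ i, ∑ j, laplacian W i j = 0 := fun i => by
      simpa using sum_laplacian_mul W i (fun _ => 1)
    simp only [mul_one, h0, mul_zero, Finset.sum_const_zero] at h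
    exact (mul_eq_zero.1 h.symm).resolve_left hl

/-- The component in the eigenvectors with eigenvalue zero is the mean. -/
lemma IsEigenbasis.sum_zero_modes_le {lam Lam : ℝ} {U : Fin n → Fin n → ℝ} {μ : Fin n → ℝ}
    (h : IsEigenbasis W lam Lam U μ) (z : Fin n → ℝ) :
    ∑ l with μ l = 0, (∑ i, U i l * z i) ^ 2 ≤ 1 / (n : ℝ) * (∑ i, z i) ^ 2 := by
  rcases Nat.eq_zero_or_pos n with rfl | hn
  · simp
  have hn' : (0 : ℝ) < n := by exact_mod_cast hn
  choose! c hc using h.const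
  have h1 : ∑ l with μ l = 0, (∑ i, U i l * z i) ^ 2 =
      (∑ l with μ l = 0, c l ^ 2) * (∑ i, z i) ^ 2 := by
    rw [Finset.sum_mul]
    refine Finset.sum_congr rfl fun l hl => ?_
    have hl' := (Finset.mem_filter.1 hl).2
    simp only [hc l hl', ← Finset.mul_sum]
    ring
  -- Parseval for the constant vector 1 gives `∑ c_l² ≤ 1/n`, so the dimension of the kernel need
  -- not be computed.
  have h2 : ∑ l with μ l = 0, ((n : ℝ) * c l) ^ 2 ≤ n := by
    have hp := h.parseval (fun _ => 1)
    simp only [mul_one, one_pow, Finset.sum_const, Finset.card_univ, Fintype.card_fin,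
      nsmul_eq_mul] at hp
    calc ∑ l with μ l = 0, ((n : ℝ) * c l) ^ 2 = ∑ l with μ l = 0, (∑ i, U i l) ^ 2 := by
          refine Finset.sum_congr rfl fun l hl => ?_
          have hl' := (Finset.mem_filter.1 hl).2
          simp [hc l hl']
      _ ≤ ∑ l, (∑ i, U i l) ^ 2 :=
          Finset.sum_le_sum_of_subset_of_nonneg (Finset.filter_subset _ _)
            fun _ _ _ => sq_nonneg _
      _ = n := hp
  rw [h1]
  gcongr
  simp only [mul_pow, ← Finset.mul_sum] at h2
  rw [le_div_iff₀ hn']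
  nlinarith

/-- The consensus error is carried by the eigenvectors with nonzero eigenvalue. -/
lemma IsEigenbasis.sum_nonzero_modes_eq {lam Lam : ℝ} {U : Fin n → Fin n → ℝ} {μ : Fin n → ℝ}
    (h : IsEigenbasis W lam Lam U μ) (z : Fin n → ℝ) :
    ∑ l with μ l ≠ 0, (∑ i, U i l * z i) ^ 2 =
      ∑ i, (z i - 1 / (n : ℝ) * ∑ j, z j) ^ 2 := by
  rcases Nat.eq_zero_or_pos n with rfl | hn
  · simp
  have hn' : (n : ℝ) ≠ 0 := by exact_mod_cast hn.ne'
  -- Parseval for the centred vector, mode by mode: zero-sum eigenvectors do not see the mean,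
  -- constant ones annihilate centred vectors.
  rw [← h.parseval, Finset.sum_filter]
  refine Finset.sum_congr rfl fun l _ => ?_
  simp only [mul_sub, Finset.sum_sub_distrib, ← Finset.sum_mul]
  split_ifs with hl
  · rw [h.sum_eq_zero l hl]; ring
  · obtain ⟨c, hc⟩ := h.const l (not_not.1 hl)
    simp only [hc, ← Finset.mul_sum, Finset.sum_const, Finset.card_univ, Fintype.card_fin,
      nsmul_eq_mul]
    field_simp
    ring

end Graph

/-! ### One step of the dynamics, summed over the modes -/

section Modes

variable {n d : ℕ} {W : Matrix (Fin n) (Fin n) ℝ} {lam Lam : ℝ} {U : Fin n → Fin n → ℝ}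
  {μ : Fin n → ℝ}

/-- Coordinate `j` of the component of the stack `z` along the eigenvector `l`. -/
def modeCoord (U : Fin n → Fin n → ℝ) (z : Fin n → Vec d) (l : Fin n) (j : Fin d) : ℝ :=
  ∑ i, U i l * z i j

lemma norm_sq_eq_sum (x : Vec d) : ‖x‖ ^ 2 = ∑ j, x j ^ 2 := EuclideanSpace.real_norm_sq_eq x

lemma mean_apply (z : Fin n → Vec d) (j : Fin d) : mean z j = 1 / (n : ℝ) * ∑ i, z i j := by
  simp [mean]

lemma IsEigenbasis.sum_modeCoord_sq (h : IsEigenbasis W lam Lam U μ) (z : Fin n → Vec d) :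
    ∑ l, ∑ j, modeCoord U z l j ^ 2 = ∑ i, ‖z i‖ ^ 2 := by
  simp only [norm_sq_eq_sum]
  rw [Finset.sum_comm, Finset.sum_comm (s := Finset.univ (α := Fin n))]
  exact Finset.sum_congr rfl fun j _ => h.parseval fun i => z i j

lemma IsEigenbasis.sum_modeCoord_sq_of_ne (h : IsEigenbasis W lam Lam U μ) (z : Fin n → Vec d) :
    ∑ l with μ l ≠ 0, ∑ j, modeCoord U z l j ^ 2 = ∑ i, ‖z i - mean z‖ ^ 2 := by
  simp only [norm_sq_eq_sum, PiLp.sub_apply, mean_apply]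
  rw [Finset.sum_comm, Finset.sum_comm (s := Finset.univ (α := Fin n))]
  exact Finset.sum_congr rfl fun j _ => h.sum_nonzero_modes_eq fun i => z i j

lemma IsEigenbasis.sum_modeCoord_sq_of_eq_zero_le (h : IsEigenbasis W lam Lam U μ)
    (z : Fin n → Vec d) :
    ∑ l with μ l = 0, ∑ j, modeCoord U z l j ^ 2 ≤ n * ‖mean z‖ ^ 2 := by
  rcases Nat.eq_zero_or_pos n with rfl | hn
  · simp
  have hn' : (n : ℝ) ≠ 0 := by exact_mod_cast hn.ne'
  rw [norm_sq_eq_sum, Finset.sum_comm, Finset.mul_sum]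
  refine Finset.sum_le_sum fun j _ => (h.sum_zero_modes_le fun i => z i j).trans (le_of_eq ?_)
  rw [mean_apply]
  field_simp

lemma IsEigenbasis.sum_modeCoord_sq_of_ne_le (h : IsEigenbasis W lam Lam U μ)
    (z : Fin n → Vec d) :
    ∑ l with μ l ≠ 0, ∑ j, modeCoord U z l j ^ 2 ≤ ∑ i, ‖z i‖ ^ 2 := by
  rw [← h.sum_modeCoord_sq]
  exact Finset.sum_le_sum_of_subset_of_nonneg (Finset.filter_subset _ _)
    fun _ _ _ => Finset.sum_nonneg fun _ _ => sq_nonneg _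

lemma modeCoord_add (z w : Fin n → Vec d) (l : Fin n) (j : Fin d) :
    modeCoord U (fun i => z i + w i) l j = modeCoord U z l j + modeCoord U w l j := by
  simp [modeCoord, mul_add, Finset.sum_add_distrib]

lemma modeCoord_sub (z w : Fin n → Vec d) (l : Fin n) (j : Fin d) :
    modeCoord U (fun i => z i - w i) l j = modeCoord U z l j - modeCoord U w l j := by
  simp [modeCoord, mul_sub, Finset.sum_sub_distrib]

lemma modeCoord_smul (c : ℝ) (z : Fin n → Vec d) (l : Fin n) (j : Fin d) :
    modeCoord U (fun i => c • z i) l j = c * modeCoord U z l j := by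
  simp only [modeCoord, PiLp.smul_apply, smul_eq_mul, Finset.mul_sum]
  exact Finset.sum_congr rfl fun i _ => by ring

lemma IsEigenbasis.modeCoord_laplacian (h : IsEigenbasis W lam Lam U μ) (z : Fin n → Vec d)
    (l : Fin n) (j : Fin d) :
    modeCoord U (fun i => ∑ k, laplacian W i k • z k) l j = μ l * modeCoord U z l j := by
  simp only [modeCoord]
  rw [← h.eigen (fun i => z i j) l]
  simp

/-- The consensus part of the Lyapunov function. -/
noncomputable def consensusLyap (A : ℝ) (U : Fin n → Fin n → ℝ) (μ : Fin n → ℝ)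
    (x y : Fin n → Vec d) : ℝ :=
  ∑ l with μ l ≠ 0, ∑ j, modeLyap A (μ l) (modeCoord U x l j) (modeCoord U y l j)

lemma IsEigenbasis.consensusLyap_nonneg (h : IsEigenbasis W lam Lam U μ) {A : ℝ} (hA : 0 ≤ A)
    (hlam : 0 < lam) (hAlam : 1 ≤ A * lam) (x y : Fin n → Vec d) :
    0 ≤ consensusLyap A U μ x y := by
  refine Finset.sum_nonneg fun l hl => Finset.sum_nonneg fun j _ => ?_
  have hb := h.bounds l (Finset.mem_filter.1 hl).2
  refine modeLyap_nonneg (hlam.trans_le hb.1) ?_ _ _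
  nlinarith

/-- Serves to bound the initial value of the Lyapunov function. -/
lemma IsEigenbasis.consensusLyap_le (h : IsEigenbasis W lam Lam U μ) {A : ℝ} (hA : 0 ≤ A)
    (hlam : 0 < lam) (x y : Fin n → Vec d) :
    consensusLyap A U μ x y ≤
      2 * ∑ i, ‖x i‖ ^ 2 + ((1 + A) / lam + 1 / lam ^ 2) * ∑ i, ‖y i‖ ^ 2 := by
  have h1 : consensusLyap A U μ x y ≤ ∑ l with μ l ≠ 0, ∑ j,
      (2 * modeCoord U x l j ^ 2 + ((1 + A) / lam + 1 / lam ^ 2) * modeCoord U y l j ^ 2) := by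
    refine Finset.sum_le_sum fun l hl => Finset.sum_le_sum fun j _ => ?_
    have hb := (h.bounds l (Finset.mem_filter.1 hl).2).1
    have hμ : 0 < μ l := hlam.trans_le hb
    have e1 : (1 + A) / μ l ≤ (1 + A) / lam := by gcongr
    have e2 : 1 / μ l ^ 2 ≤ 1 / lam ^ 2 := by gcongr
    set X := modeCoord U x l j
    set Y := modeCoord U y l j
    have e3 : 2 / μ l * (X * Y) ≤ X ^ 2 + 1 / μ l ^ 2 * Y ^ 2 := by
      have : 0 ≤ (X - Y / μ l) ^ 2 := sq_nonneg _
      have e : (X - Y / μ l) ^ 2 = X ^ 2 + 1 / μ l ^ 2 * Y ^ 2 - 2 / μ l * (X * Y) := by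
        field_simp
        ring
      linarith
    have e4 := mul_le_mul_of_nonneg_right e1 (sq_nonneg Y)
    have e5 := mul_le_mul_of_nonneg_right e2 (sq_nonneg Y)
    unfold modeLyap
    linarith
  refine h1.trans ?_
  simp only [Finset.sum_add_distrib, ← Finset.mul_sum]
  have hx := h.sum_modeCoord_sq_of_ne_le x
  have hy := h.sum_modeCoord_sq_of_ne_le y
  gcongr

/-- The one-mode estimate summed over nonzero modes and coordinates. The full displacement also has
a component in the kernel, which contributes the last term. -/
lemma IsEigenbasis.consensusLyap_step_le (h : IsEigenbasis W lam Lam U μ) {b A ω B : ℝ}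
    (hb : 0 < b) (hA : 1 ≤ A) (hlam : 0 < lam) (hω : 0 < ω) (hB : 3 ≤ B)
    (hLam : 0 ≤ Lam) (hBLam : 2 * b * Lam + 3 / 2 * B * b * Lam ≤ 15 / 16)
    (hcol : ∀ j, ∑ i, laplacian W i j = 0) {x v xh g g' q N x' v' : Fin n → Vec d} (hv : ∑ i, v i = 0)
    (hx' : ∀ i, x' i = x i - (b / ω) •
      ((A * ω) • (∑ j, laplacian W i j • xh j) + ω • v i + (q i + N i)))
    (hv' : ∀ i, v' i = v i + (b / ω * ω) • ∑ j, laplacian W i j • xh j) :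
    consensusLyap A U μ x' (fun i => v' i + (1 / ω) • g' i)
      + (B - 3) / 2 * ∑ i, ‖x' i - x i‖ ^ 2 ≤
    consensusLyap A U μ x (fun i => v i + (1 / ω) • g i)
      + b * ((-(A * lam) + 15 / 4 + 1 / ω + b + 2 * B * A ^ 2 * b * Lam ^ 2)
          * ∑ i, ‖x i - mean x‖ ^ 2
        + (A * Lam + 19 / 8 + 2 * Lam + b + 2 * B * A ^ 2 * b * Lam ^ 2) * ∑ i, ‖xh i - x i‖ ^ 2
        + (1 / ω + 8 / (ω ^ 2 * lam) + 16 * (b / ω) ^ 2 + 6 * B * b / ω ^ 2)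
          * ∑ i, ‖q i - g i‖ ^ 2
        + (8 / ω ^ 2 + 16 / (ω ^ 2 * lam) + 16 * (b / ω) ^ 2 + 6 * B * b / ω ^ 2)
          * ∑ i, ‖N i‖ ^ 2)
      + (8 / 3 * (1 + A) ^ 2 / (b * lam) + 4 / 3 / (b * lam ^ 2) + 16 * b * (1 + A) ^ 2
        + (1 + A) / lam + 2 / lam ^ 2) * ((1 / ω) ^ 2 * ∑ i, ‖g' i - g i‖ ^ 2)
      + (B - 3) / 2 * (n * ((b / ω) ^ 2 * ‖mean (fun i => q i + N i)‖ ^ 2)) := by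
  have hx'' : x' = fun i => x i - (b / ω) •
      ((A * ω) • (∑ j, laplacian W i j • xh j) + ω • v i + (q i + N i)) := funext hx'
  have hv'' : v' = fun i => v i + (b / ω * ω) • ∑ j, laplacian W i j • xh j := funext hv'
  -- The kernel part of the displacement is that of the mean, where the Laplacian and dual terms
  -- drop out and only `η` times the mean stochastic gradient survives.
  have hsplit : ∑ i, ‖x' i - x i‖ ^ 2 ≤
      ∑ l with μ l ≠ 0, ∑ j, modeCoord U (fun i => x' i - x i) l j ^ 2
        + n * ((b / ω) ^ 2 * ‖mean (fun i => q i + N i)‖ ^ 2) := by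
    rw [← h.sum_modeCoord_sq, ← Finset.sum_filter_add_sum_filter_not _ (fun l => μ l ≠ 0)]
    simp only [not_not]
    have h1 := h.sum_modeCoord_sq_of_eq_zero_le (fun i => x' i - x i)
    have hL : ∑ i, ∑ j, laplacian W i j • xh j = 0 := by
      rw [Finset.sum_comm]
      simp only [← Finset.sum_smul, hcol, zero_smul, Finset.sum_const_zero]
    have h2 : mean (fun i => x' i - x i) = -((b / ω) • mean (fun i => q i + N i)) := by
      have : ∀ i, x' i - x i = -((b / ω) •
        ((A * ω) • (∑ j, laplacian W i j • xh j) + ω • v i + (q i + N i))) := by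
        intro i; rw [hx']; abel
      simp only [mean, this, Finset.sum_neg_distrib, ← Finset.smul_sum]
      rw [Finset.sum_add_distrib, Finset.sum_add_distrib, ← Finset.smul_sum, ← Finset.smul_sum,
        hL, hv, smul_zero, smul_zero, zero_add, zero_add, smul_neg, smul_comm]
    rw [h2, norm_neg, norm_smul, mul_pow, Real.norm_eq_abs, sq_abs] at h1
    linarith
  have hmode : ∀ l, μ l ≠ 0 → ∀ j,
      modeLyap A (μ l) (modeCoord U x' l j) (modeCoord U (fun i => v' i + (1 / ω) • g' i) l j)
        + (B - 3) / 2 * modeCoord U (fun i => x' i - x i) l j ^ 2 ≤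
      modeLyap A (μ l) (modeCoord U x l j) (modeCoord U (fun i => v i + (1 / ω) • g i) l j)
      + b * ((-(A * lam) + 15 / 4 + 1 / ω + b + 2 * B * A ^ 2 * b * Lam ^ 2)
          * modeCoord U x l j ^ 2
        + (A * Lam + 19 / 8 + 2 * Lam + b + 2 * B * A ^ 2 * b * Lam ^ 2)
          * modeCoord U (fun i => xh i - x i) l j ^ 2
        + (1 / ω + 8 / (ω ^ 2 * lam) + 16 * (b / ω) ^ 2 + 6 * B * b / ω ^ 2)
          * modeCoord U (fun i => q i - g i) l j ^ 2
        + (8 / ω ^ 2 + 16 / (ω ^ 2 * lam) + 16 * (b / ω) ^ 2 + 6 * B * b / ω ^ 2)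
          * modeCoord U N l j ^ 2)
      + (8 / 3 * (1 + A) ^ 2 / (b * lam) + 4 / 3 / (b * lam ^ 2) + 16 * b * (1 + A) ^ 2
        + (1 + A) / lam + 2 / lam ^ 2)
          * ((1 / ω) ^ 2 * modeCoord U (fun i => g' i - g i) l j ^ 2) := by
    intro l hl j
    obtain ⟨h1, h2⟩ := h.bounds l hl
    have hμ : 0 < μ l := hlam.trans_le h1
    have hA0 : 0 < A := by linarith
    have hB0 : 0 ≤ B := by linarith
    have key := modeLyap_step_le hb hA hμ hω hB0 (B := B) (by
        refine le_trans ?_ hBLam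
        gcongr) (modeCoord U x l j) (modeCoord U (fun i => v i + (1 / ω) • g i) l j)
        (modeCoord U (fun i => xh i - x i) l j) (modeCoord U (fun i => q i - g i) l j)
        (modeCoord U N l j) (1 / ω * modeCoord U (fun i => g' i - g i) l j)
    have ex : modeCoord U x' l j = modeCoord U x l j - b * (A * μ l * (modeCoord U x l j
        + modeCoord U (fun i => xh i - x i) l j) + modeCoord U (fun i => v i + (1 / ω) • g i) l j
        + (modeCoord U (fun i => q i - g i) l j + modeCoord U N l j) / ω) := by
      rw [hx'', modeCoord_sub, modeCoord_smul, modeCoord_add, modeCoord_add, modeCoord_smul,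
        modeCoord_smul, h.modeCoord_laplacian, modeCoord_add, modeCoord_sub, modeCoord_add,
        modeCoord_smul, modeCoord_sub]
      field_simp
      ring
    have ed : modeCoord U (fun i => x' i - x i) l j ^ 2 = (b * (A * μ l * (modeCoord U x l j
        + modeCoord U (fun i => xh i - x i) l j) + modeCoord U (fun i => v i + (1 / ω) • g i) l j
        + (modeCoord U (fun i => q i - g i) l j + modeCoord U N l j) / ω)) ^ 2 := by
      rw [modeCoord_sub x' x, ex]; ring
    have ey : modeCoord U (fun i => v' i + (1 / ω) • g' i) l j =
        modeCoord U (fun i => v i + (1 / ω) • g i) l j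
        + b * μ l * (modeCoord U x l j + modeCoord U (fun i => xh i - x i) l j)
        + 1 / ω * modeCoord U (fun i => g' i - g i) l j := by
      rw [modeCoord_add, hv'', modeCoord_add, modeCoord_smul, h.modeCoord_laplacian,
        modeCoord_add, modeCoord_sub, modeCoord_smul, modeCoord_smul, modeCoord_sub]
      field_simp
      ring
    rw [ex, ed, ey]
    -- The coefficients are monotone in the eigenvalue: decay and inverse powers are taken at `lam`,
    -- growing terms at `Lam`.
    refine key.trans ?_
    rw [mul_pow (1 / ω)]
    gcongr
  have hsum := Finset.sum_le_sum fun l (hl : l ∈ Finset.univ.filter fun l => μ l ≠ 0) =>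
    Finset.sum_le_sum fun j (_ : j ∈ Finset.univ) => hmode l (Finset.mem_filter.1 hl).2 j
  simp only [Finset.sum_add_distrib, ← Finset.mul_sum] at hsum
  rw [h.sum_modeCoord_sq_of_ne x] at hsum
  have he := h.sum_modeCoord_sq_of_ne_le (fun i => xh i - x i)
  have hp := h.sum_modeCoord_sq_of_ne_le (fun i => q i - g i)
  have hN := h.sum_modeCoord_sq_of_ne_le N
  have hg := h.sum_modeCoord_sq_of_ne_le (fun i => g' i - g i)
  have hB' : 0 ≤ (B - 3) / 2 := by linarith
  have hB0 : 0 ≤ B := by linarith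
  have hA0 : 0 ≤ A := by linarith
  have hs := mul_le_mul_of_nonneg_left hsplit hB'
  rw [mul_add] at hs
  calc _ ≤ consensusLyap A U μ x' (fun i => v' i + (1 / ω) • g' i)
        + ((B - 3) / 2 * ∑ l with μ l ≠ 0, ∑ j, modeCoord U (fun i => x' i - x i) l j ^ 2
          + (B - 3) / 2 * (n * ((b / ω) ^ 2 * ‖mean (fun i => q i + N i)‖ ^ 2))) := by gcongr
    _ ≤ _ := by
      rw [← add_assoc]
      refine add_le_add (hsum.trans ?_) le_rfl
      unfold consensusLyap
      gcongr

lemma IsWeightMatrix.sum_laplacian_col {G : SimpleGraph (Fin n)} (hW : IsWeightMatrix G W)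
    (j : Fin n) : ∑ i, laplacian W i j = 0 := by
  simp only [fun i => hW.laplacian_comm i j]
  simpa using sum_laplacian_mul W j (fun _ => 1)

end Modes

/-! ### Admissible parameters -/

/-- The relations between the parameters that make the consensus error contract. Here `b = β₂`,
`A = β₁`, and `B = 7 + 8 / φ₁`. -/
structure Admissible (b A ω lam Lam B Lf : ℝ) : Prop where
  b_pos : 0 < b
  one_lt_A : 1 < A
  third_lt_ω : 1 / 3 < ω
  lam_pos : 0 < lam
  lam_le_Lam : lam ≤ Lam
  le_B : 15 ≤ B
  Lf_pos : 0 < Lf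
  coupling : 2 * b * B * A ^ 2 * Lam ^ 2 + 9 / 2 + (2 + 5 / 2 * Lf ^ 2) / ω ≤ A * lam
  smooth : (16 * (1 + A) ^ 2 / lam + 8 / lam ^ 2) * Lf ^ 2 ≤ ω ^ 2
  stepsize : 4 * b * Lf ≤ ω

namespace Admissible

variable {b A ω lam Lam B Lf : ℝ}

lemma ω_pos (h : Admissible b A ω lam Lam B Lf) : 0 < ω := by linarith [h.third_lt_ω]

lemma A_mul_lam (h : Admissible b A ω lam Lam B Lf) : 9 / 2 ≤ A * lam := by
  have := h.coupling
  have hb := h.b_pos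
  have hB := h.le_B
  have hω := h.ω_pos
  have h1 : 0 ≤ 2 * b * B * A ^ 2 * Lam ^ 2 := by positivity
  have h2 : 0 ≤ (2 + 5 / 2 * Lf ^ 2) / ω := by positivity
  linarith

/-- Comparing the quadratic term of `coupling` with `A * lam ≤ A * Lam` cancels one factor `A *
Lam`. The smallness of `b` in the next lemmas follows from this. -/
lemma B_mul_b_mul_A_mul_Lam_le (h : Admissible b A ω lam Lam B Lf) : B * b * A * Lam ≤ 1 / 2 := by
  have := h.coupling
  have hb := h.b_pos
  have hB := h.le_B
  have hω := h.ω_pos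
  have hA := h.one_lt_A
  have hl := h.lam_pos
  have hL := h.lam_le_Lam
  have h2 : 0 ≤ (2 + 5 / 2 * Lf ^ 2) / ω := by positivity
  have h3 : A * lam ≤ A * Lam := by gcongr
  have hAL : 0 < A * Lam := by nlinarith
  have h4 : (A * Lam) * (2 * (B * b * A * Lam)) ≤ (A * Lam) * 1 := by nlinarith
  have := le_of_mul_le_mul_left h4 hAL
  linarith

lemma B_mul_b_mul_Lam_le (h : Admissible b A ω lam Lam B Lf) : B * b * Lam ≤ 1 / 2 := by
  have h1 := h.B_mul_b_mul_A_mul_Lam_le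
  have hb := h.b_pos
  have hB := h.le_B
  have h0 : 0 ≤ B * b * Lam :=
    mul_nonneg (mul_nonneg (by linarith) hb.le) (h.lam_pos.le.trans h.lam_le_Lam)
  nlinarith [h.one_lt_A]

lemma b_mul_Lam_le (h : Admissible b A ω lam Lam B Lf) : b * Lam ≤ 1 / 30 := by
  have h1 := h.B_mul_b_mul_Lam_le
  have h0 : 0 ≤ b * Lam := mul_nonneg h.b_pos.le (h.lam_pos.le.trans h.lam_le_Lam)
  nlinarith [h.le_B]

lemma b_le (h : Admissible b A ω lam Lam B Lf) : b ≤ 1 / 135 := by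
  have h1 := h.B_mul_b_mul_A_mul_Lam_le
  have h2 := h.A_mul_lam
  have hb := h.b_pos
  have hA := h.one_lt_A
  have h3 : A * lam ≤ A * Lam := by gcongr; exact h.lam_le_Lam
  have h4 : 15 * b * (9 / 2) ≤ B * b * (A * Lam) := by
    have := h.le_B
    gcongr
    linarith
  nlinarith

lemma Lf_sq_le (h : Admissible b A ω lam Lam B Lf) : 64 * (Lf ^ 2 / ω ^ 2) ≤ lam := by
  have hl := h.lam_pos
  have hω := h.ω_pos
  have h1 := h.smooth
  have h2 : 64 / lam ≤ 16 * (1 + A) ^ 2 / lam + 8 / lam ^ 2 := by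
    have : 64 / lam ≤ 16 * (1 + A) ^ 2 / lam := by
      gcongr
      nlinarith [h.one_lt_A]
    have : 0 ≤ 8 / lam ^ 2 := by positivity
    linarith
  have h3 : 64 / lam * Lf ^ 2 ≤ ω ^ 2 := le_trans (by gcongr) h1
  rw [← mul_div_assoc, div_le_iff₀ (by positivity)]
  rw [div_mul_eq_mul_div, div_le_iff₀ hl] at h3
  linarith

/-- The gradient difference is bounded by `Lf²` times the consensus error and joins its coefficient.
The target reserves `1/4` for the final decrease; the rest, with `3 + 3Bη` the weight of the cost in
`Run.lyap`, pays for the consensus error in the cost descent. The `5/2` in `coupling` is `1` for the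
gradient difference plus `3/2` for this reserve. -/
lemma consensus_coeff_le (h : Admissible b A ω lam Lam B Lf) :
    (-(A * lam) + 15 / 4 + 1 / ω + b + 2 * B * A ^ 2 * b * Lam ^ 2)
      + (1 / ω + 8 / (ω ^ 2 * lam) + 16 * (b / ω) ^ 2 + 6 * B * b / ω ^ 2) * Lf ^ 2 ≤
    -(1 / 4 + (3 + 3 * B * (b / ω)) * Lf ^ 2 / (2 * ω)) := by
  have hl := h.lam_pos
  have hω := h.ω_pos
  have hb := h.b_pos
  set u := Lf ^ 2 / ω ^ 2 with hu
  have hu0 : 0 ≤ u := by positivity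
  have hul := h.Lf_sq_le
  rw [← hu] at hul
  have e1 : 8 / (ω ^ 2 * lam) * Lf ^ 2 ≤ 1 / 8 := by
    have : 8 / (ω ^ 2 * lam) * Lf ^ 2 = 8 * u / lam := by rw [hu]; field_simp
    rw [this, div_le_iff₀ hl]; linarith
  have hBb0 : 0 ≤ B * b := mul_nonneg (by linarith [h.le_B]) hb.le
  have hBbl : B * b * lam ≤ 1 / 2 :=
    le_trans (mul_le_mul_of_nonneg_left h.lam_le_Lam hBb0) h.B_mul_b_mul_Lam_le
  have hBu : B * b * u ≤ 1 / 128 := by nlinarith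
  have hbu : b * u ≤ 1 / 128 := by nlinarith [h.le_B, mul_nonneg hb.le hu0]
  have hbbu : b * (b * u) ≤ 1 / 135 * (1 / 128) :=
    mul_le_mul h.b_le hbu (mul_nonneg hb.le hu0) (by norm_num)
  have hc := h.coupling
  have e2 : (1 / ω + 8 / (ω ^ 2 * lam) + 16 * (b / ω) ^ 2 + 6 * B * b / ω ^ 2) * Lf ^ 2 =
      Lf ^ 2 / ω + 8 / (ω ^ 2 * lam) * Lf ^ 2 + 16 * (b * (b * u)) + 6 * (B * b * u) := by
    rw [hu]; field_simp
  have e3 : (3 + 3 * B * (b / ω)) * Lf ^ 2 / (2 * ω) =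
      3 / 2 * (Lf ^ 2 / ω) + 3 / 2 * (B * b * u) := by
    rw [hu]; field_simp
  have e4 : (2 + 5 / 2 * Lf ^ 2) / ω = 2 * (1 / ω) + 5 / 2 * (Lf ^ 2 / ω) := by field_simp
  rw [e2, e3]
  rw [e4] at hc
  have h1 : 0 ≤ 1 / ω := by positivity
  have := h.b_le
  nlinarith

/-- With `a = (1 + A)²/lam` and `c = 1/lam²` the bracket is at most `(3a + 3c/2)/b`, which is `3/16`
of `(16a + 8c)/b`, and `smooth` bounds `(16a + 8c) Lf²` by `ω²`. -/
lemma drift_coeff_le (h : Admissible b A ω lam Lam B Lf) :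
    (8 / 3 * (1 + A) ^ 2 / (b * lam) + 4 / 3 / (b * lam ^ 2) + 16 * b * (1 + A) ^ 2
        + (1 + A) / lam + 2 / lam ^ 2) * Lf ^ 2 ≤ 3 / 16 * (ω ^ 2 / b) := by
  have hl := h.lam_pos
  have hb := h.b_pos
  have hA := h.one_lt_A
  have hbl : b * lam ≤ 1 / 30 :=
    le_trans (mul_le_mul_of_nonneg_left h.lam_le_Lam hb.le) h.b_mul_Lam_le
  have hb' := h.b_le
  have hs := h.smooth
  set a := (1 + A) ^ 2 / lam with ha
  set c := 1 / lam ^ 2 with hc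
  have ha0 : 0 ≤ a := by positivity
  have hc0 : 0 ≤ c := by positivity
  have e1 : 16 * b * (1 + A) ^ 2 ≤ 1 / 8 * (a / b) := by
    have : 16 * b * (1 + A) ^ 2 = 16 * b * (b * lam) * (a / b) := by rw [ha]; field_simp
    rw [this]
    have h1 : 16 * b * (b * lam) ≤ 1 / 8 := by nlinarith [mul_pos hb hl]
    gcongr
  have e2 : (1 + A) / lam ≤ 1 / 8 * (a / b) := by
    have : (1 + A) / lam ≤ a := by
      rw [ha]; gcongr; nlinarith
    have h2 : a ≤ 1 / 8 * (a / b) := by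
      rw [← mul_div_assoc, le_div_iff₀ hb]; nlinarith
    linarith
  have e3 : 2 / lam ^ 2 ≤ 1 / 6 * (c / b) := by
    have e : 2 / lam ^ 2 = 2 * c := by rw [hc]; ring
    have e' : c ≤ 1 / 12 * (c / b) := by
      rw [← mul_div_assoc, le_div_iff₀ hb]; nlinarith
    linarith
  have e4 : 8 / 3 * (1 + A) ^ 2 / (b * lam) = 8 / 3 * (a / b) := by rw [ha]; field_simp
  have e5 : 4 / 3 / (b * lam ^ 2) = 4 / 3 * (c / b) := by rw [hc]; field_simp
  have e6 : (16 * (1 + A) ^ 2 / lam + 8 / lam ^ 2) * Lf ^ 2 = (16 * a + 8 * c) * Lf ^ 2 := by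
    rw [ha, hc]; ring
  rw [e6] at hs
  calc _ ≤ (3 * (a / b) + 3 / 2 * (c / b)) * Lf ^ 2 := by
        refine mul_le_mul_of_nonneg_right ?_ (sq_nonneg _)
        rw [e4, e5]
        have : 0 ≤ a / b := by positivity
        linarith
    _ = 3 / 16 * ((16 * a + 8 * c) * Lf ^ 2 / b) := by ring
    _ ≤ _ := by gcongr

/-- This inequality dictates the weight `3 + 3Bη` of the cost: the left side is what drift and
displacement charge to the mean gradient, the right side what the weighted cost descent returns. The
`3` covers the drift because `ω > 1/3`. -/
lemma gradient_coeff_le (h : Admissible b A ω lam Lam B Lf) :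
    3 / 8 * (b / ω ^ 2) + (B - 3) * (b / ω) ^ 2 ≤ 3 / 8 * (b / ω) * (3 + 3 * B * (b / ω)) := by
  have hω := h.ω_pos
  have hb := h.b_pos
  have h1 : b / ω ^ 2 ≤ 3 * (b / ω) := by
    rw [show 3 * (b / ω) = 3 * b * ω / ω ^ 2 by field_simp]
    gcongr
    nlinarith [h.third_lt_ω]
  have h2 : 0 ≤ (b / ω) ^ 2 := by positivity
  have h3 : 0 ≤ B * (b / ω) ^ 2 := mul_nonneg (by linarith [h.le_B]) h2
  linarith

lemma noise_coeff_le (h : Admissible b A ω lam Lam B Lf) :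
    b * (8 / ω ^ 2 + 16 / (ω ^ 2 * lam) + 16 * (b / ω) ^ 2 + 6 * B * b / ω ^ 2)
      + 3 / 8 * (b / ω ^ 2) + (B - 3) * (b / ω) ^ 2 ≤
    b * (9 + 16 / lam + 16 * b ^ 2 + 7 * B * b) * (1 / ω ^ 2) := by
  have hω := h.ω_pos
  have hb := h.b_pos
  have hl := h.lam_pos
  have h1 : b * (8 / ω ^ 2 + 16 / (ω ^ 2 * lam) + 16 * (b / ω) ^ 2 + 6 * B * b / ω ^ 2)
      + 3 / 8 * (b / ω ^ 2) + (B - 3) * (b / ω) ^ 2 =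
      b * (67 / 8 + 16 / lam + 16 * b ^ 2 + 6 * B * b + (B - 3) * b) * (1 / ω ^ 2) := by
    field_simp
    ring
  rw [h1]
  refine mul_le_mul_of_nonneg_right (mul_le_mul_of_nonneg_left ?_ hb.le) (by positivity)
  linarith

end Admissible

/-! ### Contraction of the consensus form under admissible parameters. -/

section Modes

variable {n d : ℕ} {W : Matrix (Fin n) (Fin n) ℝ} {lam Lam : ℝ} {U : Fin n → Fin n → ℝ}
  {μ : Fin n → ℝ}

lemma mean_add (z w : Fin n → Vec d) : mean (fun i => z i + w i) = mean z + mean w := by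
  simp [mean, Finset.sum_add_distrib]

lemma card_mul_norm_mean_sq_le (z : Fin n → Vec d) : n * ‖mean z‖ ^ 2 ≤ ∑ i, ‖z i‖ ^ 2 := by
  rcases Nat.eq_zero_or_pos n with rfl | hn
  · simp
  have hn' : (0 : ℝ) < n := by exact_mod_cast hn
  have h1 : ‖∑ i, z i‖ ^ 2 ≤ n * ∑ i, ‖z i‖ ^ 2 := by
    calc ‖∑ i, z i‖ ^ 2 ≤ (∑ i, ‖z i‖) ^ 2 := by gcongr; exact norm_sum_le _ _
      _ ≤ _ := by simpa using sq_sum_le_card_mul_sum_sq (s := Finset.univ) (f := fun i => ‖z i‖)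
  have h2 : ‖mean z‖ = 1 / n * ‖∑ i, z i‖ := by
    rw [mean, norm_smul, Real.norm_eq_abs, abs_of_pos (by positivity)]
  rw [h2, mul_pow]
  calc (n : ℝ) * ((1 / n) ^ 2 * ‖∑ i, z i‖ ^ 2) = 1 / n * ‖∑ i, z i‖ ^ 2 := by field_simp
    _ ≤ 1 / n * (n * ∑ i, ‖z i‖ ^ 2) := by gcongr
    _ = _ := by field_simp

lemma norm_add_sq_le_two (a b : Vec d) : ‖a + b‖ ^ 2 ≤ 2 * ‖a‖ ^ 2 + 2 * ‖b‖ ^ 2 := by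
  have h := norm_add_le a b
  have : ‖a + b‖ ^ 2 ≤ (‖a‖ + ‖b‖) ^ 2 := by gcongr
  nlinarith [sq_nonneg (‖a‖ - ‖b‖)]

/-- Every perturbation is reduced to one of four quantities: consensus error, compression error,
mean gradient, noise. The last two arise by splitting the squared step of the mean. -/
lemma IsEigenbasis.consensusLyap_contract (h : IsEigenbasis W lam Lam U μ) {b A ω B Lf : ℝ}
    (hp : Admissible b A ω lam Lam B Lf) (hcol : ∀ j, ∑ i, laplacian W i j = 0)
    {x v xh g g' q N x' v' : Fin n → Vec d} (hv : ∑ i, v i = 0)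
    (hx' : ∀ i, x' i = x i - (b / ω) •
      ((A * ω) • (∑ j, laplacian W i j • xh j) + ω • v i + (q i + N i)))
    (hv' : ∀ i, v' i = v i + (b / ω * ω) • ∑ j, laplacian W i j • xh j)
    (hq : ∑ i, ‖q i - g i‖ ^ 2 ≤ Lf ^ 2 * ∑ i, ‖x i - mean x‖ ^ 2)
    (hg : ∑ i, ‖g' i - g i‖ ^ 2 ≤
      Lf ^ 2 * (n * ((b / ω) ^ 2 * ‖mean (fun i => q i + N i)‖ ^ 2))) :
    consensusLyap A U μ x' (fun i => v' i + (1 / ω) • g' i)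
      + (B - 3) / 2 * ∑ i, ‖x' i - x i‖ ^ 2 ≤
    consensusLyap A U μ x (fun i => v i + (1 / ω) • g i)
      - b * (1 / 4 + (3 + 3 * B * (b / ω)) * Lf ^ 2 / (2 * ω)) * ∑ i, ‖x i - mean x‖ ^ 2
      + b * (A * Lam + 2 * Lam + 4 + 2 * B * A ^ 2 * b * Lam ^ 2) * ∑ i, ‖xh i - x i‖ ^ 2
      + 3 / 8 * (b / ω) * (3 + 3 * B * (b / ω)) * (n * ‖mean q‖ ^ 2)
      + b * (9 + 16 / lam + 16 * b ^ 2 + 7 * B * b) * (1 / ω ^ 2) * ∑ i, ‖N i‖ ^ 2 := by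
  have hb := hp.b_pos
  have hω := hp.ω_pos
  have hl := hp.lam_pos
  have hB := hp.le_B
  have hLam : 0 ≤ Lam := hl.le.trans hp.lam_le_Lam
  have hA := hp.one_lt_A
  have hb' := hp.b_le
  have step := h.consensusLyap_step_le (B := B) hb hA.le hl hω (by linarith) hLam
    (by nlinarith [hp.B_mul_b_mul_Lam_le, hp.b_mul_Lam_le]) hcol (g := g) (g' := g') hv hx' hv'
  set D := ∑ i, ‖x i - mean x‖ ^ 2
  set E := ∑ i, ‖xh i - x i‖ ^ 2
  set NN := ∑ i, ‖N i‖ ^ 2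
  set M := ‖mean (fun i => q i + N i)‖ ^ 2
  have hD0 : 0 ≤ D := Finset.sum_nonneg fun _ _ => sq_nonneg _
  have hE0 : 0 ≤ E := Finset.sum_nonneg fun _ _ => sq_nonneg _
  have hN0 : 0 ≤ NN := Finset.sum_nonneg fun _ _ => sq_nonneg _
  have hM : n * M ≤ 2 * (n * ‖mean q‖ ^ 2) + 2 * NN := by
    have h1 : M ≤ 2 * ‖mean q‖ ^ 2 + 2 * ‖mean N‖ ^ 2 := by
      simp only [M]; rw [mean_add]; exact norm_add_sq_le_two _ _
    have h2 := card_mul_norm_mean_sq_le N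
    have h3 : (n : ℝ) * M ≤ n * (2 * ‖mean q‖ ^ 2 + 2 * ‖mean N‖ ^ 2) := by gcongr
    linarith
  set Q := n * ‖mean q‖ ^ 2
  have hQ0 : 0 ≤ Q := by positivity
  have hcδ0 : 0 ≤ 8 / 3 * (1 + A) ^ 2 / (b * lam) + 4 / 3 / (b * lam ^ 2) + 16 * b * (1 + A) ^ 2
        + (1 + A) / lam + 2 / lam ^ 2 := by
    have : 0 < 1 + A := by linarith
    positivity
  have hδ := hp.drift_coeff_le
  set cδ := 8 / 3 * (1 + A) ^ 2 / (b * lam) + 4 / 3 / (b * lam ^ 2) + 16 * b * (1 + A) ^ 2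
        + (1 + A) / lam + 2 / lam ^ 2
  have hM0 : 0 ≤ M := sq_nonneg _
  clear_value D E NN M Q cδ
  -- The gradients at the mean move by at most `Lf` times the step of the mean, so the drift costs
  -- an extra `η²`, which absorbs the large factor `ω²/b` of `drift_coeff_le`.
  have t1 : cδ * ((1 / ω) ^ 2 * ∑ i, ‖g' i - g i‖ ^ 2) ≤ 3 / 8 * (b / ω ^ 2) * (Q + NN) := by
    calc cδ * ((1 / ω) ^ 2 * ∑ i, ‖g' i - g i‖ ^ 2)
        ≤ cδ * ((1 / ω) ^ 2 * (Lf ^ 2 * (n * ((b / ω) ^ 2 * M)))) := by gcongr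
      _ = cδ * Lf ^ 2 * ((1 / ω) ^ 2 * (b / ω) ^ 2 * (n * M)) := by ring
      _ ≤ 3 / 16 * (ω ^ 2 / b) * ((1 / ω) ^ 2 * (b / ω) ^ 2 * (2 * Q + 2 * NN)) := by gcongr
      _ = _ := by field_simp; ring
  have t2 : (B - 3) / 2 * (n * ((b / ω) ^ 2 * M)) ≤ (B - 3) * (b / ω) ^ 2 * (Q + NN) := by
    calc (B - 3) / 2 * (n * ((b / ω) ^ 2 * M)) = (B - 3) / 2 * ((b / ω) ^ 2 * (n * M)) := by ring
      _ ≤ (B - 3) / 2 * ((b / ω) ^ 2 * (2 * Q + 2 * NN)) := by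
        have : 0 ≤ (B - 3) / 2 := by linarith
        gcongr
      _ = _ := by ring
  have t3 : (1 / ω + 8 / (ω ^ 2 * lam) + 16 * (b / ω) ^ 2 + 6 * B * b / ω ^ 2)
      * ∑ i, ‖q i - g i‖ ^ 2 ≤
      (1 / ω + 8 / (ω ^ 2 * lam) + 16 * (b / ω) ^ 2 + 6 * B * b / ω ^ 2) * Lf ^ 2 * D := by
    rw [mul_assoc _ (Lf ^ 2) D]
    gcongr
  have t4 := mul_le_mul_of_nonneg_right hp.consensus_coeff_le hD0
  have t5 : (A * Lam + 19 / 8 + 2 * Lam + b + 2 * B * A ^ 2 * b * Lam ^ 2) * E ≤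
      (A * Lam + 2 * Lam + 4 + 2 * B * A ^ 2 * b * Lam ^ 2) * E := by
    gcongr ?_ * E
    linarith
  have t6 : 3 / 8 * (b / ω ^ 2) * Q + (B - 3) * (b / ω) ^ 2 * Q ≤
      3 / 8 * (b / ω) * (3 + 3 * B * (b / ω)) * Q := by
    rw [← add_mul]
    exact mul_le_mul_of_nonneg_right hp.gradient_coeff_le hQ0
  have t7 : b * ((8 / ω ^ 2 + 16 / (ω ^ 2 * lam) + 16 * (b / ω) ^ 2 + 6 * B * b / ω ^ 2) * NN)
      + 3 / 8 * (b / ω ^ 2) * NN + (B - 3) * (b / ω) ^ 2 * NN ≤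
      b * (9 + 16 / lam + 16 * b ^ 2 + 7 * B * b) * (1 / ω ^ 2) * NN := by
    rw [← mul_assoc, ← add_mul, ← add_mul]
    exact mul_le_mul_of_nonneg_right hp.noise_coeff_le hN0
  have t8 := mul_le_mul_of_nonneg_left (add_le_add t3 (add_le_add t4 t5)) hb.le
  have e1 : b * (1 / 4 + (3 + 3 * B * (b / ω)) * Lf ^ 2 / (2 * ω)) * D =
      b * ((1 / 4 + (3 + 3 * B * (b / ω)) * Lf ^ 2 / (2 * ω)) * D) := by ring
  linarith

end Modes

/-! ### Smooth functions -/

/-- The descent lemma for functions with Lipschitz gradient. -/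
lemma le_add_inner_gradient_add {E : Type*} [NormedAddCommGroup E] [InnerProductSpace ℝ E]
    [CompleteSpace E] {f : E → ℝ} {K : ℝ} (hf : Differentiable ℝ f)
    (hK : ∀ x y, ‖gradient f x - gradient f y‖ ≤ K * ‖x - y‖) (x y : E) :
    f y ≤ f x + inner ℝ (gradient f x) (y - x) + K / 2 * ‖y - x‖ ^ 2 := by
  set u := y - x with hu
  have hd : ∀ t : ℝ, HasDerivAt (fun t : ℝ => f (x + t • u) - t * inner ℝ (gradient f x) u
      - K / 2 * t ^ 2 * ‖u‖ ^ 2)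
      (inner ℝ (gradient f (x + t • u)) u - inner ℝ (gradient f x) u - K * t * ‖u‖ ^ 2) t := by
    intro t
    have h1 : HasDerivAt (fun t : ℝ => x + t • u) u t := by
      simpa using ((hasDerivAt_id t).smul_const u).const_add x
    have h2 := (hf (x + t • u)).hasFDerivAt.comp_hasDerivAt t h1
    rw [← inner_gradient_left] at h2
    have h3 : HasDerivAt (fun t : ℝ => t * inner ℝ (gradient f x) u)
        (inner ℝ (gradient f x) u) t := by
      simpa using (hasDerivAt_id t).mul_const (inner ℝ (gradient f x) u)
    have h4 : HasDerivAt (fun t : ℝ => K / 2 * t ^ 2 * ‖u‖ ^ 2) (K * t * ‖u‖ ^ 2) t := by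
      refine (((hasDerivAt_pow 2 t).const_mul (K / 2)).mul_const (‖u‖ ^ 2)).congr_deriv ?_
      rw [Nat.cast_two, pow_one]
      ring
    exact (h2.sub h3).sub h4
  have hanti : AntitoneOn (fun t : ℝ => f (x + t • u) - t * inner ℝ (gradient f x) u
      - K / 2 * t ^ 2 * ‖u‖ ^ 2) (Set.Icc 0 1) := by
    refine antitoneOn_of_deriv_nonpos (convex_Icc 0 1)
      (fun t _ => (hd t).continuousAt.continuousWithinAt)
      (fun t _ => (hd t).differentiableAt.differentiableWithinAt) fun t ht => ?_
    rw [interior_Icc] at ht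
    rw [(hd t).deriv, ← inner_sub_left]
    have h1 := real_inner_le_norm (gradient f (x + t • u) - gradient f x) u
    have h2 := hK (x + t • u) x
    rw [add_sub_cancel_left, norm_smul, Real.norm_eq_abs, abs_of_pos ht.1] at h2
    have h3 := mul_le_mul_of_nonneg_right h2 (norm_nonneg u)
    nlinarith
  have := hanti (Set.left_mem_Icc.2 zero_le_one) (Set.right_mem_Icc.2 zero_le_one) zero_le_one
  simp only [one_smul, one_mul, one_pow, mul_one, zero_smul, add_zero, zero_mul, sub_zero,
    zero_pow two_ne_zero, mul_zero] at this
  rw [hu, add_sub_cancel] at this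
  rw [hu]
  linarith

namespace Problem

variable {n d : ℕ} {Ξ : Fin n → Type*} [∀ i, MeasurableSpace (Ξ i)] {p : Problem n d Ξ} {Lf : ℝ}

lemma Smooth.hasGradientAt_cost (hp : p.Smooth Lf) (x : Vec d) :
    HasGradientAt p.cost (mean fun i => gradient (p.localCost i) x) x := by
  have h1 : HasFDerivAt (fun y => (1 / (n : ℝ)) * ∑ i, p.localCost i y)
      ((1 / (n : ℝ)) • ∑ i, fderiv ℝ (p.localCost i) x) x :=
    (HasFDerivAt.fun_sum fun i _ => (hp.differentiable i x).hasFDerivAt).const_mul _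
  rw [hasGradientAt_iff_hasFDerivAt]
  have h2 : (InnerProductSpace.toDual ℝ (Vec d)) (mean fun i => gradient (p.localCost i) x) =
      (1 / (n : ℝ)) • ∑ i, fderiv ℝ (p.localCost i) x := by
    ext y
    rw [mean, InnerProductSpace.toDual_apply_apply, real_inner_smul_left, sum_inner]
    simp [inner_gradient_left]
  rw [h2]
  exact h1

lemma Smooth.gradient_cost (hp : p.Smooth Lf) (x : Vec d) :
    gradient p.cost x = mean fun i => gradient (p.localCost i) x :=
  (hp.hasGradientAt_cost x).gradient

lemma Smooth.differentiable_cost (hp : p.Smooth Lf) : Differentiable ℝ p.cost :=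
  fun x => (hp.hasGradientAt_cost x).differentiableAt

end Problem

lemma mean_sub {n d : ℕ} (z w : Fin n → Vec d) :
    mean (fun i => z i - w i) = mean z - mean w := by
  simp [mean, Finset.sum_sub_distrib, smul_sub]

lemma norm_mean_sq_le {n d : ℕ} (z : Fin n → Vec d) :
    ‖mean z‖ ^ 2 ≤ 1 / (n : ℝ) * ∑ i, ‖z i‖ ^ 2 := by
  rcases Nat.eq_zero_or_pos n with rfl | hn
  · simp [mean]
  have hn' : (0 : ℝ) < n := by exact_mod_cast hn
  have := card_mul_norm_mean_sq_le z
  rw [one_div, inv_mul_eq_div, le_div_iff₀ hn']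
  linarith

namespace Problem

variable {n d : ℕ} {Ξ : Fin n → Type*} [∀ i, MeasurableSpace (Ξ i)] {p : Problem n d Ξ} {Lf : ℝ}

lemma Smooth.lipschitz_cost (hp : p.Smooth Lf) (hLf : 0 ≤ Lf) (x y : Vec d) :
    ‖gradient p.cost x - gradient p.cost y‖ ≤ Lf * ‖x - y‖ := by
  rcases Nat.eq_zero_or_pos n with hn | hn
  · subst hn
    rw [hp.gradient_cost, hp.gradient_cost]
    simp only [mean, Finset.univ_eq_empty, Finset.sum_empty, smul_zero, sub_zero, norm_zero]
    positivity
  have hn' : (0 : ℝ) < n := by exact_mod_cast hn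
  refine abs_le_of_sq_le_sq' ?_ (by positivity) |>.2
  rw [hp.gradient_cost, hp.gradient_cost, ← mean_sub]
  calc _ ≤ 1 / (n : ℝ) * ∑ i, ‖gradient (p.localCost i) x - gradient (p.localCost i) y‖ ^ 2 :=
        norm_mean_sq_le _
    _ ≤ 1 / (n : ℝ) * ∑ _i : Fin n, (Lf * ‖x - y‖) ^ 2 := by
        gcongr with i
        exact hp.lipschitz i x y
    _ = _ := by
        simp only [Finset.sum_const, Finset.card_univ, Fintype.card_fin, nsmul_eq_mul]
        field_simp

lemma Smooth.sum_gradient_sub_sq_le (hp : p.Smooth Lf) (x y : Fin n → Vec d) :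
    ∑ i, ‖gradient (p.localCost i) (x i) - gradient (p.localCost i) (y i)‖ ^ 2 ≤
      Lf ^ 2 * ∑ i, ‖x i - y i‖ ^ 2 := by
  rw [Finset.mul_sum]
  refine Finset.sum_le_sum fun i _ => ?_
  rw [← mul_pow]
  gcongr
  exact hp.lipschitz i _ _

lemma Smooth.norm_gradient_cost_sub_mean_sq_le (hp : p.Smooth Lf) (x : Fin n → Vec d) :
    ‖gradient p.cost (mean x) - mean (fun i => gradient (p.localCost i) (x i))‖ ^ 2 ≤
      Lf ^ 2 * (1 / (n : ℝ) * ∑ i, ‖x i - mean x‖ ^ 2) := by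
  rw [hp.gradient_cost, ← mean_sub]
  refine (norm_mean_sq_le _).trans ?_
  have h := hp.sum_gradient_sub_sq_le (fun _ => mean x) x
  simp only [norm_sub_rev (mean x)] at h
  calc _ ≤ 1 / (n : ℝ) * (Lf ^ 2 * ∑ i, ‖x i - mean x‖ ^ 2) := by gcongr
    _ = _ := by ring

/-- The decrease of the global cost along a step of length `η` in a perturbed mean gradient
direction, before taking expectations. -/
lemma Smooth.cost_step_le (hp : p.Smooth Lf) (hLf : 0 < Lf) {η : ℝ} (hη : 0 ≤ η)
    (hηL : 4 * η * Lf ≤ 1) (x : Fin n → Vec d) (N : Vec d) :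
    p.cost (mean x - η • (mean (fun i => gradient (p.localCost i) (x i)) + N)) ≤
      p.cost (mean x) - η / 2 * ‖gradient p.cost (mean x)‖ ^ 2
        - 3 / 8 * η * ‖mean (fun i => gradient (p.localCost i) (x i))‖ ^ 2
        + η / 2 * (Lf ^ 2 * (1 / (n : ℝ) * ∑ i, ‖x i - mean x‖ ^ 2))
        + Lf / 2 * η ^ 2 * ‖N‖ ^ 2
        + (Lf * η ^ 2 * inner ℝ (mean (fun i => gradient (p.localCost i) (x i))) N
          - η * inner ℝ (gradient p.cost (mean x)) N) := by
  have h1 := le_add_inner_gradient_add hp.differentiable_cost (hp.lipschitz_cost hLf.le) (mean x)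
    (mean x - η • (mean (fun i => gradient (p.localCost i) (x i)) + N))
  have h2 := hp.norm_gradient_cost_sub_mean_sq_le x
  set G := mean (fun i => gradient (p.localCost i) (x i))
  set F := gradient p.cost (mean x)
  rw [sub_sub_cancel_left, norm_neg, norm_smul, inner_neg_right, inner_smul_right, inner_add_right,
    mul_pow, Real.norm_eq_abs, sq_abs, norm_add_sq_real] at h1
  rw [norm_sub_sq_real] at h2
  -- Polarization of `⟨F, G⟩` provides `-η/2 ‖G‖²`; the quadratic term takes back at most `η/8`,
  -- which leaves `3/8`. The inner products with `N` stay exact because they will have mean zero.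
  have h3 : Lf * η * (η * ‖G‖ ^ 2) ≤ 1 / 4 * (η * ‖G‖ ^ 2) := by
    gcongr
    linarith
  have h4 := mul_le_mul_of_nonneg_left h2 (by linarith : 0 ≤ η / 2)
  nlinarith

end Problem

/-! ### Consequences of the thresholds -/

lemma r0_nonneg {φ r : ℝ} (hφ : φ ≤ 1) : 0 ≤ r0 φ r := by
  unfold r0
  have : 0 ≤ 1 - φ := by linarith
  positivity

/-- Below the positive root of a quadratic. -/
lemma quadratic_lt_of_lt_root {a b c t : ℝ} (hc : 0 < c) (hb : 0 ≤ b) (ht : 0 < t)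
    (h : t < (Real.sqrt (b ^ 2 + 4 * a * c) - b) / (2 * c)) : t * b + t ^ 2 * c < a := by
  rw [lt_div_iff₀ (by positivity)] at h
  have h1 : t * (2 * c) + b < Real.sqrt (b ^ 2 + 4 * a * c) := by linarith
  rw [Real.lt_sqrt (by positivity)] at h1
  have h2 : 4 * c * (t * b + t ^ 2 * c) < 4 * c * a := by linarith
  exact lt_of_mul_lt_mul_left h2 (by positivity)

section Thresholds

variable {φ r α β₁ β₂ β₅ lam Lam Lf ω : ℝ}

lemma div_lt_of_div_lt {a b c : ℝ} (hb : 0 < b) (hc : 0 < c) (h : a / b < c) :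
    a / c < b := by
  rw [div_lt_iff₀ hb] at h
  rw [div_lt_iff₀ hc]
  linarith

/-- Above the threshold `beta3`, the step size is below `beta4` and the parameters are
admissible. -/
lemma admissible_of_beta3_lt (hφ : 0 < φ) (hφ1 : φ ≤ 1) (hr : 0 < r) (hα : 0 < α) (hα1 : α < 1 / r)
    (hlam : 0 < lam) (hLam : lam ≤ Lam) (hβ₅ : 0 < β₅) (hβ₁ : c0 lam β₅ < β₁) (hβ₂ : 0 < β₂)
    (hLf : 0 < Lf) (hω : beta3 lam Lam Lf φ r α β₁ β₂ β₅ ω < ω) :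
    Admissible β₂ β₁ ω lam Lam (7 + 8 / (α * r * φ)) Lf ∧
      β₂ * (β₁ * Lam + 2 * Lam + 4 + 2 * (7 + 8 / (α * r * φ)) * β₁ ^ 2 * β₂ * Lam ^ 2)
        * r0 φ r ≤ α * r * φ + (α * r * φ) ^ 2 := by
  have hφ₁ : 0 < α * r * φ := by positivity
  have hφ₁1 : α * r * φ < 1 := by
    have : α * r < 1 := by rwa [lt_div_iff₀ hr] at hα1
    nlinarith
  set φ₁ := α * r * φ with hφ₁def
  unfold beta3 at hω
  simp only [max_lt_iff] at hω
  obtain ⟨w1, w2, w3, w4, w5⟩ := hω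
  unfold c0 at hβ₁
  obtain ⟨c1, c2⟩ := max_lt_iff.1 hβ₁
  have hω0 : 0 < ω := lt_trans (by positivity) w5
  rw [div_lt_iff₀ (by positivity)] at c1
  rw [div_lt_iff₀ hβ₅] at w1
  rw [div_lt_iff₀ (by norm_num)] at w2
  have hLam0 : 0 < Lam := hlam.trans_le hLam
  have hinv : 0 < lam⁻¹ := inv_pos.2 hlam
  have hω3 : 1 / 3 < ω := by linarith
  have hb6 : beta6 lam Lf β₁ < ω ^ 2 := (Real.sqrt_lt' hω0).1 w3
  have p1 : 0 < eps1 lam Lf β₁ ω := by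
    unfold eps1
    nlinarith
  have p2 : 0 < eps2 Lam Lf φ₁ β₁ ω := by
    unfold eps2; positivity
  have p4 : 0 < eps4 lam ω := by unfold eps4; linarith
  have p5 : 0 < eps5 lam Lam φ₁ ω := by unfold eps5; positivity
  have p6 : 0 < eps6 lam Lf β₁ ω := by
    unfold eps6
    have h1 : (2 * (1 + β₁) ^ 2 / (ω ^ 2 * lam) + 1 / (ω ^ 2 * lam ^ 2)) * Lf ^ 2
        = beta6 lam Lf β₁ / (8 * ω ^ 2) := by
      unfold beta6; field_simp; ring
    have h2 : beta6 lam Lf β₁ / (8 * ω ^ 2) < 1 / 8 := by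
      rw [div_lt_iff₀ (by positivity)]; linarith
    rw [h1]; linarith
  have p7 : 0 < eps7 lam Lf β₁ ω := by unfold eps7; positivity
  have p10 : 0 < eps10 φ₁ := by unfold eps10; positivity
  have hr0 := r0_nonneg (r := r) hφ1
  have p11 : 0 ≤ eps11 Lam (r0 φ r) β₁ ω := by unfold eps11; positivity
  have pr : 0 < compressionRoot Lam φ₁ (r0 φ r) β₁ ω := by
    unfold compressionRoot
    split_ifs with h0
    · exact one_pos
    · have hr0' : 0 < r0 φ r := lt_of_le_of_ne hr0 (Ne.symm h0)
      have p12 : 0 < eps12 Lam φ₁ (r0 φ r) β₁ ω := by unfold eps12; positivity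
      refine div_pos (sub_pos.2 ?_) (by positivity)
      refine Real.lt_sqrt_of_sq_lt ?_
      have : 0 < 4 * eps10 φ₁ * eps12 Lam φ₁ (r0 φ r) β₁ ω := by positivity
      linarith
  -- Positivity is needed before the entry `β₂ / beta4` of `beta3` can be read as a bound on the
  -- step size; the other entries of `beta3` supply it.
  have hβ₄ : 0 < beta4 lam Lam Lf φ r α β₁ ω := by
    unfold beta4
    rw [← hφ₁def]
    simp only [lt_min_iff]
    exact ⟨div_pos p1 p2, div_pos p4 p5, div_pos p6 p7, pr, one_pos⟩
  have hη := div_lt_of_div_lt hβ₄ hω0 w4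
  unfold beta4 at hη
  rw [← hφ₁def] at hη
  simp only [lt_min_iff] at hη
  obtain ⟨q1, -, -, q4, -⟩ := hη
  have hη0 : 0 < β₂ / ω := by positivity
  have hB : 15 ≤ 7 + 8 / φ₁ := by
    have : 8 ≤ 8 / φ₁ := by rw [le_div_iff₀ hφ₁]; linarith
    linarith
  set B := 7 + 8 / φ₁ with hBdef
  refine ⟨⟨hβ₂, c2, hω3, hlam, hLam, hB, hLf, ?_, hb6.le, ?_⟩, ?_⟩
  -- From `η ε̃₂ < ε̃₁`, keep in `ε̃₂` only the terms with `γ²Λ²`, whose coefficients `4 + 8/φ₁` and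
  -- `3` add up to `B`, and divide by `ω/2`.
  · rw [lt_div_iff₀ p2] at q1
    have h1 : B * (β₁ * ω) ^ 2 * Lam ^ 2 ≤ eps2 Lam Lf φ₁ β₁ ω := by
      unfold eps2
      have h2 : 0 ≤ (7 + 16 / φ₁) * Lf ^ 2 := by positivity
      have h3 : 0 ≤ ω ^ 2 := sq_nonneg _
      rw [hBdef]
      linarith
    have h2 : β₂ / ω * (B * (β₁ * ω) ^ 2 * Lam ^ 2) < eps1 lam Lf β₁ ω :=
      lt_of_le_of_lt (mul_le_mul_of_nonneg_left h1 hη0.le) q1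
    have h3 : β₂ / ω * (B * (β₁ * ω) ^ 2 * Lam ^ 2) = ω / 2 * (2 * β₂ * B * β₁ ^ 2 * Lam ^ 2) := by
      field_simp
    have h4 : eps1 lam Lf β₁ ω =
        ω / 2 * (β₁ * lam - 9 / 2 - (2 + 5 / 2 * Lf ^ 2) / ω) := by
      unfold eps1; field_simp; ring
    rw [h3, h4] at h2
    have := lt_of_mul_lt_mul_left h2 (by positivity)
    linarith
  · linarith
  -- Since `(8 + 7φ₁)/φ₁ = B`, twice this inequality without the nonnegative term `(η² + 2β₂²)r₀` is
  -- the claim. If `r₀ = 0`, both coefficients vanish and it holds trivially.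
  · have key : β₂ / ω * eps11 Lam (r0 φ r) β₁ ω + (β₂ / ω) ^ 2 * eps12 Lam φ₁ (r0 φ r) β₁ ω
        < eps10 φ₁ := by
      unfold compressionRoot at q4
      split_ifs at q4 with h0
      · have e1 : eps11 Lam (r0 φ r) β₁ ω = 0 := by unfold eps11; rw [h0]; ring
        have e2 : eps12 Lam φ₁ (r0 φ r) β₁ ω = 0 := by unfold eps12; rw [h0]; ring
        rw [e1, e2]
        simpa using p10
      · have hr0' : 0 < r0 φ r := lt_of_le_of_ne hr0 (Ne.symm h0)
        have p12 : 0 < eps12 Lam φ₁ (r0 φ r) β₁ ω := by unfold eps12; positivity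
        exact quadratic_lt_of_lt_root p12 p11 hη0 q4
    have e1 : β₂ / ω * eps11 Lam (r0 φ r) β₁ ω + (β₂ / ω) ^ 2 * eps12 Lam φ₁ (r0 φ r) β₁ ω =
        1 / 2 * (β₂ * (β₁ * Lam + 2 * Lam + 4 + 2 * B * β₁ ^ 2 * β₂ * Lam ^ 2) * r0 φ r)
        + ((β₂ / ω) ^ 2 + 2 * β₂ ^ 2) * r0 φ r := by
      unfold eps11 eps12
      rw [hBdef]
      field_simp
      ring
    rw [e1] at key
    unfold eps10 at key
    have : 0 ≤ ((β₂ / ω) ^ 2 + 2 * β₂ ^ 2) * r0 φ r := by positivity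
    linarith

end Thresholds

/-! ### Expectations of functions of independent variables -/

section Indep

variable {Ω E F : Type*} [MeasurableSpace Ω] [MeasurableSpace E] [MeasurableSpace F]
  {P : Measure Ω} [IsProbabilityMeasure P] {X : Ω → E} {Y : Ω → F}

/-- A conditional expectation bound in Fubini form: the joint law is a product, so `X` can be frozen
while integrating over `Y`. As `u ≥ 0`, integrability comes from the bound on the inner integral. -/
lemma integral_comp_le_of_indepFun (hX : Measurable X) (hY : Measurable Y) (h : IndepFun X Y P)
    {u : E → F → ℝ} (hu : Measurable fun q : E × F => u q.1 q.2) (hu0 : ∀ x y, 0 ≤ u x y)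
    (hui : ∀ x, Integrable (u x) (P.map Y)) {w : E → ℝ} (hw : Measurable w)
    (hle : ∀ x, ∫ y, u x y ∂(P.map Y) ≤ w x) (hwi : Integrable (fun a => w (X a)) P) :
    Integrable (fun a => u (X a) (Y a)) P ∧ ∫ a, u (X a) (Y a) ∂P ≤ ∫ a, w (X a) ∂P := by
  have : IsProbabilityMeasure (P.map X) := Measure.isProbabilityMeasure_map hX.aemeasurable
  have : IsProbabilityMeasure (P.map Y) := Measure.isProbabilityMeasure_map hY.aemeasurable
  have hmap := h.map_prod_eq_prod_map_map hX.aemeasurable hY.aemeasurable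
  have hwi' : Integrable w (P.map X) :=
    (integrable_map_measure hw.aestronglyMeasurable hX.aemeasurable).2 hwi
  have hint : Integrable (fun x => ∫ y, u x y ∂(P.map Y)) (P.map X) := by
    refine hwi'.mono' ?_ (ae_of_all _ fun x => ?_)
    · exact (hu.stronglyMeasurable.integral_prod_right).aestronglyMeasurable
    · rw [Real.norm_eq_abs, abs_of_nonneg (integral_nonneg (hu0 x))]
      exact hle x
  have hprod : Integrable (fun q : E × F => u q.1 q.2) ((P.map X).prod (P.map Y)) := by
    rw [integrable_prod_iff hu.aestronglyMeasurable]
    refine ⟨ae_of_all _ hui, ?_⟩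
    simpa only [Real.norm_eq_abs, abs_of_nonneg (hu0 _ _)] using hint
  have hXY : Measurable fun a => (X a, Y a) := hX.prodMk hY
  refine ⟨?_, ?_⟩
  · rw [← hmap] at hprod
    exact (integrable_map_measure hu.aestronglyMeasurable hXY.aemeasurable).1 hprod
  · calc ∫ a, u (X a) (Y a) ∂P = ∫ q, u q.1 q.2 ∂(P.map fun a => (X a, Y a)) :=
          (integral_map hXY.aemeasurable hu.aestronglyMeasurable).symm
      _ = ∫ x, ∫ y, u x y ∂(P.map Y) ∂(P.map X) := by rw [hmap, integral_prod _ hprod]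
      _ ≤ ∫ x, w x ∂(P.map X) := integral_mono hint hwi' hle
      _ = ∫ a, w (X a) ∂P := integral_map hX.aemeasurable hw.aestronglyMeasurable

lemma integral_comp_eq_zero_of_indepFun (hX : Measurable X) (hY : Measurable Y)
    (h : IndepFun X Y P) {u : E → F → ℝ} (hu : Measurable fun q : E × F => u q.1 q.2)
    (hui : Integrable (fun a => u (X a) (Y a)) P) (h0 : ∀ x, ∫ y, u x y ∂(P.map Y) = 0) :
    ∫ a, u (X a) (Y a) ∂P = 0 := by
  have : IsProbabilityMeasure (P.map X) := Measure.isProbabilityMeasure_map hX.aemeasurable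
  have : IsProbabilityMeasure (P.map Y) := Measure.isProbabilityMeasure_map hY.aemeasurable
  have hmap := h.map_prod_eq_prod_map_map hX.aemeasurable hY.aemeasurable
  have hXY : Measurable fun a => (X a, Y a) := hX.prodMk hY
  have hprod : Integrable (fun q : E × F => u q.1 q.2) ((P.map X).prod (P.map Y)) := by
    rw [← hmap]
    exact (integrable_map_measure hu.aestronglyMeasurable hXY.aemeasurable).2 hui
  calc ∫ a, u (X a) (Y a) ∂P = ∫ q, u q.1 q.2 ∂(P.map fun a => (X a, Y a)) :=
        (integral_map hXY.aemeasurable hu.aestronglyMeasurable).symm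
    _ = ∫ x, ∫ y, u x y ∂(P.map Y) ∂(P.map X) := by rw [hmap, integral_prod _ hprod]
    _ = 0 := by simp [h0]

end Indep

/-! ### The σ-algebras of the samples -/

section Sampling

variable {n : ℕ} {Ξ : Fin n → Type*} [∀ i, MeasurableSpace (Ξ i)] {Z Ω : Type*}
  [MeasurableSpace Z] {ξ : ∀ i, ℕ → Ω → Ξ i} {ζ : Fin n → ℕ → Ω → Z}

/-- The σ-algebras of the single data and of the compressor draws at the single times. -/
@[reducible] def drawSigma (ξ : ∀ i, ℕ → Ω → Ξ i) (ζ : Fin n → ℕ → Ω → Z) :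
    (Fin n × ℕ) ⊕ ℕ → MeasurableSpace Ω
  | .inl q => MeasurableSpace.comap (ξ q.1 q.2) inferInstance
  | .inr k => MeasurableSpace.comap (fun a i => ζ i k a) inferInstance

/-- The σ-algebra of the draws in a set of indices. -/
@[reducible] def drawsSigma (ξ : ∀ i, ℕ → Ω → Ξ i) (ζ : Fin n → ℕ → Ω → Z) (S : Set ((Fin n × ℕ) ⊕ ℕ)) :
    MeasurableSpace Ω := ⨆ s ∈ S, drawSigma ξ ζ s

lemma drawsSigma_mono {S T : Set ((Fin n × ℕ) ⊕ ℕ)} (h : S ⊆ T) :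
    drawsSigma ξ ζ S ≤ drawsSigma ξ ζ T := biSup_mono h

lemma measurable_data_drawsSigma {S : Set ((Fin n × ℕ) ⊕ ℕ)} {i : Fin n} {k : ℕ}
    (h : Sum.inl (i, k) ∈ S) : Measurable[drawsSigma ξ ζ S] (ξ i k) :=
  Measurable.mono (comap_measurable (ξ i k))
    (le_biSup (drawSigma ξ ζ) h) le_rfl

lemma measurable_comp_drawsSigma {S : Set ((Fin n × ℕ) ⊕ ℕ)} {k : ℕ}
    (h : Sum.inr k ∈ S) (i : Fin n) : Measurable[drawsSigma ξ ζ S] (ζ i k) := by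
  have h1 : Measurable[drawsSigma ξ ζ S] (fun a i => ζ i k a) :=
    Measurable.mono (comap_measurable (fun a i => ζ i k a)) (le_biSup (drawSigma ξ ζ) h) le_rfl
  exact (measurable_pi_apply i).comp h1

variable [mΩ : MeasurableSpace Ω] {D : ∀ i, Measure (Ξ i)} {Q : Measure Z} {P : Measure Ω}

lemma IsSampling.drawSigma_le (h : IsSampling D Q P ξ ζ) (s : (Fin n × ℕ) ⊕ ℕ) :
    drawSigma ξ ζ s ≤ mΩ := by
  rcases s with q | k
  · exact (h.measurable_data q.1 q.2).comap_le
  · exact (measurable_pi_lambda _ fun i => h.measurable_comp i k).comap_le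

lemma IsSampling.drawsSigma_le (h : IsSampling D Q P ξ ζ) (S : Set ((Fin n × ℕ) ⊕ ℕ)) :
    drawsSigma ξ ζ S ≤ mΩ := iSup₂_le fun s _ => h.drawSigma_le s

/-- A finite intersection of events splits into a data part and a compressor part. These are
independent of each other, and each factors by its own family. The compressor draws of all agents at
one time form a single index, as no independence among them is assumed. -/
lemma IsSampling.iIndep_drawSigma (h : IsSampling D Q P ξ ζ) : iIndep (drawSigma ξ ζ) P := by
  rw [iIndep_iff]
  intro s f hf
  have hd := (iIndep_iff _ _).1 h.indep_data.iIndep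
  have hc := (iIndep_iff _ _).1 h.indep_comp.iIndep
  have hdc := (Indep_iff _ _ _).1 ((IndepFun_iff_Indep _ _ _).1 h.indep_data_comp)
  have h1 : (⋂ i ∈ s, f i) =
      (⋂ q ∈ s.toLeft, f (Sum.inl q)) ∩ (⋂ k ∈ s.toRight, f (Sum.inr k)) := by
    ext a
    simp only [Set.mem_iInter, Set.mem_inter_iff, Finset.mem_toLeft, Finset.mem_toRight]
    constructor
    · exact fun H => ⟨fun q hq => H _ hq, fun k hk => H _ hk⟩
    · rintro ⟨H1, H2⟩ (q | k) hi
      · exact H1 q hi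
      · exact H2 k hi
  have hD : ∀ q : Fin n × ℕ, drawSigma ξ ζ (Sum.inl q) ≤
      MeasurableSpace.comap (fun (a : Ω) (q : Fin n × ℕ) => ξ q.1 q.2 a) inferInstance := by
    intro q
    refine Measurable.comap_le ?_
    exact (measurable_pi_apply q).comp
      (comap_measurable (fun (a : Ω) (q : Fin n × ℕ) => ξ q.1 q.2 a))
  have hC : ∀ k : ℕ, drawSigma ξ ζ (Sum.inr k) ≤
      MeasurableSpace.comap (fun (a : Ω) (q : Fin n × ℕ) => ζ q.1 q.2 a) inferInstance := by
    intro k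
    refine Measurable.comap_le ?_
    have h2 : Measurable fun (b : Fin n × ℕ → Z) (i : Fin n) => b (i, k) :=
      measurable_pi_lambda _ fun i => measurable_pi_apply (i, k)
    exact h2.comp (comap_measurable (fun (a : Ω) (q : Fin n × ℕ) => ζ q.1 q.2 a))
  have hfl : ∀ q ∈ s.toLeft, MeasurableSet[drawSigma ξ ζ (Sum.inl q)] (f (Sum.inl q)) :=
    fun q hq => hf _ (Finset.mem_toLeft.1 hq)
  have hfr : ∀ k ∈ s.toRight, MeasurableSet[drawSigma ξ ζ (Sum.inr k)] (f (Sum.inr k)) :=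
    fun k hk => hf _ (Finset.mem_toRight.1 hk)
  rw [h1, hdc _ _ (Finset.measurableSet_biInter _ fun q hq => hD q _ (hfl q hq))
    (Finset.measurableSet_biInter _ fun k hk => hC k _ (hfr k hk)),
    hd s.toLeft (f := fun q => f (Sum.inl q)) hfl, hc s.toRight (f := fun k => f (Sum.inr k)) hfr]
  conv_rhs => rw [← Finset.toLeft_disjSum_toRight (u := s)]
  rw [Finset.prod_disjSum]

lemma IsSampling.indepFun (h : IsSampling D Q P ξ ζ) {S T : Set ((Fin n × ℕ) ⊕ ℕ)}
    (hST : Disjoint S T) {E F : Type*} [MeasurableSpace E] [MeasurableSpace F] {X : Ω → E}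
    {Y : Ω → F} (hX : Measurable[drawsSigma ξ ζ S] X) (hY : Measurable[drawsSigma ξ ζ T] Y) :
    IndepFun X Y P := by
  rw [IndepFun_iff_Indep]
  exact indep_of_indep_of_le_left (indep_of_indep_of_le_right
    (indep_iSup_of_disjoint h.drawSigma_le h.iIndep_drawSigma hST) hY.comap_le) hX.comap_le

/-- The indices of the draws before time `k`. -/
def pastDraws (n k : ℕ) : Set ((Fin n × ℕ) ⊕ ℕ) :=
  {s | Sum.elim (fun q => q.2) id s < k}

end Sampling

/-! ### The random trajectory -/

/-- The data of a run of RCP-SGD with constant parameters. -/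
structure Run (n d : ℕ) (Ξ : Fin n → Type*) [∀ i, MeasurableSpace (Ξ i)] (Z Ω : Type*) where
  p : Problem n d Ξ
  W : Matrix (Fin n) (Fin n) ℝ
  C : Vec d → Z → Vec d
  x₀ : Fin n → Vec d
  ξ : ∀ i, ℕ → Ω → Ξ i
  ζ : Fin n → ℕ → Ω → Z
  β₁ : ℝ
  β₂ : ℝ
  α : ℝ
  h₀ : ℝ
  ω : ℝ

namespace Run

section Defs

variable {n d : ℕ} {Ξ : Fin n → Type*} [∀ i, MeasurableSpace (Ξ i)] {Z Ω : Type*}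
  (R : Run n d Ξ Z Ω)

/-- The state at time `k`. -/
noncomputable def state (k : ℕ) (a : Ω) : State n d :=
  iterate (laplacian R.W) (fun _ => R.β₂ / R.ω) (fun _ => R.β₁ * R.ω) (fun _ => R.ω)
    (fun k => R.h₀ ^ k) R.α R.C R.p.stochGrad R.x₀ (fun i k => R.ξ i k a) (fun i k => R.ζ i k a) k

noncomputable def x (k : ℕ) (a : Ω) (i : Fin n) : Vec d := (R.state k a).x i

noncomputable def v (k : ℕ) (a : Ω) (i : Fin n) : Vec d := (R.state k a).v i

noncomputable def c (k : ℕ) (a : Ω) (i : Fin n) : Vec d := (R.state k a).c i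

/-- The argument of the compressor. -/
noncomputable def compArg (k : ℕ) (a : Ω) (i : Fin n) : Vec d :=
  (1 / R.h₀ ^ k) • (R.x k a i - R.c k a i)

/-- The reconstructed decisions. -/
noncomputable def xhat (k : ℕ) (a : Ω) (i : Fin n) : Vec d :=
  R.c k a i + R.h₀ ^ k • R.C (R.compArg k a i) (R.ζ i k a)

/-- The exact local gradients at the decisions. -/
noncomputable def grad (k : ℕ) (a : Ω) (i : Fin n) : Vec d :=
  gradient (R.p.localCost i) (R.x k a i)

/-- The noise of the stochastic gradients. -/
noncomputable def noise (k : ℕ) (a : Ω) (i : Fin n) : Vec d :=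
  R.p.stochGrad i (R.x k a i) (R.ξ i k a) - R.grad k a i

/-- The squared error of the rescaled compressor. -/
noncomputable def compErr (r : ℝ) (k : ℕ) (a : Ω) (i : Fin n) : ℝ :=
  ‖(1 / r) • R.C (R.compArg k a i) (R.ζ i k a) - R.compArg k a i‖ ^ 2

lemma x_zero (a : Ω) : R.x 0 a = R.x₀ := rfl

lemma v_zero (a : Ω) (i : Fin n) : R.v 0 a i = 0 := rfl

lemma c_zero (a : Ω) (i : Fin n) : R.c 0 a i = 0 := rfl

lemma x_succ (k : ℕ) (a : Ω) (i : Fin n) :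
    R.x (k + 1) a i = R.x k a i - (R.β₂ / R.ω) •
      ((R.β₁ * R.ω) • (∑ j, laplacian R.W i j • R.xhat k a j) + R.ω • R.v k a i
        + (R.grad k a i + R.noise k a i)) := by
  rw [noise, add_sub_cancel]
  rfl

lemma v_succ (k : ℕ) (a : Ω) (i : Fin n) :
    R.v (k + 1) a i = R.v k a i + (R.β₂ / R.ω * R.ω) •
      ∑ j, laplacian R.W i j • R.xhat k a j := rfl

lemma c_succ (k : ℕ) (a : Ω) (i : Fin n) :
    R.c (k + 1) a i = (1 - R.α) • R.c k a i + R.α • R.xhat k a i := rfl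

/-- Zero column sums preserve the zero initial sum of the duals. Hence the mean performs an
undisturbed stochastic gradient step, whatever the compressor does. -/
lemma sum_v (hcol : ∀ j, ∑ i, laplacian R.W i j = 0) (k : ℕ) (a : Ω) : ∑ i, R.v k a i = 0 := by
  induction k with
  | zero => simp [v_zero]
  | succ k ih =>
    simp only [v_succ, Finset.sum_add_distrib, ih, zero_add, ← Finset.smul_sum]
    rw [Finset.sum_comm]
    simp only [← Finset.sum_smul, hcol, zero_smul, Finset.sum_const_zero, smul_zero]

lemma mean_x_succ (hcol : ∀ j, ∑ i, laplacian R.W i j = 0) (k : ℕ) (a : Ω) :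
    mean (R.x (k + 1) a) =
      mean (R.x k a) - (R.β₂ / R.ω) • (mean (R.grad k a) + mean (R.noise k a)) := by
  have h1 : ∑ i, ∑ j, laplacian R.W i j • R.xhat k a j = 0 := by
    rw [Finset.sum_comm]
    simp only [← Finset.sum_smul, hcol, zero_smul, Finset.sum_const_zero]
  simp only [mean, x_succ, Finset.sum_sub_distrib, Finset.sum_add_distrib, ← Finset.smul_sum, h1,
    R.sum_v hcol, smul_zero, zero_add, smul_sub, ← smul_add]
  rw [smul_comm]

variable {R}

lemma smul_compArg (hh : R.h₀ ≠ 0) (k : ℕ) (a : Ω) (i : Fin n) :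
    R.h₀ ^ k • R.compArg k a i = R.x k a i - R.c k a i := by
  rw [compArg, smul_smul, mul_one_div_cancel (pow_ne_zero _ hh), one_smul]

lemma norm_sq_compArg (hh : R.h₀ ≠ 0) (k : ℕ) (a : Ω) (i : Fin n) :
    (R.h₀ ^ k) ^ 2 * ‖R.compArg k a i‖ ^ 2 = ‖R.x k a i - R.c k a i‖ ^ 2 := by
  rw [← smul_compArg hh, norm_smul, mul_pow, Real.norm_eq_abs, sq_abs]

/-- The decoding error is `h_k` times `r` times the error of the rescaled compressor plus `(r - 1)`
times its argument. In expectation the two parts add up to the factor `r0`. -/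
lemma norm_xhat_sub_x_sq_le (hh : R.h₀ ≠ 0) {r : ℝ} (hr : 0 < r) (k : ℕ) (a : Ω) (i : Fin n) :
    ‖R.xhat k a i - R.x k a i‖ ^ 2 ≤
      2 * (1 - r) ^ 2 * ‖R.x k a i - R.c k a i‖ ^ 2
        + 2 * r ^ 2 * ((R.h₀ ^ k) ^ 2 * R.compErr r k a i) := by
  have h1 : R.xhat k a i - R.x k a i = R.h₀ ^ k •
      (r • ((1 / r) • R.C (R.compArg k a i) (R.ζ i k a) - R.compArg k a i)
        + (r - 1) • R.compArg k a i) := by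
    have h2 := smul_compArg hh k a i
    have h3 : R.x k a i = R.c k a i + R.h₀ ^ k • R.compArg k a i := by rw [h2]; abel
    rw [h3, xhat, smul_sub, smul_smul, mul_one_div_cancel hr.ne', one_smul]
    module
  rw [h1, norm_smul, mul_pow, Real.norm_eq_abs, sq_abs, ← norm_sq_compArg hh]
  have h4 := norm_add_sq_le_two
    (r • ((1 / r) • R.C (R.compArg k a i) (R.ζ i k a) - R.compArg k a i))
    ((r - 1) • R.compArg k a i)
  rw [norm_smul r, norm_smul (r - 1), mul_pow, mul_pow, Real.norm_eq_abs, sq_abs,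
    Real.norm_eq_abs, sq_abs] at h4
  have h5 := mul_le_mul_of_nonneg_left h4 (sq_nonneg (R.h₀ ^ k))
  unfold compErr
  linarith

/-- Up to the scale `h_k`, the new difference is a combination with weights `1 - αr` and `αr` of the
argument and minus its compression error; convexity of the squared norm applies. In expectation the
relative part contracts by `1 - αr + αr(1 - φ) = 1 - φ₁`. -/
lemma norm_x_sub_c_succ_sq_le (hh : R.h₀ ≠ 0) {r : ℝ} (hr : 0 < r) (hα : 0 ≤ R.α)
    (hαr : R.α * r ≤ 1) (k : ℕ) (a : Ω) (i : Fin n) :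
    ‖R.x k a i - R.c (k + 1) a i‖ ^ 2 ≤
      (1 - R.α * r) * ‖R.x k a i - R.c k a i‖ ^ 2
        + R.α * r * ((R.h₀ ^ k) ^ 2 * R.compErr r k a i) := by
  set w := R.compArg k a i
  set e := (1 / r) • R.C w (R.ζ i k a) - w with he
  have h1 : R.x k a i - R.c (k + 1) a i = R.h₀ ^ k • ((1 - R.α * r) • w - (R.α * r) • e) := by
    have h2 := smul_compArg hh k a i
    have h3 : R.x k a i = R.c k a i + R.h₀ ^ k • w := by rw [h2]; abel
    have h4 : (R.α * r) • e = R.α • R.C w (R.ζ i k a) - (R.α * r) • w := by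
      rw [he, smul_sub, smul_smul, mul_assoc, mul_one_div_cancel hr.ne', mul_one]
    rw [h4, h3, c_succ, xhat]
    module
  have h5 : ‖(1 - R.α * r) • w - (R.α * r) • e‖ ^ 2 ≤
      (1 - R.α * r) * ‖w‖ ^ 2 + R.α * r * ‖e‖ ^ 2 := by
    have hs : 0 ≤ R.α * r := mul_nonneg hα hr.le
    have h6 := norm_sub_le ((1 - R.α * r) • w) ((R.α * r) • e)
    rw [norm_smul, norm_smul, Real.norm_eq_abs, Real.norm_eq_abs, abs_of_nonneg hs,
      abs_of_nonneg (sub_nonneg.2 hαr)] at h6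
    have h7 : ‖(1 - R.α * r) • w - (R.α * r) • e‖ ^ 2 ≤
      ((1 - R.α * r) * ‖w‖ + R.α * r * ‖e‖) ^ 2 := by gcongr
    have h8 : 0 ≤ (R.α * r) * (1 - R.α * r) * (‖w‖ - ‖e‖) ^ 2 :=
      mul_nonneg (mul_nonneg hs (sub_nonneg.2 hαr)) (sq_nonneg _)
    linarith
  rw [h1, norm_smul, mul_pow, Real.norm_eq_abs, sq_abs, ← norm_sq_compArg hh]
  have h9 := mul_le_mul_of_nonneg_left h5 (sq_nonneg (R.h₀ ^ k))
  have h10 : R.compErr r k a i = ‖e‖ ^ 2 := rfl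
  rw [h10]
  linarith

end Defs

end Run

/-! ### Continuity of the gradients and calculus of square-integrable vectors. -/

namespace Problem

variable {n d : ℕ} {Ξ : Fin n → Type*} [∀ i, MeasurableSpace (Ξ i)] {p : Problem n d Ξ} {Lf : ℝ}

lemma Smooth.continuous_gradient_localCost (hp : p.Smooth Lf) (hLf : 0 ≤ Lf) (i : Fin n) :
    Continuous (gradient (p.localCost i)) :=
  (LipschitzWith.of_dist_le_mul (K := ⟨Lf, hLf⟩) fun x y => by
    rw [dist_eq_norm, dist_eq_norm]; exact hp.lipschitz i x y).continuous

lemma Smooth.continuous_gradient_cost (hp : p.Smooth Lf) (hLf : 0 ≤ Lf) :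
    Continuous (gradient p.cost) :=
  (LipschitzWith.of_dist_le_mul (K := ⟨Lf, hLf⟩) fun x y => by
    rw [dist_eq_norm, dist_eq_norm]; exact hp.lipschitz_cost hLf x y).continuous

end Problem

section Vec

variable {d : ℕ} {Ω : Type*} {m : MeasurableSpace Ω} {P : Measure Ω} {X Y : Ω → Vec d}

lemma measurable_smul_vec (c : ℝ) (hX : Measurable X) : Measurable fun a => c • X a :=
  hX.const_smul c

lemma memLp_smul_vec (c : ℝ) (hX : MemLp X 2 P) : MemLp (fun a => c • X a) 2 P :=
  hX.const_smul c

lemma memLp_add_vec (hX : MemLp X 2 P) (hY : MemLp Y 2 P) : MemLp (fun a => X a + Y a) 2 P :=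
  hX.add hY

lemma memLp_sub_vec (hX : MemLp X 2 P) (hY : MemLp Y 2 P) : MemLp (fun a => X a - Y a) 2 P :=
  hX.sub hY

lemma integrable_norm_sq_vec (hX : MemLp X 2 P) : Integrable (fun a => ‖X a‖ ^ 2) P :=
  hX.integrable_norm_pow two_ne_zero

lemma integrable_inner_vec (hX : MemLp X 2 P) (hY : MemLp Y 2 P) :
    Integrable (fun a => inner ℝ (X a) (Y a)) P := by
  refine ((integrable_norm_sq_vec hX).add (integrable_norm_sq_vec hY)).mono' (hX.1.inner hY.1)
    (ae_of_all _ fun a => ?_)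
  have h1 := norm_inner_le_norm (𝕜 := ℝ) (X a) (Y a)
  have h2 : ‖X a‖ * ‖Y a‖ ≤ ‖X a‖ ^ 2 + ‖Y a‖ ^ 2 := by
    nlinarith [sq_nonneg (‖X a‖ - ‖Y a‖), sq_nonneg ‖X a‖, sq_nonneg ‖Y a‖]
  exact h1.trans h2

end Vec

/-- A map of linear growth preserves square integrability. -/
lemma memLp_two_comp_of_lipschitz {d : ℕ} {Ω : Type*} [MeasurableSpace Ω] {P : Measure Ω}
    [IsProbabilityMeasure P] {g : Vec d → Vec d} {K : ℝ} (hgc : Continuous g)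
    (hg : ∀ x y, ‖g x - g y‖ ≤ K * ‖x - y‖) {X : Ω → Vec d} (hX : MemLp X 2 P) :
    MemLp (fun a => g (X a)) 2 P := by
  have h1 : MemLp (fun a => g (X a) - g 0) 2 P := by
    refine hX.of_le_mul (c := K) ?_ (ae_of_all _ fun a => ?_)
    · exact (hgc.comp_aestronglyMeasurable hX.1).sub aestronglyMeasurable_const
    · simpa using hg (X a) 0
  refine (h1.add (memLp_const (g 0))).congr_norm (hgc.comp_aestronglyMeasurable hX.1)
    (ae_of_all _ fun a => ?_)
  simp

/-! ### Adaptedness and second moments of the iterates, and orthogonality of the noise. -/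

namespace Run

/-- The σ-algebra on `Ω` is left free, since the lemma is also applied to those generated by subsets
of the draws. -/
lemma measurable_noise_of {n d : ℕ} {Ξ : Fin n → Type*} [∀ i, MeasurableSpace (Ξ i)] {Z Ω : Type*}
    {m : MeasurableSpace Ω} {R : Run n d Ξ Z Ω} {Lf : ℝ} (hw : R.p.WellPosed)
    (hs : R.p.Smooth Lf) (hLf : 0 ≤ Lf) {k : ℕ} {i : Fin n} (hx : Measurable fun a => R.x k a i)
    (hξ : Measurable (R.ξ i k)) : Measurable fun a => R.noise k a i :=
  ((hw.measurable i).comp (hx.prodMk hξ)).sub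
    ((hs.continuous_gradient_localCost hLf i).measurable.comp hx)

section Moments

variable {n d : ℕ} {Ξ : Fin n → Type*} [∀ i, MeasurableSpace (Ξ i)] {Z Ω : Type*}
  [MeasurableSpace Z] [mΩ : MeasurableSpace Ω]

/-- The assumptions on a run that do not concern the graph. -/
structure Valid (R : Run n d Ξ Z Ω) (P : Measure Ω) (Q : Measure Z) (φ r σC σ Lf : ℝ) :
    Prop where
  wellPosed : R.p.WellPosed
  smooth : R.p.Smooth Lf
  unbiased : R.p.UnbiasedBoundedVariance σ
  compressor : IsCompressor Q R.C φ r σC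
  sampling : IsSampling R.p.D Q P R.ξ R.ζ
  Lf_pos : 0 < Lf
  φ_le : φ ≤ 1
  r_pos : 0 < r
  α_pos : 0 < R.α
  α_mul_r_le : R.α * r ≤ 1
  h₀_pos : 0 < R.h₀

variable {R : Run n d Ξ Z Ω} {P : Measure Ω} {Q : Measure Z} {φ r σC σ Lf : ℝ}

/-- The σ-algebra of the draws before time `k`. -/
@[reducible] def past (R : Run n d Ξ Z Ω) (k : ℕ) : MeasurableSpace Ω :=
  drawsSigma R.ξ R.ζ (pastDraws n k)

lemma inl_mem_pastDraws {k m : ℕ} {i : Fin n} : Sum.inl (i, k) ∈ pastDraws n m ↔ k < m := Iff.rfl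

lemma inr_mem_pastDraws {k m : ℕ} : Sum.inr k ∈ pastDraws n m ↔ k < m := Iff.rfl

lemma pastDraws_mono {k m : ℕ} (h : k ≤ m) : pastDraws n k ⊆ pastDraws n m :=
  fun _ hs => lt_of_lt_of_le hs h

lemma Valid.past_le (hR : R.Valid P Q φ r σC σ Lf) (k : ℕ) : R.past k ≤ mΩ :=
  hR.sampling.drawsSigma_le _

lemma Valid.measurable_state (hR : R.Valid P Q φ r σC σ Lf) (k : ℕ) :
    (∀ i, Measurable[R.past k] fun a => R.x k a i) ∧
      (∀ i, Measurable[R.past k] fun a => R.v k a i) ∧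
      ∀ i, Measurable[R.past k] fun a => R.c k a i := by
  induction k with
  | zero =>
    exact ⟨fun i => measurable_const, fun i => measurable_const, fun i => measurable_const⟩
  | succ k ih =>
    have hle : R.past k ≤ R.past (k + 1) := drawsSigma_mono (pastDraws_mono k.le_succ)
    have hx := fun i => (ih.1 i).mono hle le_rfl
    have hv := fun i => (ih.2.1 i).mono hle le_rfl
    have hc := fun i => (ih.2.2 i).mono hle le_rfl
    have hξ : ∀ i, Measurable[R.past (k + 1)] (R.ξ i k) := fun i =>
      measurable_data_drawsSigma (inl_mem_pastDraws.2 k.lt_succ_self)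
    have hζ : ∀ i, Measurable[R.past (k + 1)] (R.ζ i k) :=
      measurable_comp_drawsSigma (inr_mem_pastDraws.2 k.lt_succ_self)
    have hw : ∀ i, Measurable[R.past (k + 1)] fun a => R.compArg k a i := fun i => by
      unfold compArg
      exact measurable_smul_vec _ ((hx i).sub (hc i))
    have hxh : ∀ i, Measurable[R.past (k + 1)] fun a => R.xhat k a i := fun i => by
      have h1 : Measurable[R.past (k + 1)] fun a => R.C (R.compArg k a i) (R.ζ i k a) :=
        hR.compressor.measurable.comp ((hw i).prodMk (hζ i))
      exact (hc i).add (measurable_smul_vec _ h1)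
    have hL : ∀ i, Measurable[R.past (k + 1)] fun a => ∑ j, laplacian R.W i j • R.xhat k a j :=
      fun i => Finset.measurable_fun_sum _ fun j _ => measurable_smul_vec _ (hxh j)
    have hN := fun i => measurable_noise_of hR.wellPosed hR.smooth hR.Lf_pos.le (hx i) (hξ i)
    have hg : ∀ i, Measurable[R.past (k + 1)] fun a => R.grad k a i := fun i =>
      (hR.smooth.continuous_gradient_localCost hR.Lf_pos.le i).measurable.comp (hx i)
    refine ⟨fun i => ?_, fun i => ?_, fun i => ?_⟩
    · simp only [x_succ]
      exact (hx i).sub (measurable_smul_vec _ (((measurable_smul_vec _ (hL i)).add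
        (measurable_smul_vec _ (hv i))).add ((hg i).add (hN i))))
    · simp only [v_succ]
      exact (hv i).add (measurable_smul_vec _ (hL i))
    · simp only [c_succ]
      exact (measurable_smul_vec _ (hc i)).add (measurable_smul_vec _ (hxh i))

lemma Valid.measurable_compArg (hR : R.Valid P Q φ r σC σ Lf) (k : ℕ) (i : Fin n) :
    Measurable[R.past k] fun a => R.compArg k a i := by
  unfold compArg
  exact measurable_smul_vec _ (((hR.measurable_state k).1 i).sub ((hR.measurable_state k).2.2 i))

lemma Valid.measurable_noise (hR : R.Valid P Q φ r σC σ Lf) (k : ℕ) (i : Fin n) :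
    Measurable fun a => R.noise k a i :=
  measurable_noise_of hR.wellPosed hR.smooth hR.Lf_pos.le (((hR.measurable_state k).1 i).mono (hR.past_le k) le_rfl)
    (hR.sampling.measurable_data i k)

lemma Valid.indepFun_data (hR : R.Valid P Q φ r σC σ Lf) {k : ℕ} {i : Fin n}
    {E : Type*} [MeasurableSpace E] {X : Ω → E} (hX : Measurable[R.past k] X) :
    IndepFun X (R.ξ i k) P := by
  refine hR.sampling.indepFun (S := pastDraws n k) (T := {Sum.inl (i, k)}) ?_ hX
    (measurable_data_drawsSigma (Set.mem_singleton _))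
  rw [Set.disjoint_singleton_right, inl_mem_pastDraws]
  exact lt_irrefl k

variable [IsProbabilityMeasure P]

/-- The compressor argument depends only on earlier draws, so the compressor bound may be applied
with the argument frozen. -/
lemma Valid.compErr_le (hR : R.Valid P Q φ r σC σ Lf) {k : ℕ} {i : Fin n}
    (hw : MemLp (fun a => R.compArg k a i) 2 P) :
    Integrable (fun a => R.compErr r k a i) P ∧
      ∫ a, R.compErr r k a i ∂P ≤ (1 - φ) * ∫ a, ‖R.compArg k a i‖ ^ 2 ∂P + σC := by
  have hwm := hR.measurable_compArg k i
  have hind : IndepFun (fun a => R.compArg k a i) (R.ζ i k) P := by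
    refine hR.sampling.indepFun (S := pastDraws n k) (T := {Sum.inr k}) ?_ hwm
      (measurable_comp_drawsSigma (Set.mem_singleton _) i)
    rw [Set.disjoint_singleton_right, inr_mem_pastDraws]
    exact lt_irrefl k
  have hi : Integrable (fun a => ‖R.compArg k a i‖ ^ 2) P := hw.integrable_norm_pow two_ne_zero
  have key := integral_comp_le_of_indepFun (hwm.mono (hR.past_le k) le_rfl)
    (hR.sampling.measurable_comp i k) hind
    (u := fun x z => ‖(1 / r) • R.C x z - x‖ ^ 2)
    (((hR.compressor.measurable.const_smul (1 / r)).sub measurable_fst).norm.pow_const 2)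
    (fun x z => sq_nonneg _)
    (by rw [hR.sampling.law_comp]; exact hR.compressor.integrable)
    (w := fun x => (1 - φ) * ‖x‖ ^ 2 + σC)
    (((measurable_norm.pow_const 2).const_mul _).add_const _)
    (by rw [hR.sampling.law_comp]; exact hR.compressor.error)
    ((hi.const_mul _).add (integrable_const _))
  refine ⟨key.1, key.2.trans (le_of_eq ?_)⟩
  rw [integral_add (hi.const_mul _) (integrable_const _), integral_const_mul]
  simp

lemma Valid.integral_noise_sq_le (hR : R.Valid P Q φ r σC σ Lf) (k : ℕ) (i : Fin n) :
    Integrable (fun a => ‖R.noise k a i‖ ^ 2) P ∧ ∫ a, ‖R.noise k a i‖ ^ 2 ∂P ≤ σ ^ 2 := by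
  have hxm := (hR.measurable_state k).1 i
  have key := integral_comp_le_of_indepFun (hxm.mono (hR.past_le k) le_rfl)
    (hR.sampling.measurable_data i k) (hR.indepFun_data hxm)
    (u := fun x s => ‖R.p.stochGrad i x s - gradient (R.p.localCost i) x‖ ^ 2)
    (((hR.wellPosed.measurable i).sub ((hR.smooth.continuous_gradient_localCost
      hR.Lf_pos.le i).measurable.comp measurable_fst)).norm.pow_const 2)
    (fun x z => sq_nonneg _)
    (by rw [hR.sampling.law_data]; exact hR.unbiased.integrable i)
    (w := fun x => σ ^ 2) measurable_const
    (by rw [hR.sampling.law_data]; exact hR.unbiased.variance i) (integrable_const _)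
  refine ⟨key.1, key.2.trans (le_of_eq ?_)⟩
  simp

lemma Valid.memLp_noise (hR : R.Valid P Q φ r σC σ Lf) (k : ℕ) (i : Fin n) :
    MemLp (fun a => R.noise k a i) 2 P :=
  (memLp_two_iff_integrable_sq_norm (hR.measurable_noise k i).aestronglyMeasurable).2
    (hR.integral_noise_sq_le k i).1

lemma Valid.memLp_xhat_of (hR : R.Valid P Q φ r σC σ Lf) {k : ℕ} {i : Fin n}
    (hx : MemLp (fun a => R.x k a i) 2 P) (hc : MemLp (fun a => R.c k a i) 2 P) :
    MemLp (fun a => R.xhat k a i) 2 P := by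
  have hw : MemLp (fun a => R.compArg k a i) 2 P := by
    unfold compArg
    exact memLp_smul_vec _ (memLp_sub_vec hx hc)
  have hwm : Measurable fun a => R.compArg k a i :=
    (hR.measurable_compArg k i).mono (hR.past_le k) le_rfl
  have hCm : Measurable fun a => R.C (R.compArg k a i) (R.ζ i k a) :=
    hR.compressor.measurable.comp (hwm.prodMk (hR.sampling.measurable_comp i k))
  have he : MemLp (fun a => (1 / r) • R.C (R.compArg k a i) (R.ζ i k a) - R.compArg k a i) 2 P :=
    (memLp_two_iff_integrable_sq_norm ((measurable_smul_vec _ hCm).sub hwm).aestronglyMeasurable).2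
      (hR.compErr_le hw).1
  have hC : MemLp (fun a => R.C (R.compArg k a i) (R.ζ i k a)) 2 P := by
    have h1 := memLp_smul_vec r (memLp_add_vec he hw)
    refine h1.congr_norm hCm.aestronglyMeasurable (ae_of_all _ fun a => ?_)
    rw [sub_add_cancel, smul_smul, mul_one_div_cancel hR.r_pos.ne', one_smul]
  exact memLp_add_vec hc (memLp_smul_vec _ hC)

lemma Valid.memLp_grad_of (hR : R.Valid P Q φ r σC σ Lf) {k : ℕ} {i : Fin n}
    (hx : MemLp (fun a => R.x k a i) 2 P) : MemLp (fun a => R.grad k a i) 2 P :=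
  memLp_two_comp_of_lipschitz (hR.smooth.continuous_gradient_localCost hR.Lf_pos.le i)
    (hR.smooth.lipschitz i) hx

/-- Second moments propagate: exact gradients grow linearly, the noise has bounded variance, and the
mean squared compression error grows at most quadratically in the argument. -/
lemma Valid.memLp_state (hR : R.Valid P Q φ r σC σ Lf) (k : ℕ) :
    (∀ i, MemLp (fun a => R.x k a i) 2 P) ∧ (∀ i, MemLp (fun a => R.v k a i) 2 P) ∧
      ∀ i, MemLp (fun a => R.c k a i) 2 P := by
  induction k with
  | zero => exact ⟨fun i => memLp_const _, fun i => memLp_const _, fun i => memLp_const _⟩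
  | succ k ih =>
    obtain ⟨hx, hv, hc⟩ := ih
    have hxh := fun i => hR.memLp_xhat_of (hx i) (hc i)
    have hL : ∀ i, MemLp (fun a => ∑ j, laplacian R.W i j • R.xhat k a j) 2 P :=
      fun i => memLp_finsetSum _ fun j _ => memLp_smul_vec _ (hxh j)
    refine ⟨fun i => ?_, fun i => ?_, fun i => ?_⟩
    · simp only [x_succ]
      exact memLp_sub_vec (hx i) (memLp_smul_vec _ (memLp_add_vec
        (memLp_add_vec (memLp_smul_vec _ (hL i)) (memLp_smul_vec _ (hv i)))
        (memLp_add_vec (hR.memLp_grad_of (hx i)) (hR.memLp_noise k i))))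
    · simp only [v_succ]
      exact memLp_add_vec (hv i) (memLp_smul_vec _ (hL i))
    · simp only [c_succ]
      exact memLp_add_vec (memLp_smul_vec _ (hc i)) (memLp_smul_vec _ (hxh i))

/-- The noise is orthogonal to everything that is independent of its datum. -/
lemma Valid.integral_inner_noise_eq_zero (hR : R.Valid P Q φ r σC σ Lf) {k : ℕ} {i : Fin n}
    {S : Set ((Fin n × ℕ) ⊕ ℕ)} (hS : pastDraws n k ⊆ S) (hi : Sum.inl (i, k) ∉ S)
    {Y : Ω → Vec d} (hY : Measurable[drawsSigma R.ξ R.ζ S] Y) (hY2 : MemLp Y 2 P) :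
    Integrable (fun a => inner ℝ (Y a) (R.noise k a i)) P ∧
      ∫ a, inner ℝ (Y a) (R.noise k a i) ∂P = 0 := by
  have hint : Integrable (fun a => inner ℝ (Y a) (R.noise k a i)) P :=
    integrable_inner_vec hY2 (hR.memLp_noise k i)
  refine ⟨hint, ?_⟩
  have hxm : Measurable[drawsSigma R.ξ R.ζ S] fun a => R.x k a i :=
    ((hR.measurable_state k).1 i).mono (drawsSigma_mono hS) le_rfl
  -- The noise depends on the datum and on the iterate, so the iterate is frozen together with `Y`.
  -- A general `S` allows `Y` to contain another agent's datum at the same time.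
  have hXm : Measurable[drawsSigma R.ξ R.ζ S] fun a => (Y a, R.x k a i) := hY.prodMk hxm
  have hind : IndepFun (fun a => (Y a, R.x k a i)) (R.ξ i k) P :=
    hR.sampling.indepFun (S := S) (T := {Sum.inl (i, k)}) (Set.disjoint_singleton_right.2 hi) hXm
      (measurable_data_drawsSigma (Set.mem_singleton _))
  refine integral_comp_eq_zero_of_indepFun (hXm.mono (hR.sampling.drawsSigma_le _) le_rfl)
    (hR.sampling.measurable_data i k) hind
    (u := fun q s => inner ℝ q.1 (R.p.stochGrad i q.2 s - gradient (R.p.localCost i) q.2))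
    ?_ hint ?_
  · refine (measurable_fst.comp measurable_fst).inner (Measurable.sub ?_ ?_)
    · exact (hR.wellPosed.measurable i).comp
        ((measurable_snd.comp measurable_fst).prodMk measurable_snd)
    · exact (hR.smooth.continuous_gradient_localCost hR.Lf_pos.le i).measurable.comp
        (measurable_snd.comp measurable_fst)
  · rintro ⟨y, x⟩
    rw [hR.sampling.law_data]
    have hprob : IsProbabilityMeasure (R.p.D i) := by
      rw [← hR.sampling.law_data i k]
      exact Measure.isProbabilityMeasure_map (hR.sampling.measurable_data i k).aemeasurable
    have hsm : Measurable fun s => R.p.stochGrad i x s :=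
      (hR.wellPosed.measurable i).comp measurable_prodMk_left
    have h1 : Integrable (fun s => R.p.stochGrad i x s - gradient (R.p.localCost i) x)
        (R.p.D i) :=
      ((memLp_two_iff_integrable_sq_norm (hsm.sub_const _).aestronglyMeasurable).2
        (hR.unbiased.integrable i x)).integrable one_le_two
    have h2 : Integrable (fun s => R.p.stochGrad i x s) (R.p.D i) := by
      refine (h1.add (integrable_const (gradient (R.p.localCost i) x))).congr
        (ae_of_all _ fun s => ?_)
      simp
    rw [integral_inner h1, integral_sub h2 (integrable_const _), hR.unbiased.unbiased]
    simp

end Moments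

end Run

/-! ### Integrability of averages and of the consensus form. -/

section Vec

variable {n d : ℕ} {Ω : Type*} {m : MeasurableSpace Ω} {P : Measure Ω}

lemma memLp_mean {X : Ω → Fin n → Vec d} (hX : ∀ i, MemLp (fun a => X a i) 2 P) :
    MemLp (fun a => mean (X a)) 2 P :=
  memLp_smul_vec _ (memLp_finsetSum _ fun i _ => hX i)

lemma measurable_mean {X : Ω → Fin n → Vec d} (hX : ∀ i, Measurable fun a => X a i) :
    Measurable fun a => mean (X a) :=
  measurable_smul_vec _ (Finset.measurable_fun_sum _ fun i _ => hX i)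

lemma integrable_sum_norm_sq {X : Ω → Fin n → Vec d} (hX : ∀ i, MemLp (fun a => X a i) 2 P) :
    Integrable (fun a => ∑ i, ‖X a i‖ ^ 2) P :=
  integrable_finsetSum _ fun i _ => integrable_norm_sq_vec (hX i)

lemma memLp_modeCoord (U : Fin n → Fin n → ℝ) {X : Ω → Fin n → Vec d}
    (hX : ∀ i, MemLp (fun a => X a i) 2 P) (l : Fin n) (j : Fin d) :
    MemLp (fun a => modeCoord U (X a) l j) 2 P := by
  refine memLp_finsetSum _ fun i _ => MemLp.const_mul ?_ _
  refine (hX i).of_le ?_ (ae_of_all _ fun a => PiLp.norm_apply_le (X a i) j)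
  exact (PiLp.continuous_apply 2 _ j).comp_aestronglyMeasurable (hX i).1

lemma integrable_consensusLyap (A : ℝ) (U : Fin n → Fin n → ℝ) (μ : Fin n → ℝ)
    {X Y : Ω → Fin n → Vec d} (hX : ∀ i, MemLp (fun a => X a i) 2 P)
    (hY : ∀ i, MemLp (fun a => Y a i) 2 P) :
    Integrable (fun a => consensusLyap A U μ (X a) (Y a)) P := by
  refine integrable_finsetSum _ fun l _ => integrable_finsetSum _ fun j _ => ?_
  have hx := memLp_modeCoord U hX l j
  have hy := memLp_modeCoord U hY l j
  exact (hx.integrable_sq.add (hy.integrable_sq.const_mul _)).add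
    ((hx.integrable_mul hy).const_mul _)

end Vec

/-! ### Expected descent of the cost. -/

namespace Run

section Expectation

variable {n d : ℕ} {Ξ : Fin n → Type*} [∀ i, MeasurableSpace (Ξ i)] {Z Ω : Type*}
  [MeasurableSpace Z] [mΩ : MeasurableSpace Ω] {R : Run n d Ξ Z Ω} {P : Measure Ω}
  [IsProbabilityMeasure P] {Q : Measure Z} {φ r σC σ Lf : ℝ}

lemma Valid.memLp_x (hR : R.Valid P Q φ r σC σ Lf) (k : ℕ) (i : Fin n) :
    MemLp (fun a => R.x k a i) 2 P := (hR.memLp_state k).1 i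

lemma Valid.memLp_v (hR : R.Valid P Q φ r σC σ Lf) (k : ℕ) (i : Fin n) :
    MemLp (fun a => R.v k a i) 2 P := (hR.memLp_state k).2.1 i

lemma Valid.memLp_c (hR : R.Valid P Q φ r σC σ Lf) (k : ℕ) (i : Fin n) :
    MemLp (fun a => R.c k a i) 2 P := (hR.memLp_state k).2.2 i

lemma Valid.memLp_xhat (hR : R.Valid P Q φ r σC σ Lf) (k : ℕ) (i : Fin n) :
    MemLp (fun a => R.xhat k a i) 2 P := hR.memLp_xhat_of (hR.memLp_x k i) (hR.memLp_c k i)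

lemma Valid.memLp_grad (hR : R.Valid P Q φ r σC σ Lf) (k : ℕ) (i : Fin n) :
    MemLp (fun a => R.grad k a i) 2 P := hR.memLp_grad_of (hR.memLp_x k i)

lemma Valid.memLp_mean_x (hR : R.Valid P Q φ r σC σ Lf) (k : ℕ) :
    MemLp (fun a => mean (R.x k a)) 2 P := memLp_mean (hR.memLp_x k)

lemma Valid.memLp_gradient_cost (hR : R.Valid P Q φ r σC σ Lf) (k : ℕ) :
    MemLp (fun a => gradient R.p.cost (mean (R.x k a))) 2 P :=
  memLp_two_comp_of_lipschitz (hR.smooth.continuous_gradient_cost hR.Lf_pos.le)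
    (hR.smooth.lipschitz_cost hR.Lf_pos.le) (hR.memLp_mean_x k)

lemma Valid.memLp_gradient_mean (hR : R.Valid P Q φ r σC σ Lf) (k : ℕ) (i : Fin n) :
    MemLp (fun a => gradient (R.p.localCost i) (mean (R.x k a))) 2 P :=
  memLp_two_comp_of_lipschitz (hR.smooth.continuous_gradient_localCost hR.Lf_pos.le i)
    (hR.smooth.lipschitz i) (hR.memLp_mean_x k)

lemma Valid.integrable_consensus (hR : R.Valid P Q φ r σC σ Lf) (k : ℕ) :
    Integrable (fun a => ∑ i, ‖R.x k a i - mean (R.x k a)‖ ^ 2) P :=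
  integrable_sum_norm_sq (X := fun a i => R.x k a i - mean (R.x k a))
    fun i => memLp_sub_vec (hR.memLp_x k i) (hR.memLp_mean_x k)

/-- The cost lies between its lower bound and the quadratic majorant given by the descent lemma at
the origin. -/
lemma Valid.integrable_cost (hR : R.Valid P Q φ r σC σ Lf) (hb : BddBelow (Set.range R.p.cost))
    (k : ℕ) : Integrable (fun a => R.p.cost (mean (R.x k a))) P := by
  have hm := hR.memLp_mean_x k
  obtain ⟨m, hm'⟩ := hb
  have hlow : ∀ x, m ≤ R.p.cost x := fun x => hm' ⟨x, rfl⟩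
  have hup : ∀ x, R.p.cost x ≤ R.p.cost 0 + inner ℝ (gradient R.p.cost 0) x
      + Lf / 2 * ‖x‖ ^ 2 := fun x => by
    simpa using le_add_inner_gradient_add hR.smooth.differentiable_cost
      (hR.smooth.lipschitz_cost hR.Lf_pos.le) 0 x
  refine integrable_of_le_of_le (g₁ := fun _ => m)
    (g₂ := fun a => R.p.cost 0 + inner ℝ (gradient R.p.cost 0) (mean (R.x k a))
      + Lf / 2 * ‖mean (R.x k a)‖ ^ 2) ?_ (ae_of_all _ fun a => hlow _)
    (ae_of_all _ fun a => hup _) (integrable_const _) ?_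
  · exact hR.smooth.differentiable_cost.continuous.comp_aestronglyMeasurable hm.1
  · exact ((integrable_const _).add (integrable_inner_vec (memLp_const _) hm)).add
      ((integrable_norm_sq_vec hm).const_mul _)

lemma Valid.integral_inner_mean_noise_eq_zero (hR : R.Valid P Q φ r σC σ Lf) {k : ℕ}
    {Y : Ω → Vec d} (hY : Measurable[R.past k] Y) (hY2 : MemLp Y 2 P) :
    ∫ a, inner ℝ (Y a) (mean (R.noise k a)) ∂P = 0 := by
  have h := fun i => hR.integral_inner_noise_eq_zero (k := k) (i := i) subset_rfl
    (fun h => lt_irrefl k (inl_mem_pastDraws.1 h)) hY hY2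
  simp only [mean, real_inner_smul_right, inner_sum]
  rw [integral_const_mul, integral_finsetSum _ fun i _ => (h i).1]
  simp [(h _).2]

lemma Valid.integral_inner_noise_of_ne (hR : R.Valid P Q φ r σC σ Lf) (k : ℕ) {i j : Fin n}
    (hij : j ≠ i) : ∫ a, inner ℝ (R.noise k a j) (R.noise k a i) ∂P = 0 := by
  have hs : pastDraws n k ⊆ insert (Sum.inl (j, k)) (pastDraws n k) := Set.subset_insert _ _
  refine (hR.integral_inner_noise_eq_zero hs ?_ ?_ (hR.memLp_noise k j)).2
  · simp only [Set.mem_insert_iff, Sum.inl.injEq, Prod.mk.injEq, and_true, inl_mem_pastDraws,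
      lt_irrefl, or_false]
    exact Ne.symm hij
  · exact measurable_noise_of hR.wellPosed hR.smooth hR.Lf_pos.le
      (((hR.measurable_state k).1 j).mono (drawsSigma_mono hs) le_rfl)
      (measurable_data_drawsSigma (Set.mem_insert _ _))

/-- Noises of distinct agents are uncorrelated, so only the `n` diagonal terms survive the factor
`1/n²`. This is the source of the linear speedup. -/
lemma Valid.integral_mean_noise_sq_le (hR : R.Valid P Q φ r σC σ Lf) (k : ℕ) :
    ∫ a, ‖mean (R.noise k a)‖ ^ 2 ∂P ≤ σ ^ 2 / n := by
  rcases Nat.eq_zero_or_pos n with hn | hn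
  · subst hn
    simp [mean]
  have hn' : (0 : ℝ) < n := by exact_mod_cast hn
  have h1 : ∀ a, ‖mean (R.noise k a)‖ ^ 2 =
      (1 / (n : ℝ)) ^ 2 * ∑ j, ∑ i, inner ℝ (R.noise k a j) (R.noise k a i) := by
    intro a
    rw [mean, norm_smul, mul_pow, Real.norm_eq_abs, sq_abs, ← real_inner_self_eq_norm_sq,
      sum_inner]
    simp only [inner_sum]
  have hint : ∀ j i, Integrable (fun a => inner ℝ (R.noise k a j) (R.noise k a i)) P :=
    fun j i => integrable_inner_vec (hR.memLp_noise k j) (hR.memLp_noise k i)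
  simp only [h1]
  rw [integral_const_mul, integral_finsetSum _ fun j _ => integrable_finsetSum _ fun i _ =>
    hint j i]
  have h2 : ∀ j, ∫ a, ∑ i, inner ℝ (R.noise k a j) (R.noise k a i) ∂P ≤ σ ^ 2 := by
    intro j
    rw [integral_finsetSum _ fun i _ => hint j i, Finset.sum_eq_single j]
    · simp only [real_inner_self_eq_norm_sq]
      exact (hR.integral_noise_sq_le k j).2
    · exact fun i _ hi => hR.integral_inner_noise_of_ne k (Ne.symm hi)
    · exact fun h => absurd (Finset.mem_univ j) h
  calc _ ≤ (1 / (n : ℝ)) ^ 2 * ∑ _j : Fin n, σ ^ 2 := by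
        gcongr with j
        exact h2 j
    _ = σ ^ 2 / n := by
        simp only [Finset.sum_const, Finset.card_univ, Fintype.card_fin, nsmul_eq_mul]
        field_simp

/-- The expected decrease of the global cost. -/
lemma Valid.integral_cost_succ_le (hR : R.Valid P Q φ r σC σ Lf)
    (hb : BddBelow (Set.range R.p.cost)) (hcol : ∀ j, ∑ i, laplacian R.W i j = 0)
    (hη : 0 ≤ R.β₂ / R.ω) (hηL : 4 * (R.β₂ / R.ω) * Lf ≤ 1) (k : ℕ) :
    ∫ a, R.p.cost (mean (R.x (k + 1) a)) ∂P ≤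
      ∫ a, R.p.cost (mean (R.x k a)) ∂P
        - R.β₂ / R.ω / 2 * ∫ a, ‖gradient R.p.cost (mean (R.x k a))‖ ^ 2 ∂P
        - 3 / 8 * (R.β₂ / R.ω) * ∫ a, ‖mean (R.grad k a)‖ ^ 2 ∂P
        + R.β₂ / R.ω / 2 * (Lf ^ 2 * (1 / (n : ℝ) *
          ∫ a, ∑ i, ‖R.x k a i - mean (R.x k a)‖ ^ 2 ∂P))
        + Lf / 2 * (R.β₂ / R.ω) ^ 2 * (σ ^ 2 / n) := by
  have hpath := fun a => hR.smooth.cost_step_le hR.Lf_pos hη hηL (R.x k a) (mean (R.noise k a))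
  have hgm : MemLp (fun a => mean (R.grad k a)) 2 P := memLp_mean (hR.memLp_grad k)
  have hNm : MemLp (fun a => mean (R.noise k a)) 2 P := memLp_mean (hR.memLp_noise k)
  have i0 := hR.integrable_cost hb k
  have i1 := (integrable_norm_sq_vec (hR.memLp_gradient_cost k)).const_mul (R.β₂ / R.ω / 2)
  have i2 := (integrable_norm_sq_vec hgm).const_mul (3 / 8 * (R.β₂ / R.ω))
  have i3 := (((hR.integrable_consensus k).const_mul (1 / (n : ℝ))).const_mul
    (Lf ^ 2)).const_mul (R.β₂ / R.ω / 2)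
  have i4 := (integrable_norm_sq_vec hNm).const_mul (Lf / 2 * (R.β₂ / R.ω) ^ 2)
  have i5 := (integrable_inner_vec hgm hNm).const_mul (Lf * (R.β₂ / R.ω) ^ 2)
  have i6 := (integrable_inner_vec (hR.memLp_gradient_cost k) hNm).const_mul (R.β₂ / R.ω)
  have key := integral_mono (μ := P) (hR.integrable_cost hb (k + 1))
    (((((i0.sub i1).sub i2).add i3).add i4).add (i5.sub i6)) fun a => by
      have := hpath a
      rw [R.mean_x_succ hcol]
      exact this
  have hxm := measurable_mean (m := R.past k) (hR.measurable_state k).1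
  have hgmeas : Measurable[R.past k] fun a => mean (R.grad k a) :=
    measurable_mean (m := R.past k) fun i =>
      (hR.smooth.continuous_gradient_localCost hR.Lf_pos.le i).measurable.comp
        ((hR.measurable_state k).1 i)
  have z5 := hR.integral_inner_mean_noise_eq_zero hgmeas hgm
  have z6 := hR.integral_inner_mean_noise_eq_zero
    ((hR.smooth.continuous_gradient_cost hR.Lf_pos.le).measurable.comp hxm)
    (hR.memLp_gradient_cost k)
  rw [integral_add' ((((i0.sub i1).sub i2).add i3).add i4) (i5.sub i6),
    integral_add' (((i0.sub i1).sub i2).add i3) i4, integral_add' ((i0.sub i1).sub i2) i3,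
    integral_sub' (i0.sub i1) i2, integral_sub' i0 i1, integral_sub' i5 i6, integral_const_mul,
    integral_const_mul, integral_const_mul, integral_const_mul, integral_const_mul,
    integral_const_mul, integral_const_mul, integral_const_mul, z5] at key
  simp only [Function.comp_apply] at z6
  rw [z6] at key
  have h4 := hR.integral_mean_noise_sq_le k
  have h5 : Lf / 2 * (R.β₂ / R.ω) ^ 2 * ∫ a, ‖mean (R.noise k a)‖ ^ 2 ∂P ≤
      Lf / 2 * (R.β₂ / R.ω) ^ 2 * (σ ^ 2 / n) := by
    have := hR.Lf_pos
    gcongr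
  linarith

end Expectation

end Run

/-! ### The combined Lyapunov function and its expected decrease. -/

namespace Run

section Lyapunov

variable {n d : ℕ} {Ξ : Fin n → Type*} [∀ i, MeasurableSpace (Ξ i)] {Z Ω : Type*}
  [MeasurableSpace Z] [mΩ : MeasurableSpace Ω] {R : Run n d Ξ Z Ω} {P : Measure Ω}
  [IsProbabilityMeasure P] {Q : Measure Z} {φ r σC σ Lf lam Lam B : ℝ} {U : Fin n → Fin n → ℝ}
  {μ : Fin n → ℝ}

/-- The dual variable shifted by the scaled gradients at the mean. -/
noncomputable def dual (R : Run n d Ξ Z Ω) (k : ℕ) (a : Ω) (i : Fin n) : Vec d :=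
  R.v k a i + (1 / R.ω) • gradient (R.p.localCost i) (mean (R.x k a))

lemma Valid.memLp_dual (hR : R.Valid P Q φ r σC σ Lf) (k : ℕ) (i : Fin n) :
    MemLp (fun a => R.dual k a i) 2 P :=
  memLp_add_vec (hR.memLp_v k i) (memLp_smul_vec _ (hR.memLp_gradient_mean k i))

lemma Valid.integrable_lyap (hR : R.Valid P Q φ r σC σ Lf) (k : ℕ) :
    Integrable (fun a => consensusLyap R.β₁ U μ (R.x k a) (R.dual k a)) P :=
  integrable_consensusLyap _ _ _ (hR.memLp_x k) (hR.memLp_dual k)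

lemma Valid.integral_consensusLyap_succ_le (hR : R.Valid P Q φ r σC σ Lf)
    (hA : Admissible R.β₂ R.β₁ R.ω lam Lam B Lf) (hU : IsEigenbasis R.W lam Lam U μ)
    (hcol : ∀ j, ∑ i, laplacian R.W i j = 0) (k : ℕ) :
    ∫ a, consensusLyap R.β₁ U μ (R.x (k + 1) a) (R.dual (k + 1) a) ∂P
      + (B - 3) / 2 * ∫ a, ∑ i, ‖R.x (k + 1) a i - R.x k a i‖ ^ 2 ∂P ≤
    ∫ a, consensusLyap R.β₁ U μ (R.x k a) (R.dual k a) ∂P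
      - R.β₂ * (1 / 4 + (3 + 3 * B * (R.β₂ / R.ω)) * Lf ^ 2 / (2 * R.ω))
        * ∫ a, ∑ i, ‖R.x k a i - mean (R.x k a)‖ ^ 2 ∂P
      + R.β₂ * (R.β₁ * Lam + 2 * Lam + 4 + 2 * B * R.β₁ ^ 2 * R.β₂ * Lam ^ 2)
        * ∫ a, ∑ i, ‖R.xhat k a i - R.x k a i‖ ^ 2 ∂P
      + 3 / 8 * (R.β₂ / R.ω) * (3 + 3 * B * (R.β₂ / R.ω))
        * (n * ∫ a, ‖mean (R.grad k a)‖ ^ 2 ∂P)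
      + R.β₂ * (9 + 16 / lam + 16 * R.β₂ ^ 2 + 7 * B * R.β₂) * (1 / R.ω ^ 2)
        * ∫ a, ∑ i, ‖R.noise k a i‖ ^ 2 ∂P := by
  have hpath := fun a => hU.consensusLyap_contract hA hcol (x := R.x k a) (v := R.v k a)
    (xh := R.xhat k a) (g := fun i => gradient (R.p.localCost i) (mean (R.x k a)))
    (g' := fun i => gradient (R.p.localCost i) (mean (R.x (k + 1) a))) (q := R.grad k a)
    (N := R.noise k a) (x' := R.x (k + 1) a) (v' := R.v (k + 1) a) (R.sum_v hcol k a)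
    (R.x_succ k a) (R.v_succ k a)
    (hR.smooth.sum_gradient_sub_sq_le (R.x k a) fun _ => mean (R.x k a)) (by
      -- The reference gradients move only with the mean, whose step is `η` times the mean
      -- stochastic gradient.
      refine (hR.smooth.sum_gradient_sub_sq_le (fun _ => mean (R.x (k + 1) a))
        fun _ => mean (R.x k a)).trans (le_of_eq ?_)
      simp only [R.mean_x_succ hcol, sub_sub_cancel_left, norm_neg, norm_smul, mul_pow,
        Real.norm_eq_abs, sq_abs, Finset.sum_const, Finset.card_univ, Fintype.card_fin,
        nsmul_eq_mul, mean_add])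
  have j0 := hR.integrable_lyap (U := U) (μ := μ) (k + 1)
  have j1 := (integrable_sum_norm_sq (X := fun a i => R.x (k + 1) a i - R.x k a i)
    fun i => memLp_sub_vec (hR.memLp_x (k + 1) i) (hR.memLp_x k i)).const_mul ((B - 3) / 2)
  have i0 := hR.integrable_lyap (U := U) (μ := μ) k
  have i1 := (hR.integrable_consensus k).const_mul
    (R.β₂ * (1 / 4 + (3 + 3 * B * (R.β₂ / R.ω)) * Lf ^ 2 / (2 * R.ω)))
  have i2 := (integrable_sum_norm_sq (X := fun a i => R.xhat k a i - R.x k a i)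
    fun i => memLp_sub_vec (hR.memLp_xhat k i) (hR.memLp_x k i)).const_mul
    (R.β₂ * (R.β₁ * Lam + 2 * Lam + 4 + 2 * B * R.β₁ ^ 2 * R.β₂ * Lam ^ 2))
  have i3 := ((integrable_norm_sq_vec (memLp_mean (hR.memLp_grad k))).const_mul
    (n : ℝ)).const_mul (3 / 8 * (R.β₂ / R.ω) * (3 + 3 * B * (R.β₂ / R.ω)))
  have i4 := (integrable_sum_norm_sq (hR.memLp_noise k)).const_mul
    (R.β₂ * (9 + 16 / lam + 16 * R.β₂ ^ 2 + 7 * B * R.β₂) * (1 / R.ω ^ 2))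
  have key := integral_mono (μ := P) (j0.add j1) ((((i0.sub i1).add i2).add i3).add i4) hpath
  rw [integral_add' j0 j1, integral_add' (((i0.sub i1).add i2).add i3) i4,
    integral_add' ((i0.sub i1).add i2) i3, integral_add' (i0.sub i1) i2, integral_sub' i0 i1,
    integral_const_mul, integral_const_mul, integral_const_mul, integral_const_mul,
    integral_const_mul, integral_const_mul] at key
  exact key

lemma Valid.integral_noise_sum_le (hR : R.Valid P Q φ r σC σ Lf) (k : ℕ) :
    ∫ a, ∑ i, ‖R.noise k a i‖ ^ 2 ∂P ≤ n * σ ^ 2 := by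
  rw [integral_finsetSum _ fun i _ => (hR.integral_noise_sq_le k i).1]
  calc _ ≤ ∑ _i : Fin n, σ ^ 2 := Finset.sum_le_sum fun i _ => (hR.integral_noise_sq_le k i).2
    _ = _ := by simp

/-- Undoing the scaling turns the relative error into `‖x - c‖²` and multiplies the absolute error
`σC` by `h_k²`, which is summable in `k`. -/
lemma Valid.integral_compErr_sum_le (hR : R.Valid P Q φ r σC σ Lf) (k : ℕ) :
    Integrable (fun a => (R.h₀ ^ k) ^ 2 * ∑ i, R.compErr r k a i) P ∧
    ∫ a, (R.h₀ ^ k) ^ 2 * ∑ i, R.compErr r k a i ∂P ≤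
      (1 - φ) * ∫ a, ∑ i, ‖R.x k a i - R.c k a i‖ ^ 2 ∂P + n * (σC * (R.h₀ ^ k) ^ 2) := by
  have hw : ∀ i, MemLp (fun a => R.compArg k a i) 2 P := fun i => by
    unfold compArg
    exact memLp_smul_vec _ (memLp_sub_vec (hR.memLp_x k i) (hR.memLp_c k i))
  have h := fun i => hR.compErr_le (hw i)
  refine ⟨(integrable_finsetSum _ fun i _ => (h i).1).const_mul _, ?_⟩
  have e1 : ∫ a, ∑ i, ‖R.x k a i - R.c k a i‖ ^ 2 ∂P =
      ∑ i, (R.h₀ ^ k) ^ 2 * ∫ a, ‖R.compArg k a i‖ ^ 2 ∂P := by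
    simp only [← norm_sq_compArg hR.h₀_pos.ne']
    rw [integral_finsetSum _ fun i _ => (integrable_norm_sq_vec (hw i)).const_mul _]
    simp only [integral_const_mul]
  rw [e1, integral_const_mul, integral_finsetSum _ fun i _ => (h i).1, Finset.mul_sum]
  calc _ ≤ ∑ i, (R.h₀ ^ k) ^ 2 * ((1 - φ) * ∫ a, ‖R.compArg k a i‖ ^ 2 ∂P + σC) := by
        gcongr with i
        exact (h i).2
    _ = _ := by
        simp only [mul_add, Finset.sum_add_distrib, Finset.mul_sum, Finset.sum_const,
          Finset.card_univ, Fintype.card_fin, nsmul_eq_mul]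
        congr 1
        · exact Finset.sum_congr rfl fun i _ => by ring
        · ring

lemma Valid.integrable_compression (hR : R.Valid P Q φ r σC σ Lf) (k : ℕ) :
    Integrable (fun a => ∑ i, ‖R.x k a i - R.c k a i‖ ^ 2) P :=
  integrable_sum_norm_sq (X := fun a i => R.x k a i - R.c k a i)
    fun i => memLp_sub_vec (hR.memLp_x k i) (hR.memLp_c k i)

lemma Valid.integral_xhat_sub_le (hR : R.Valid P Q φ r σC σ Lf) (k : ℕ) :
    ∫ a, ∑ i, ‖R.xhat k a i - R.x k a i‖ ^ 2 ∂P ≤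
      r0 φ r * ∫ a, ∑ i, ‖R.x k a i - R.c k a i‖ ^ 2 ∂P
        + n * (2 * r ^ 2 * σC * (R.h₀ ^ k) ^ 2) := by
  obtain ⟨hi, hle⟩ := hR.integral_compErr_sum_le k
  have hu := hR.integrable_compression k
  have i1 := hu.const_mul (2 * (1 - r) ^ 2)
  have i2 := hi.const_mul (2 * r ^ 2)
  have key := integral_mono (μ := P) (integrable_sum_norm_sq
    (X := fun a i => R.xhat k a i - R.x k a i)
    fun i => memLp_sub_vec (hR.memLp_xhat k i) (hR.memLp_x k i)) (i1.add i2) fun a => by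
      have := Finset.sum_le_sum fun i (_ : i ∈ Finset.univ) =>
        norm_xhat_sub_x_sq_le (R := R) hR.h₀_pos.ne' hR.r_pos k a i
      simp only [Finset.sum_add_distrib, ← Finset.mul_sum] at this
      exact this
  rw [integral_add' i1 i2, integral_const_mul, integral_const_mul] at key
  have := mul_le_mul_of_nonneg_left hle (by positivity : 0 ≤ 2 * r ^ 2)
  unfold r0
  linarith

lemma norm_add_sq_le_young (s : ℝ) (hs : 0 < s) (x y : Vec d) :
    ‖x + y‖ ^ 2 ≤ (1 + s / 2) * ‖x‖ ^ 2 + (1 + 2 / s) * ‖y‖ ^ 2 := by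
  have h1 : ‖x + y‖ ^ 2 ≤ (‖x‖ + ‖y‖) ^ 2 := by gcongr; exact norm_add_le x y
  have h2 : 0 ≤ s / 2 * (‖x‖ - 2 / s * ‖y‖) ^ 2 := by positivity
  have h3 : s / 2 * (‖x‖ - 2 / s * ‖y‖) ^ 2 =
      s / 2 * ‖x‖ ^ 2 + 2 / s * ‖y‖ ^ 2 - 2 * (‖x‖ * ‖y‖) := by
    field_simp
    ring
  linarith

/-- With `s = φ₁`, Young's inequality separates the displacement. The doubled contraction factor is
`(2 + s)(1 - s) = 2 - s - s²`, and the displacement coefficient `2 + 4/s` equals `(B - 3)/2`, the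
one reserved in the consensus step. -/
lemma Valid.integral_compression_succ_le (hR : R.Valid P Q φ r σC σ Lf) (hφ : 0 < φ) (k : ℕ) :
    2 * ∫ a, ∑ i, ‖R.x (k + 1) a i - R.c (k + 1) a i‖ ^ 2 ∂P ≤
      (2 - R.α * r * φ - (R.α * r * φ) ^ 2) * ∫ a, ∑ i, ‖R.x k a i - R.c k a i‖ ^ 2 ∂P
      + n * ((2 + R.α * r * φ) * (R.α * r) * σC * (R.h₀ ^ k) ^ 2)
      + (2 + 4 / (R.α * r * φ)) * ∫ a, ∑ i, ‖R.x (k + 1) a i - R.x k a i‖ ^ 2 ∂P := by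
  have hφ₁ : 0 < R.α * r * φ := mul_pos (mul_pos hR.α_pos hR.r_pos) hφ
  set s := R.α * r * φ with hs
  obtain ⟨hi, hle⟩ := hR.integral_compErr_sum_le k
  have hu := hR.integrable_compression k
  have i1 := (hu.const_mul (1 - R.α * r)).const_mul (2 + s)
  have i2 := (hi.const_mul (R.α * r)).const_mul (2 + s)
  have i3 := (integrable_sum_norm_sq (X := fun a i => R.x (k + 1) a i - R.x k a i)
    fun i => memLp_sub_vec (hR.memLp_x (k + 1) i) (hR.memLp_x k i)).const_mul (2 + 4 / s)
  have key := integral_mono (μ := P) ((hR.integrable_compression (k + 1)).const_mul 2)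
    ((i1.add i2).add i3) fun a => by
      have h1 : ∀ i, 2 * ‖R.x (k + 1) a i - R.c (k + 1) a i‖ ^ 2 ≤
          (2 + s) * ((1 - R.α * r) * ‖R.x k a i - R.c k a i‖ ^ 2)
          + (2 + s) * (R.α * r * ((R.h₀ ^ k) ^ 2 * R.compErr r k a i))
          + (2 + 4 / s) * ‖R.x (k + 1) a i - R.x k a i‖ ^ 2 := by
        intro i
        have h2 := norm_add_sq_le_young s hφ₁ (R.x k a i - R.c (k + 1) a i)
          (R.x (k + 1) a i - R.x k a i)
        have h3 : R.x k a i - R.c (k + 1) a i + (R.x (k + 1) a i - R.x k a i) =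
          R.x (k + 1) a i - R.c (k + 1) a i := by abel
        rw [h3] at h2
        have h4 := mul_le_mul_of_nonneg_left (norm_x_sub_c_succ_sq_le hR.h₀_pos.ne' hR.r_pos
          hR.α_pos.le hR.α_mul_r_le k a i) (by positivity : 0 ≤ 2 + s)
        have h5 : 4 / s = 2 * (2 / s) := by ring
        rw [h5]
        linarith
      have := Finset.sum_le_sum fun i (_ : i ∈ Finset.univ) => h1 i
      simp only [Finset.sum_add_distrib, ← Finset.mul_sum] at this
      exact this
  rw [integral_add' (i1.add i2) i3, integral_add' i1 i2, integral_const_mul, integral_const_mul,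
    integral_const_mul, integral_const_mul, integral_const_mul, integral_const_mul,
    integral_const_mul] at key
  rw [integral_const_mul] at hle
  have hαr : 0 ≤ R.α * r := mul_nonneg hR.α_pos.le hR.r_pos.le
  have h6 := mul_le_mul_of_nonneg_left hle
    (mul_nonneg (by positivity : 0 ≤ 2 + s) hαr)
  have e1 : (2 - s - s ^ 2) = (2 + s) * (1 - R.α * r) + (2 + s) * (R.α * r) * (1 - φ) := by
    rw [hs]; ring
  rw [e1]
  linarith

/-- The expected Lyapunov function. -/
noncomputable def lyap (R : Run n d Ξ Z Ω) (P : Measure Ω) (U : Fin n → Fin n → ℝ)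
    (μ : Fin n → ℝ) (B : ℝ) (k : ℕ) : ℝ :=
  ∫ a, consensusLyap R.β₁ U μ (R.x k a) (R.dual k a) ∂P
    + 2 * ∫ a, ∑ i, ‖R.x k a i - R.c k a i‖ ^ 2 ∂P
    + (3 + 3 * B * (R.β₂ / R.ω)) * (n * ∫ a, R.p.cost (mean (R.x k a)) ∂P)

/-- The constant of the gradient noise in the decrease of the Lyapunov function. -/
noncomputable def noiseConst (b lam B Lf σ : ℝ) : ℝ :=
  b * (9 + 16 / lam + 16 * b ^ 2 + 7 * B * b) * σ ^ 2 + (3 + 3 * B) * (Lf / 2 * b ^ 2 * σ ^ 2)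

/-- The constant of the absolute compression error in the decrease of the Lyapunov function. -/
noncomputable def compConst (b A Lam B α r φ σC : ℝ) : ℝ :=
  (2 + α * r * φ) * (α * r) * σC
    + b * (A * Lam + 2 * Lam + 4 + 2 * B * A ^ 2 * b * Lam ^ 2) * (2 * r ^ 2 * σC)

/-- Displacements and mean gradients cancel between the three estimates. Hypothesis `hc` lets the
contraction `s + s²` of the compression error pay for its feedback through `xhat`, and the reserve
from `consensus_coeff_le` pays the consensus error in the cost. -/
lemma Valid.lyap_succ_le (hR : R.Valid P Q φ r σC σ Lf) (hφ : 0 < φ) (hn : 0 < n)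
    (hA : Admissible R.β₂ R.β₁ R.ω lam Lam (7 + 8 / (R.α * r * φ)) Lf)
    (hc : R.β₂ * (R.β₁ * Lam + 2 * Lam + 4
      + 2 * (7 + 8 / (R.α * r * φ)) * R.β₁ ^ 2 * R.β₂ * Lam ^ 2) * r0 φ r ≤
        R.α * r * φ + (R.α * r * φ) ^ 2)
    (hU : IsEigenbasis R.W lam Lam U μ) (hcol : ∀ j, ∑ i, laplacian R.W i j = 0)
    (hb : BddBelow (Set.range R.p.cost)) (k : ℕ) :
    R.lyap P U μ (7 + 8 / (R.α * r * φ)) (k + 1) ≤ R.lyap P U μ (7 + 8 / (R.α * r * φ)) k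
      - R.β₂ / 4 * ∫ a, ∑ i, ‖R.x k a i - mean (R.x k a)‖ ^ 2 ∂P
      + n * (noiseConst R.β₂ lam (7 + 8 / (R.α * r * φ)) Lf σ * (1 / R.ω ^ 2))
      + n * (compConst R.β₂ R.β₁ Lam (7 + 8 / (R.α * r * φ)) R.α r φ σC * (R.h₀ ^ k) ^ 2) := by
  have hφ₁ : 0 < R.α * r * φ := mul_pos (mul_pos hR.α_pos hR.r_pos) hφ
  have hn' : (0 : ℝ) < n := by exact_mod_cast hn
  have hω := hA.ω_pos
  have hb2 := hA.b_pos
  have hLam : 0 ≤ Lam := hA.lam_pos.le.trans hA.lam_le_Lam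
  have hA1 := hA.one_lt_A
  have hB := hA.le_B
  have hη : 0 ≤ R.β₂ / R.ω := by positivity
  have hη1 : R.β₂ / R.ω ≤ 1 := by
    rw [div_le_one hω]; linarith [hA.b_le, hA.third_lt_ω]
  have hηL : 4 * (R.β₂ / R.ω) * Lf ≤ 1 := by
    have := hA.stepsize
    rw [show 4 * (R.β₂ / R.ω) * Lf = 4 * R.β₂ * Lf / R.ω by ring, div_le_one hω]
    exact this
  have h1 := hR.integral_consensusLyap_succ_le hA hU hcol k
  have h2 := hR.integral_compression_succ_le hφ k
  have h3 := hR.integral_cost_succ_le hb hcol hη hηL k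
  have h4 := hR.integral_xhat_sub_le k
  have h5 := hR.integral_noise_sum_le k
  have hF : 0 ≤ ∫ a, ‖gradient R.p.cost (mean (R.x k a))‖ ^ 2 ∂P :=
    integral_nonneg fun a => sq_nonneg _
  have hu : 0 ≤ ∫ a, ∑ i, ‖R.x k a i - R.c k a i‖ ^ 2 ∂P :=
    integral_nonneg fun a => Finset.sum_nonneg fun i _ => sq_nonneg _
  have e0 : (7 + 8 / (R.α * r * φ) - 3) / 2 = 2 + 4 / (R.α * r * φ) := by ring
  rw [e0] at h1
  unfold lyap noiseConst compConst
  have hK : 0 ≤ R.β₂ * (9 + 16 / lam + 16 * R.β₂ ^ 2 + 7 * (7 + 8 / (R.α * r * φ)) * R.β₂)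
      * (1 / R.ω ^ 2) := by
    have := hA.lam_pos
    positivity
  have hce : 0 ≤ R.β₂ * (R.β₁ * Lam + 2 * Lam + 4
      + 2 * (7 + 8 / (R.α * r * φ)) * R.β₁ ^ 2 * R.β₂ * Lam ^ 2) := by positivity
  have hm0 : 0 ≤ 3 + 3 * (7 + 8 / (R.α * r * φ)) * (R.β₂ / R.ω) := by positivity
  have hm1 : 3 + 3 * (7 + 8 / (R.α * r * φ)) * (R.β₂ / R.ω) ≤
      3 + 3 * (7 + 8 / (R.α * r * φ)) := by
    have := mul_le_mul_of_nonneg_left hη1 (by positivity : 0 ≤ 3 * (7 + 8 / (R.α * r * φ)))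
    linarith
  set B := 7 + 8 / (R.α * r * φ)
  set m := 3 + 3 * B * (R.β₂ / R.ω)
  set s := R.α * r * φ
  set ce := R.β₂ * (R.β₁ * Lam + 2 * Lam + 4 + 2 * B * R.β₁ ^ 2 * R.β₂ * Lam ^ 2)
  set K := R.β₂ * (9 + 16 / lam + 16 * R.β₂ ^ 2 + 7 * B * R.β₂)
  set η := R.β₂ / R.ω with hηdef
  set w' := ∫ a, consensusLyap R.β₁ U μ (R.x (k + 1) a) (R.dual (k + 1) a) ∂P
  set w := ∫ a, consensusLyap R.β₁ U μ (R.x k a) (R.dual k a) ∂P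
  set dd := ∫ a, ∑ i, ‖R.x (k + 1) a i - R.x k a i‖ ^ 2 ∂P
  set DD := ∫ a, ∑ i, ‖R.x k a i - mean (R.x k a)‖ ^ 2 ∂P
  set ee := ∫ a, ∑ i, ‖R.xhat k a i - R.x k a i‖ ^ 2 ∂P
  set gg := ∫ a, ‖mean (R.grad k a)‖ ^ 2 ∂P
  set NN := ∫ a, ∑ i, ‖R.noise k a i‖ ^ 2 ∂P
  set uu := ∫ a, ∑ i, ‖R.x k a i - R.c k a i‖ ^ 2 ∂P
  set uu' := ∫ a, ∑ i, ‖R.x (k + 1) a i - R.c (k + 1) a i‖ ^ 2 ∂P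
  set F := ∫ a, ‖gradient R.p.cost (mean (R.x k a))‖ ^ 2 ∂P
  set cc := ∫ a, R.p.cost (mean (R.x k a)) ∂P
  set cc' := ∫ a, R.p.cost (mean (R.x (k + 1) a)) ∂P
  set t := (R.h₀ ^ k) ^ 2
  clear_value w' w dd DD ee gg NN uu uu' F cc cc' t
  have g1 : m * (n * cc') ≤ m * (n * cc) - 3 / 8 * η * m * (n * gg)
      + R.β₂ * (m * Lf ^ 2 / (2 * R.ω)) * DD
      + m * (Lf / 2 * R.β₂ ^ 2 * σ ^ 2) * (1 / R.ω ^ 2) := by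
    have q1 := mul_le_mul_of_nonneg_left h3 (mul_nonneg hm0 hn'.le)
    have q2 : m * n * (cc - η / 2 * F - 3 / 8 * η * gg + η / 2 * (Lf ^ 2 * (1 / n * DD))
        + Lf / 2 * η ^ 2 * (σ ^ 2 / n)) = m * (n * cc) - m * n * (η / 2) * F
        - 3 / 8 * η * m * (n * gg) + R.β₂ * (m * Lf ^ 2 / (2 * R.ω)) * DD
        + m * (Lf / 2 * R.β₂ ^ 2 * σ ^ 2) * (1 / R.ω ^ 2) := by
      clear_value m
      rw [hηdef]
      field_simp
    have q3 : 0 ≤ m * n * (η / 2) * F := by positivity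
    rw [q2] at q1
    linarith
  have hLf := hR.Lf_pos
  -- The gain `1/n` in the cost noise is given up here: the consensus noise is of order `n/ω²`
  -- anyway.
  have g2 : m * (Lf / 2 * R.β₂ ^ 2 * σ ^ 2) * (1 / R.ω ^ 2) ≤
      n * ((3 + 3 * B) * (Lf / 2 * R.β₂ ^ 2 * σ ^ 2) * (1 / R.ω ^ 2)) := by
    have hn1 : (1 : ℝ) ≤ n := by exact_mod_cast hn
    have q1 : m * (Lf / 2 * R.β₂ ^ 2 * σ ^ 2) * (1 / R.ω ^ 2) ≤
      (3 + 3 * B) * (Lf / 2 * R.β₂ ^ 2 * σ ^ 2) * (1 / R.ω ^ 2) := by gcongr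
    have q2 : 0 ≤ (3 + 3 * B) * (Lf / 2 * R.β₂ ^ 2 * σ ^ 2) * (1 / R.ω ^ 2) := by positivity
    exact q1.trans (le_mul_of_one_le_left q2 hn1)
  have g3 := mul_le_mul_of_nonneg_left h4 hce
  have g4 := mul_le_mul_of_nonneg_left h5 hK
  have g5 := mul_le_mul_of_nonneg_right hc hu
  clear_value m ce K η s B
  linarith

end Lyapunov

end Run

/-! ### Convergence rates -/

lemma sum_geometric_sq_le {h : ℝ} (h0 : 0 < h) (h1 : h < 1) (T : ℕ) :
    ∑ k ∈ Finset.range T, (h ^ k) ^ 2 ≤ 1 / (1 - h ^ 2) := by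
  have hh : h ^ 2 < 1 := by nlinarith
  have e : ∀ k : ℕ, (h ^ k) ^ 2 = (h ^ 2) ^ k := fun k => by rw [← pow_mul, ← pow_mul, mul_comm]
  simp only [e]
  rw [one_div, ← tsum_geometric_of_lt_one (by positivity) hh]
  exact (summable_geometric_of_lt_one (by positivity) hh).sum_le_tsum _
    fun k _ => by positivity

lemma sum_range_le_of_succ_le {V e d : ℕ → ℝ} (h : ∀ k, V (k + 1) ≤ V k - d k + e k) (T : ℕ) :
    ∑ k ∈ Finset.range T, d k ≤ V 0 - V T + ∑ k ∈ Finset.range T, e k := by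
  induction T with
  | zero => simp
  | succ T ih =>
    rw [Finset.sum_range_succ, Finset.sum_range_succ]
    linarith [h T]

namespace Run

section Rates

variable {n d : ℕ} {Ξ : Fin n → Type*} [∀ i, MeasurableSpace (Ξ i)] {Z Ω : Type*}
  [MeasurableSpace Z] [mΩ : MeasurableSpace Ω] {R : Run n d Ξ Z Ω} {P : Measure Ω}
  [IsProbabilityMeasure P] {Q : Measure Z} {φ r σC σ Lf lam Lam Δ₀ R₀ G₀ : ℝ}
  {U : Fin n → Fin n → ℝ} {μ : Fin n → ℝ}

/-- The constant of the consensus rate. -/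
noncomputable def consensusConst (b A lam Lam Lf φ r α h₀ σ σC Δ₀ R₀ G₀ : ℝ) : ℝ :=
  4 / b * (4 * |R₀| + 9 * ((1 + A) / lam + 1 / lam ^ 2) * |G₀|
    + (3 + 3 * (7 + 8 / (α * r * φ))) * |Δ₀|
    + compConst b A Lam (7 + 8 / (α * r * φ)) α r φ σC * (1 / (1 - h₀ ^ 2))
    + noiseConst b lam (7 + 8 / (α * r * φ)) Lf σ)

/-- The constant of the leading terms of the gradient rate. -/
noncomputable def gradientConst (b Lf σ Δ₀ : ℝ) : ℝ := 2 * |Δ₀| / b + Lf * b * σ ^ 2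

/-- At time zero `v` and `c` vanish, so the consensus form and the compression error each contribute
`2 ∑ᵢ ‖x_{i,0}‖²`. At time `T` the function is at least its weight times `n f^*`. -/
lemma Valid.lyap_zero_sub_le (hR : R.Valid P Q φ r σC σ Lf) (hφ : 0 < φ) (hn : 0 < n)
    (hA : Admissible R.β₂ R.β₁ R.ω lam Lam (7 + 8 / (R.α * r * φ)) Lf)
    (hU : IsEigenbasis R.W lam Lam U μ) (hb : BddBelow (Set.range R.p.cost))
    (hΔ : R.p.cost (mean R.x₀) - (⨅ x, R.p.cost x) ≤ Δ₀)
    (hR₀ : (1 / (n : ℝ)) * ∑ i, ‖R.x₀ i‖ ^ 2 ≤ R₀)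
    (hG₀ : (1 / (n : ℝ)) * ∑ i, ‖gradient (R.p.localCost i) (mean R.x₀)‖ ^ 2 ≤ G₀) (T : ℕ) :
    R.lyap P U μ (7 + 8 / (R.α * r * φ)) 0 - R.lyap P U μ (7 + 8 / (R.α * r * φ)) T ≤
      n * (4 * |R₀| + 9 * ((1 + R.β₁) / lam + 1 / lam ^ 2) * |G₀|
        + (3 + 3 * (7 + 8 / (R.α * r * φ))) * |Δ₀|) := by
  have hφ₁ : 0 < R.α * r * φ := mul_pos (mul_pos hR.α_pos hR.r_pos) hφ
  have hn' : (0 : ℝ) < n := by exact_mod_cast hn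
  have hω := hA.ω_pos
  have hb2 := hA.b_pos
  have hl := hA.lam_pos
  have hA1 := hA.one_lt_A
  have hη1 : R.β₂ / R.ω ≤ 1 := by
    rw [div_le_one hω]; linarith [hA.b_le, hA.third_lt_ω]
  set B := 7 + 8 / (R.α * r * φ) with hB
  have hB0 : 0 ≤ B := by positivity
  set m := 3 + 3 * B * (R.β₂ / R.ω) with hm
  have hm0 : 0 ≤ m := by positivity
  have hm1 : m ≤ 3 + 3 * B := by
    have := mul_le_mul_of_nonneg_left hη1 (by positivity : 0 ≤ 3 * B)
    linarith
  have hfT : (⨅ x, R.p.cost x) ≤ ∫ a, R.p.cost (mean (R.x T a)) ∂P := by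
    have := integral_mono (μ := P) (integrable_const (⨅ x, R.p.cost x)) (hR.integrable_cost hb T)
      fun a => ciInf_le hb _
    simpa using this
  have hT : m * (n * ⨅ x, R.p.cost x) ≤ R.lyap P U μ B T := by
    have h1 : 0 ≤ ∫ a, consensusLyap R.β₁ U μ (R.x T a) (R.dual T a) ∂P :=
      integral_nonneg fun a => hU.consensusLyap_nonneg (by linarith) hl
        (by linarith [hA.A_mul_lam]) _ _
    have h2 : 0 ≤ ∫ a, ∑ i, ‖R.x T a i - R.c T a i‖ ^ 2 ∂P :=
      integral_nonneg fun a => Finset.sum_nonneg fun i _ => sq_nonneg _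
    have h3 : m * (n * ⨅ x, R.p.cost x) ≤ m * (n * ∫ a, R.p.cost (mean (R.x T a)) ∂P) := by
      gcongr
    unfold lyap
    linarith
  have hsumR : ∑ i, ‖R.x₀ i‖ ^ 2 ≤ n * |R₀| := by
    have h1 := hR₀.trans (le_abs_self R₀)
    rw [one_div, inv_mul_le_iff₀ hn'] at h1
    exact h1
  have hsumG : ∑ i, ‖gradient (R.p.localCost i) (mean R.x₀)‖ ^ 2 ≤ n * |G₀| := by
    have h1 := hG₀.trans (le_abs_self G₀)
    rw [one_div, inv_mul_le_iff₀ hn'] at h1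
    exact h1
  have hω9 : (1 / R.ω) ^ 2 ≤ 9 := by
    have h1 : 1 / R.ω ≤ 3 := by rw [div_le_iff₀ hω]; linarith [hA.third_lt_ω]
    have h2 : 0 ≤ 1 / R.ω := by positivity
    nlinarith
  have h0 : R.lyap P U μ B 0 ≤ n * (4 * |R₀| + 9 * ((1 + R.β₁) / lam + 1 / lam ^ 2) * |G₀|)
      + m * (n * R.p.cost (mean R.x₀)) := by
    unfold lyap
    have e1 : ∀ a, R.dual 0 a =
        fun i => (1 / R.ω) • gradient (R.p.localCost i) (mean R.x₀) := by
      intro a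
      funext i
      rw [dual, v_zero, zero_add, x_zero]
    simp only [e1, x_zero, c_zero, sub_zero, integral_const, probReal_univ, one_smul]
    have h1 := hU.consensusLyap_le (A := R.β₁) (by linarith) hl R.x₀
      (fun i => (1 / R.ω) • gradient (R.p.localCost i) (mean R.x₀))
    simp only [norm_smul, mul_pow, Real.norm_eq_abs, sq_abs, ← Finset.mul_sum] at h1
    have h2 : (1 / R.ω) ^ 2 * ∑ i, ‖gradient (R.p.localCost i) (mean R.x₀)‖ ^ 2 ≤
        9 * (n * |G₀|) := by gcongr
    have hcoef : 0 ≤ (1 + R.β₁) / lam + 1 / lam ^ 2 := by positivity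
    have h3 := mul_le_mul_of_nonneg_left h2 hcoef
    linarith
  have hΔ' : m * (n * R.p.cost (mean R.x₀)) - m * (n * ⨅ x, R.p.cost x) ≤
      n * ((3 + 3 * B) * |Δ₀|) := by
    have h1 : m * (n * R.p.cost (mean R.x₀)) - m * (n * ⨅ x, R.p.cost x) =
      n * (m * (R.p.cost (mean R.x₀) - ⨅ x, R.p.cost x)) := by ring
    rw [h1]
    have h2 := hΔ.trans (le_abs_self Δ₀)
    have h3 : m * (R.p.cost (mean R.x₀) - ⨅ x, R.p.cost x) ≤ (3 + 3 * B) * |Δ₀| :=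
      (mul_le_mul_of_nonneg_left h2 hm0).trans
        (mul_le_mul_of_nonneg_right hm1 (abs_nonneg _))
    gcongr
  linarith

/-- Telescoping `lyap_succ_le`, with the absolute compression errors summed as a geometric series.
The factor `4/β₂` in the constant inverts the decrease rate. -/
lemma Valid.timeAvg_consensusError_le (hR : R.Valid P Q φ r σC σ Lf) (hφ : 0 < φ) (hn : 0 < n)
    (hσC : 0 ≤ σC) (hh : R.h₀ < 1)
    (hA : Admissible R.β₂ R.β₁ R.ω lam Lam (7 + 8 / (R.α * r * φ)) Lf)
    (hc : R.β₂ * (R.β₁ * Lam + 2 * Lam + 4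
      + 2 * (7 + 8 / (R.α * r * φ)) * R.β₁ ^ 2 * R.β₂ * Lam ^ 2) * r0 φ r ≤
        R.α * r * φ + (R.α * r * φ) ^ 2)
    (hU : IsEigenbasis R.W lam Lam U μ) (hcol : ∀ j, ∑ i, laplacian R.W i j = 0)
    (hb : BddBelow (Set.range R.p.cost))
    (hΔ : R.p.cost (mean R.x₀) - (⨅ x, R.p.cost x) ≤ Δ₀)
    (hR₀ : (1 / (n : ℝ)) * ∑ i, ‖R.x₀ i‖ ^ 2 ≤ R₀)
    (hG₀ : (1 / (n : ℝ)) * ∑ i, ‖gradient (R.p.localCost i) (mean R.x₀)‖ ^ 2 ≤ G₀)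
    {T : ℕ} (hT : 0 < T) :
    0 ≤ consensusConst R.β₂ R.β₁ lam Lam Lf φ r R.α R.h₀ σ σC Δ₀ R₀ G₀ ∧
    timeAvg P (fun k a => consensusError (R.x k a)) T ≤
      consensusConst R.β₂ R.β₁ lam Lam Lf φ r R.α R.h₀ σ σC Δ₀ R₀ G₀ * (1 / T)
        + consensusConst R.β₂ R.β₁ lam Lam Lf φ r R.α R.h₀ σ σC Δ₀ R₀ G₀ * (1 / R.ω ^ 2) := by
  have hφ₁ : 0 < R.α * r * φ := mul_pos (mul_pos hR.α_pos hR.r_pos) hφ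
  have hn' : (0 : ℝ) < n := by exact_mod_cast hn
  have hT' : (0 : ℝ) < T := by exact_mod_cast hT
  have hω := hA.ω_pos
  have hb2 := hA.b_pos
  have hl := hA.lam_pos
  have hA1 := hA.one_lt_A
  have hLam : 0 < Lam := hl.trans_le hA.lam_le_Lam
  have hLf := hR.Lf_pos
  have hαp := hR.α_pos
  have hrp := hR.r_pos
  have hsum := sum_range_le_of_succ_le (V := R.lyap P U μ (7 + 8 / (R.α * r * φ)))
    (d := fun k => R.β₂ / 4 * ∫ a, ∑ i, ‖R.x k a i - mean (R.x k a)‖ ^ 2 ∂P)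
    (e := fun k => n * (noiseConst R.β₂ lam (7 + 8 / (R.α * r * φ)) Lf σ * (1 / R.ω ^ 2))
      + n * (compConst R.β₂ R.β₁ Lam (7 + 8 / (R.α * r * φ)) R.α r φ σC * (R.h₀ ^ k) ^ 2))
    (fun k => by linarith [hR.lyap_succ_le hφ hn hA hc hU hcol hb k]) T
  have h0 := hR.lyap_zero_sub_le hφ hn hA hU hb hΔ hR₀ hG₀ T
  have hgeo := sum_geometric_sq_le hR.h₀_pos hh T
  have hK2 : 0 ≤ compConst R.β₂ R.β₁ Lam (7 + 8 / (R.α * r * φ)) R.α r φ σC := by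
    unfold compConst
    positivity
  have hK1 : 0 ≤ noiseConst R.β₂ lam (7 + 8 / (R.α * r * φ)) Lf σ := by
    unfold noiseConst
    positivity
  have hC0 : 0 ≤ 4 * |R₀| + 9 * ((1 + R.β₁) / lam + 1 / lam ^ 2) * |G₀|
        + (3 + 3 * (7 + 8 / (R.α * r * φ))) * |Δ₀| := by positivity
  have havg : timeAvg P (fun k a => consensusError (R.x k a)) T = 1 / T * (1 / n *
      ∑ k ∈ Finset.range T, ∫ a, ∑ i, ‖R.x k a i - mean (R.x k a)‖ ^ 2 ∂P) := by
    simp only [timeAvg, consensusError, integral_const_mul, ← Finset.mul_sum]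
  have hgeo0 : 0 ≤ 1 / (1 - R.h₀ ^ 2) :=
    le_trans (Finset.sum_nonneg fun k _ => sq_nonneg (R.h₀ ^ k)) hgeo
  rw [havg]
  unfold consensusConst
  set K1 := noiseConst R.β₂ lam (7 + 8 / (R.α * r * φ)) Lf σ
  set K2 := compConst R.β₂ R.β₁ Lam (7 + 8 / (R.α * r * φ)) R.α r φ σC
  set C0 := 4 * |R₀| + 9 * ((1 + R.β₁) / lam + 1 / lam ^ 2) * |G₀|
        + (3 + 3 * (7 + 8 / (R.α * r * φ))) * |Δ₀|
  set g := 1 / (1 - R.h₀ ^ 2)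
  refine ⟨by positivity, ?_⟩
  simp only [Finset.sum_add_distrib, ← Finset.mul_sum, Finset.sum_const, Finset.card_range,
    nsmul_eq_mul] at hsum
  set S := ∑ k ∈ Finset.range T, ∫ a, ∑ i, ‖R.x k a i - mean (R.x k a)‖ ^ 2 ∂P
  have h1 : R.β₂ / 4 * S ≤ n * (C0 + K2 * g + T * (K1 * (1 / R.ω ^ 2))) := by
    have h2 : n * (K2 * ∑ k ∈ Finset.range T, (R.h₀ ^ k) ^ 2) ≤ n * (K2 * g) := by gcongr
    linarith
  clear_value S K1 K2 C0 g
  have h3 : 1 / (T : ℝ) * (1 / n * S) ≤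
      4 / R.β₂ * (1 / T) * (C0 + K2 * g + T * (K1 * (1 / R.ω ^ 2))) := by
    have h4 : 1 / (T : ℝ) * (1 / n * S) = 4 / R.β₂ * (1 / T) * (1 / n * (R.β₂ / 4 * S)) := by
      field_simp
    rw [h4]
    refine mul_le_mul_of_nonneg_left ?_ (by positivity)
    rw [one_div, inv_mul_le_iff₀ hn']
    exact h1
  have h5 : 4 / R.β₂ * (1 / T) * (C0 + K2 * g + T * (K1 * (1 / R.ω ^ 2))) =
      4 / R.β₂ * (C0 + K2 * g) * (1 / T) + 4 / R.β₂ * K1 * (1 / R.ω ^ 2) := by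
    field_simp
  have hK2g : 0 ≤ K2 * g := by positivity
  have h6 : 4 / R.β₂ * (C0 + K2 * g) * (1 / T) ≤ 4 / R.β₂ * (C0 + K2 * g + K1) * (1 / T) :=
    mul_le_mul_of_nonneg_right (mul_le_mul_of_nonneg_left (by linarith) (by positivity))
      (by positivity)
  have h7 : 4 / R.β₂ * K1 * (1 / R.ω ^ 2) ≤ 4 / R.β₂ * (C0 + K2 * g + K1) * (1 / R.ω ^ 2) :=
    mul_le_mul_of_nonneg_right (mul_le_mul_of_nonneg_left (by linarith) (by positivity))
      (by positivity)
  linarith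

/-- Telescoping the cost descent alone keeps the graph and the compressor out of the leading terms;
they enter only through the averaged consensus error. -/
lemma Valid.timeAvg_gradient_le (hR : R.Valid P Q φ r σC σ Lf) (hn : 0 < n) (hβ : 0 < R.β₂)
    (hω : 0 < R.ω) (hstep : 4 * R.β₂ * Lf ≤ R.ω) (hcol : ∀ j, ∑ i, laplacian R.W i j = 0)
    (hb : BddBelow (Set.range R.p.cost))
    (hΔ : R.p.cost (mean R.x₀) - (⨅ x, R.p.cost x) ≤ Δ₀) {T : ℕ} (hT : 0 < T) :
    timeAvg P (fun k a => ‖gradient R.p.cost (mean (R.x k a))‖ ^ 2) T ≤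
      gradientConst R.β₂ Lf σ Δ₀ * (R.ω / T) + gradientConst R.β₂ Lf σ Δ₀ * (1 / (n * R.ω))
        + Lf ^ 2 * timeAvg P (fun k a => consensusError (R.x k a)) T := by
  have hn' : (0 : ℝ) < n := by exact_mod_cast hn
  have hT' : (0 : ℝ) < T := by exact_mod_cast hT
  have hLf := hR.Lf_pos
  have hη : 0 < R.β₂ / R.ω := by positivity
  have hηL : 4 * (R.β₂ / R.ω) * Lf ≤ 1 := by
    rw [show 4 * (R.β₂ / R.ω) * Lf = 4 * R.β₂ * Lf / R.ω by ring, div_le_one hω]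
    exact hstep
  have hsum := sum_range_le_of_succ_le (V := fun k => ∫ a, R.p.cost (mean (R.x k a)) ∂P)
    (d := fun k => R.β₂ / R.ω / 2 * ∫ a, ‖gradient R.p.cost (mean (R.x k a))‖ ^ 2 ∂P)
    (e := fun k => R.β₂ / R.ω / 2 * (Lf ^ 2 * (1 / (n : ℝ) *
          ∫ a, ∑ i, ‖R.x k a i - mean (R.x k a)‖ ^ 2 ∂P))
        + Lf / 2 * (R.β₂ / R.ω) ^ 2 * (σ ^ 2 / n))
    (fun k => by
      have h1 := hR.integral_cost_succ_le hb hcol hη.le hηL k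
      have h2 : 0 ≤ 3 / 8 * (R.β₂ / R.ω) * ∫ a, ‖mean (R.grad k a)‖ ^ 2 ∂P :=
        mul_nonneg (by positivity) (integral_nonneg fun a => sq_nonneg _)
      linarith) T
  have hfT : (⨅ x, R.p.cost x) ≤ ∫ a, R.p.cost (mean (R.x T a)) ∂P := by
    have := integral_mono (μ := P) (integrable_const (⨅ x, R.p.cost x)) (hR.integrable_cost hb T)
      fun a => ciInf_le hb _
    simpa using this
  have hf0 : ∫ a, R.p.cost (mean (R.x 0 a)) ∂P = R.p.cost (mean R.x₀) := by
    simp [x_zero]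
  have havg : timeAvg P (fun k a => consensusError (R.x k a)) T = 1 / T * (1 / n *
      ∑ k ∈ Finset.range T, ∫ a, ∑ i, ‖R.x k a i - mean (R.x k a)‖ ^ 2 ∂P) := by
    simp only [timeAvg, consensusError, integral_const_mul, ← Finset.mul_sum]
  simp only [Finset.sum_add_distrib, ← Finset.mul_sum, Finset.sum_const, Finset.card_range,
    nsmul_eq_mul] at hsum
  rw [havg, timeAvg]
  unfold gradientConst
  rw [hf0] at hsum
  set S := ∑ k ∈ Finset.range T, ∫ a, ∑ i, ‖R.x k a i - mean (R.x k a)‖ ^ 2 ∂P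
  set F := ∑ k ∈ Finset.range T, ∫ a, ‖gradient R.p.cost (mean (R.x k a))‖ ^ 2 ∂P
  clear_value S F
  have h1 : R.β₂ / R.ω / 2 * F ≤ |Δ₀| + (R.β₂ / R.ω / 2 * (Lf ^ 2 * (1 / n * S))
      + T * (Lf / 2 * (R.β₂ / R.ω) ^ 2 * (σ ^ 2 / n))) := by
    linarith [le_abs_self Δ₀]
  have h2 := mul_le_mul_of_nonneg_left h1
    (by positivity : 0 ≤ 1 / (T : ℝ) * (2 * (R.ω / R.β₂)))
  have e1 : 1 / (T : ℝ) * (2 * (R.ω / R.β₂)) * (R.β₂ / R.ω / 2 * F) = 1 / T * F := by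
    field_simp
  have e2 : 1 / (T : ℝ) * (2 * (R.ω / R.β₂)) * (|Δ₀| + (R.β₂ / R.ω / 2 * (Lf ^ 2 * (1 / n * S))
      + T * (Lf / 2 * (R.β₂ / R.ω) ^ 2 * (σ ^ 2 / n)))) =
      2 * |Δ₀| / R.β₂ * (R.ω / T) + Lf * R.β₂ * σ ^ 2 * (1 / (n * R.ω))
        + Lf ^ 2 * (1 / T * (1 / n * S)) := by
    field_simp
    ring
  rw [e1, e2] at h2
  have p1 : 0 ≤ Lf * R.β₂ * σ ^ 2 * (R.ω / T) := by positivity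
  have p2 : 0 ≤ 2 * |Δ₀| / R.β₂ * (1 / (n * R.ω)) := by positivity
  linarith

end Rates

end Run

end RCPSGD

/-! ### Choice of the constants and assembly of both rates. -/

theorem theorem1
    (Lf σ β₂ Δ₀ : ℝ) (hLf : 0 < Lf) (hσ : 0 < σ) (hβ₂ : 0 < β₂) :
    -- the constant of the leading terms: independent of the graph, of `n` and of the compressor
    ∃ C₁ : ℝ, 0 < C₁ ∧
    ∀ (φ r σC α h₀ β₁ β₅ lam Lam R₀ G₀ : ℝ),
      0 < φ → φ ≤ 1 → 0 < r → 0 ≤ σC → 0 < α → α < 1 / r → 0 < h₀ → h₀ < 1 →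
      0 < lam → 0 < β₅ → RCPSGD.c0 lam β₅ < β₁ →
    -- the constant of the remaining terms: depends on the graph only through `lam` and `Lam`
    ∃ C₂ : ℝ, 0 < C₂ ∧
    ∀ (n d : ℕ) (G : SimpleGraph (Fin n)) (W : Matrix (Fin n) (Fin n) ℝ)
      (Ξ : Fin n → Type*) [∀ i, MeasurableSpace (Ξ i)]
      (Z : Type*) [MeasurableSpace Z]
      (Ω : Type*) [MeasurableSpace Ω] (P : MeasureTheory.Measure Ω)
      [MeasureTheory.IsProbabilityMeasure P]
      (p : RCPSGD.Problem n d Ξ) (Q : MeasureTheory.Measure Z)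
      (C : RCPSGD.Vec d → Z → RCPSGD.Vec d)
      (ξ : ∀ i, ℕ → Ω → Ξ i) (ζ : Fin n → ℕ → Ω → Z) (x₀ : Fin n → RCPSGD.Vec d),
      -- connected weighted graph
      G.Connected → RCPSGD.IsWeightMatrix G W →
      RCPSGD.IsMinPosEigenvalue (RCPSGD.laplacian W) lam →
      RCPSGD.IsMaxEigenvalue (RCPSGD.laplacian W) Lam →
      -- cost functions, stochastic gradients, compressor, sampling
      p.WellPosed → p.Smooth Lf → p.UnbiasedBoundedVariance σ →
      BddBelow (Set.range p.cost) →
      RCPSGD.IsCompressor Q C φ r σC →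
      RCPSGD.IsSampling p.D Q P ξ ζ →
      -- the sizes of the initial data on which the constants depend
      p.cost (RCPSGD.mean x₀) - (⨅ x, p.cost x) ≤ Δ₀ →
      (1 / (n : ℝ)) * ∑ i, ‖x₀ i‖ ^ 2 ≤ R₀ →
      (1 / (n : ℝ)) * ∑ i, ‖gradient (p.localCost i) (RCPSGD.mean x₀)‖ ^ 2 ≤ G₀ →
      -- constant `ω` above the threshold
      (∀ ω : ℝ, RCPSGD.beta3 lam Lam Lf φ r α β₁ β₂ β₅ ω < ω →
        (∀ k, MeasureTheory.Integrable (fun a => RCPSGD.consensusError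
            (RCPSGD.primal p W C x₀ ξ ζ β₁ β₂ α h₀ ω k a)) P) ∧
        (∀ k, MeasureTheory.Integrable (fun a => ‖gradient p.cost (RCPSGD.mean
            (RCPSGD.primal p W C x₀ ξ ζ β₁ β₂ α h₀ ω k a))‖ ^ 2) P) ∧
        ∀ T : ℕ, 0 < T →
          RCPSGD.timeAvg P (fun k a => RCPSGD.consensusError
              (RCPSGD.primal p W C x₀ ξ ζ β₁ β₂ α h₀ ω k a)) T
            ≤ C₂ * (1 / T) + C₂ * (1 / ω ^ 2) ∧
          RCPSGD.timeAvg P (fun k a => ‖gradient p.cost (RCPSGD.mean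
              (RCPSGD.primal p W C x₀ ξ ζ β₁ β₂ α h₀ ω k a))‖ ^ 2) T
            ≤ C₁ * (ω / T) + C₁ * (1 / (n * ω)) + C₂ * (1 / T) + C₂ * (1 / ω ^ 2)) ∧
      -- `ω = β₂ √T / √n`
      (∀ (T : ℕ) (ω : ℝ), 0 < T → ω = β₂ * Real.sqrt T / Real.sqrt n →
        n * (RCPSGD.beta3 lam Lam Lf φ r α β₁ β₂ β₅ ω / β₂) ^ 2 < T →
          RCPSGD.timeAvg P (fun k a => RCPSGD.consensusError
              (RCPSGD.primal p W C x₀ ξ ζ β₁ β₂ α h₀ ω k a)) T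
            ≤ C₂ * (n / T) ∧
          RCPSGD.timeAvg P (fun k a => ‖gradient p.cost (RCPSGD.mean
              (RCPSGD.primal p W C x₀ ξ ζ β₁ β₂ α h₀ ω k a))‖ ^ 2) T
            ≤ C₁ * (1 / Real.sqrt (n * T)) + C₂ * (n / T)) := by
  have hC1' : 0 < RCPSGD.Run.gradientConst β₂ Lf σ Δ₀ := by
    unfold RCPSGD.Run.gradientConst
    positivity
  -- The factors `β₂` and `1/β₂` come from writing `ω/T` and `1/(nω)` in terms of `1/√(nT)` in part
  -- (b).
  refine ⟨RCPSGD.Run.gradientConst β₂ Lf σ Δ₀ * (1 + (β₂ + 1 / β₂)), by positivity, ?_⟩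
  intro φ r σC α h₀ β₁ β₅ lam Lam R₀ G₀ hφ hφ1 hr hσC hα hα1 hh₀ hh₀1 hlam0 hβ₅ hβ₁
  -- The 1 and the absolute value give positivity before any run is available. The factor `1 + Lf²`
  -- serves both rates, and `1 + 1/β₂²` comes from `1/ω² = n/(β₂²T)`.
  refine ⟨1 + |RCPSGD.Run.consensusConst β₂ β₁ lam Lam Lf φ r α h₀ σ σC Δ₀ R₀ G₀|
    * ((1 + Lf ^ 2) * (1 + 1 / β₂ ^ 2)), by positivity, ?_⟩
  intro n d G W Ξ _ Z _ Ω _ P _ p Q C ξ ζ x₀ hG hW hlam hLam hp hs hu hb hC hS hΔ hR₀ hG₀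
  have hn : 0 < n := Fin.pos_iff_nonempty.2 hG.nonempty
  have hn' : (1 : ℝ) ≤ n := by exact_mod_cast hn
  have hlL : lam ≤ Lam := hLam.2 hlam.1.2
  obtain ⟨U, μ, hU⟩ := RCPSGD.exists_isEigenbasis hG hW hlam hLam
  have hcol := hW.sum_laplacian_col
  have hαr : α * r ≤ 1 := ((lt_div_iff₀ hr).1 hα1).le
  set C1 := RCPSGD.Run.gradientConst β₂ Lf σ Δ₀ with hC1
  set C2 := RCPSGD.Run.consensusConst β₂ β₁ lam Lam Lf φ r α h₀ σ σC Δ₀ R₀ G₀ with hC2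
  have valid : ∀ ω, (RCPSGD.Run.mk p W C x₀ ξ ζ β₁ β₂ α h₀ ω).Valid P Q φ r σC σ Lf :=
    fun ω => ⟨hp, hs, hu, hC, hS, hLf, hφ1, hr, hα, hαr, hh₀⟩
  have rates : ∀ ω, RCPSGD.beta3 lam Lam Lf φ r α β₁ β₂ β₅ ω < ω → ∀ T : ℕ, 0 < T →
      0 ≤ C2 ∧
      RCPSGD.timeAvg P (fun k a => RCPSGD.consensusError
          (RCPSGD.primal p W C x₀ ξ ζ β₁ β₂ α h₀ ω k a)) T
        ≤ C2 * (1 / T) + C2 * (1 / ω ^ 2) ∧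
      RCPSGD.timeAvg P (fun k a => ‖gradient p.cost (RCPSGD.mean
          (RCPSGD.primal p W C x₀ ξ ζ β₁ β₂ α h₀ ω k a))‖ ^ 2) T
        ≤ C1 * (ω / T) + C1 * (1 / (n * ω)) + Lf ^ 2 * (C2 * (1 / T) + C2 * (1 / ω ^ 2)) := by
    intro ω hω T hT
    obtain ⟨hA, hc⟩ := RCPSGD.admissible_of_beta3_lt hφ hφ1 hr hα hα1 hlam0 hlL hβ₅ hβ₁ hβ₂ hLf hω
    have hstep : 4 * β₂ * Lf ≤ ω := by
      refine le_trans ?_ hω.le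
      unfold RCPSGD.beta3
      simp
    obtain ⟨h0, h1⟩ := (valid ω).timeAvg_consensusError_le hφ hn hσC hh₀1 hA hc hU hcol hb hΔ
      hR₀ hG₀ hT
    have h2 := (valid ω).timeAvg_gradient_le hn hβ₂ hA.ω_pos hstep hcol hb hΔ hT
    refine ⟨h0, h1, h2.trans ?_⟩
    exact add_le_add_right (mul_le_mul_of_nonneg_left h1 (sq_nonneg Lf)) _
  clear_value C1 C2
  have hβi : 0 ≤ 1 / β₂ ^ 2 := by positivity
  have hC1_le : C1 ≤ C1 * (1 + (β₂ + 1 / β₂)) :=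
    le_mul_of_one_le_right hC1'.le (by linarith [show 0 ≤ β₂ + 1 / β₂ by positivity])
  constructor
  · intro ω hω
    refine ⟨fun k => ((valid ω).integrable_consensus k).const_mul _,
      fun k => RCPSGD.integrable_norm_sq_vec ((valid ω).memLp_gradient_cost k), fun T hT => ?_⟩
    obtain ⟨h0, h1, h2⟩ := rates ω hω T hT
    have hω0 : 0 < ω := by
      refine lt_of_le_of_lt ?_ hω
      refine le_trans (show 0 ≤ 4 * β₂ * Lf by positivity) ?_
      unfold RCPSGD.beta3
      simp
    have hq : 0 ≤ 1 / (T : ℝ) + 1 / ω ^ 2 := by positivity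
    rw [abs_of_nonneg h0]
    have k1 : C2 ≤ 1 + C2 * ((1 + Lf ^ 2) * (1 + 1 / β₂ ^ 2)) := by
      have : 0 ≤ C2 * (Lf ^ 2 + (1 + Lf ^ 2) * (1 / β₂ ^ 2)) := by positivity
      linarith
    have k2 : Lf ^ 2 * C2 ≤ 1 + C2 * ((1 + Lf ^ 2) * (1 + 1 / β₂ ^ 2)) := by
      have : 0 ≤ C2 * (1 + (1 + Lf ^ 2) * (1 / β₂ ^ 2)) := by positivity
      linarith
    have k3 := mul_le_mul_of_nonneg_right k1 hq
    have k4 := mul_le_mul_of_nonneg_right k2 hq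
    have k5 := mul_le_mul_of_nonneg_right hC1_le
      (show 0 ≤ ω / T + 1 / (n * ω) by positivity)
    constructor <;> linarith
  · intro T ω hT hω hβ₃
    have hT' : (0 : ℝ) < T := by exact_mod_cast hT
    have hn0 : (0 : ℝ) < n := by linarith
    have hsT : 0 < Real.sqrt T := Real.sqrt_pos.2 hT'
    have hsn : 0 < Real.sqrt n := Real.sqrt_pos.2 hn0
    have hω0 : 0 < ω := by rw [hω]; positivity
    have hω2 : ω ^ 2 = β₂ ^ 2 * T / n := by
      rw [hω, div_pow, mul_pow, Real.sq_sqrt hT'.le, Real.sq_sqrt hn0.le]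
    -- Comparing squares needs only `ω ≥ 0`, not the sign of `beta3`.
    have hlt : RCPSGD.beta3 lam Lam Lf φ r α β₁ β₂ β₅ ω < ω := by
      refine lt_of_pow_lt_pow_left₀ 2 hω0.le ?_
      rw [hω2, lt_div_iff₀ hn0]
      rw [div_pow, ← mul_div_assoc, div_lt_iff₀ (by positivity)] at hβ₃
      linarith
    obtain ⟨h0, h1, h2⟩ := rates ω hlt T hT
    rw [abs_of_nonneg h0]
    have e1 : ω / T = β₂ * (1 / Real.sqrt (n * T)) := by
      rw [hω, Real.sqrt_mul hn0.le]
      field_simp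
      rw [Real.sq_sqrt hT'.le]
    have e2 : 1 / (n * ω) = 1 / β₂ * (1 / Real.sqrt (n * T)) := by
      rw [hω, Real.sqrt_mul hn0.le]
      field_simp
      rw [Real.sq_sqrt hn0.le]
    have e3 : 1 / ω ^ 2 = 1 / β₂ ^ 2 * (n / T) := by
      rw [hω2]
      field_simp
    have e4 : 1 / (T : ℝ) ≤ n / T := by gcongr
    rw [e3] at h1 h2
    rw [e1, e2] at h2
    have k0 : C2 * (1 / T) + C2 * (1 / β₂ ^ 2 * (n / T)) ≤ C2 * (1 + 1 / β₂ ^ 2) * (n / T) := by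
      have := mul_le_mul_of_nonneg_left e4 h0
      linarith
    have hq : (0 : ℝ) ≤ n / T := by positivity
    have k1 : C2 * (1 + 1 / β₂ ^ 2) * (n / T) ≤
        (1 + C2 * ((1 + Lf ^ 2) * (1 + 1 / β₂ ^ 2))) * (n / T) := by
      refine mul_le_mul_of_nonneg_right ?_ hq
      have : 0 ≤ C2 * (Lf ^ 2 * (1 + 1 / β₂ ^ 2)) := by positivity
      linarith
    have k2 : Lf ^ 2 * (C2 * (1 + 1 / β₂ ^ 2) * (n / T)) ≤
        (1 + C2 * ((1 + Lf ^ 2) * (1 + 1 / β₂ ^ 2))) * (n / T) := by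
      rw [← mul_assoc]
      refine mul_le_mul_of_nonneg_right ?_ hq
      have : 0 ≤ C2 * (1 + 1 / β₂ ^ 2) := by positivity
      linarith
    have k3 := mul_le_mul_of_nonneg_left k0 (sq_nonneg Lf)
    have k4 : 0 ≤ C1 * (1 / Real.sqrt (n * T)) := by positivity
    constructor <;> linarith
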